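/- **Setting.** Let $d\in\{2,3\}$, $k\ge 1$, and let $\Omega_f,\Omega_s\subset\mathbb R^d$ be disjoint bounded polygonal/polyhedral domains with Lipschitz boundary, $\partial\Omega_f=\Sigma\cup\Gamma_0$ and $\partial\Omega_s=\Sigma\cup\Gamma_D\cup\Gamma_N$, where the parts are closed and those of the same boundary overlap pairwise only in sets of surface measure zero; $n$ denotes unit normals. Let $c,\rho_F,\rho_s,g>0$ be constants, let $E,\nu$ be measurable functions bounded above and bounded away from zero with $\nu\le 1/2$, and put $\mu=\frac{E}{2(1+\nu)}$, $\frac1\lambda=\frac{(1+\nu)(1-2\nu)}{E\nu}$. Let $V=\{v\in H^1(\Omega_s)^d: v=0\text{ on }\Gamma_D\}$, $W=\{\tau\in H(\operatorname{div},\Omega_f):\tau\cdot n\in L^2(\Gamma_0)\}$, $Q=L^2(\Omega_s)$, $Y=\{(v,\tau)\in V\times W: v\cdot n=\tau\cdot n\text{ on }\Sigma\}$, $H=Y\times Q$. For $z=((u,w),p)$ and $z'=((v,\tau),q)$ in $H$ put $$B(z,z')=\int_{\Omega_s}\rho_s u\cdot v+\int_{\Omega_f}\rho_F w\cdot\tau,$$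 $$A(z,z')=\int_{\Omega_s}2\mu\,\varepsilon(u):\varepsilon(v)-\int_{\Omega_s}p\operatorname{div}v+\int_{\Omega_f}c^2\rho_F\operatorname{div}w\operatorname{div}\tau+\int_{\Gamma_0}g\rho_F(w\cdot n)(\tau\cdot n)-\int_{\Omega_s}q\operatorname{div}u-\int_{\Omega_s}\tfrac1\lambda pq+B(z,z').$$ Let $\mathcal T_h$ be a conforming triangulation of $\overline{\Omega_f}$ into triangles/tetrahedra which is shape regular with parameter $\sigma>0$: every $T\in\mathcal T_h$ contains a ball of radius $r>0$ with $h_T=\operatorname{diam}T\le\sigma r$. Let $V_h\subset V$ and $Q_h\subset Q$ be finite-dimensional subspaces (for instance MINI or Taylor–Hood elements), $W_h=\{\tau\in W:\tau|_T\in\mathbb P_k(T)^d\ \forall T\in\mathcal T_h\}$ (Brezzi–Douglas–Marini elements) and $H_h=\{((v,\tau),q)\in H: v\in V_h,\ \tau\in W_h,\ q\in Q_h\}$. Let $\omega,\omega_h>0$ and let $0\ne((u,w),p)\in H$ and $0\ne((u_h,w_h),p_h)\in H_h$ satisfy $$A(((u,w),p),z')=(\omega^2+1)B(((u,w),p),z')\quad\forall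 z'\in H,$$ $$A(((u_h,w_h),p_h),z')=(\omega_h^2+1)B(((u_h,w_h),p_h),z')\quad\forall z'\in H_h.$$ On $T\in\mathcal T_h$ let $R^F_{1,T}=c^2\rho_F\nabla(\operatorname{div}w_h)+\omega_h^2\rho_Fw_h$ and $R^F_{2,T}=\operatorname{rot}(\omega_h^2\rho_Fw_h)$. On a facet $\ell$ shared by two distinct elements $T,T'\in\mathcal T_h$, with outward unit normals $n_T,n_{T'}$, let $$J^F_{1,\ell}=\tfrac12\,c^2\rho_F\big((\operatorname{div}w_h|_T)\,n_T+(\operatorname{div}w_h|_{T'})\,n_{T'}\big),\qquad J^F_{2,\ell}=\tfrac12\,\omega_h^2\rho_F\big(w_h|_T\times n_T+w_h|_{T'}\times n_{T'}\big),$$ let $h_\ell=\operatorname{diam}\ell$ and $\omega_\ell=T\cup T'$. (For $d=2$, $\operatorname{rot}v=\partial_1v_2-\partial_2v_1$ and $v\times n=v_1n_2-v_2n_1$; for $d=3$ they are the usual curl and cross product.) Put $$\rho^F=(c^2\rho_F)^{-1/2},\qquad \rho^F_E=\min\Big\{\tfrac{(c^2\rho_F)^{-1/2}}{\sqrt2},\tfrac{(\omega_h^2\rho_F)^{-1/2}}{\sqrt2}\Big\}.$$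 **Lemma (local efficiency of the fluid estimator).** There is a constant $C>0$, depending only on $d$, $k$, $\sigma$, the domains and their boundary parts, $c$ and $\rho_F$ (in particular, independent of the mesh, of $\nu$, of $\omega,\omega_h$ and of the continuous and discrete solutions), such that for every element $T\in\mathcal T_h$ $$h_T^2\|\rho^FR^F_{1,T}\|_{0,T}^2\le C\Big(\|c\rho_F^{1/2}\operatorname{div}(w-w_h)\|_{0,T}^2+\|(\rho^F)^{-1/2}(\omega_h^2\rho_Fw_h-\omega^2\rho_Fw)\|_{0,T}^2\Big),$$ $$h_T^2\|\rho^FR^F_{2,T}\|_{0,T}^2\le C\,\|(\rho^F)^{-1/2}(\omega_h^2\rho_Fw_h-\omega^2\rho_Fw)\|_{0,T}^2,$$ and for every facet $\ell$ shared by two elements $$h_\ell\|\rho_E^FJ^F_{1,\ell}\|_{0,\ell}^2\le C\Big(\|c\rho_F^{1/2}\operatorname{div}(w-w_h)\|_{0,\omega_\ell}^2+\|(\rho^F)^{-1/2}(\omega_h^2\rho_Fw_h-\omega^2\rho_Fw)\|_{0,\omega_\ell}^2\Big),$$ $$h_\ell\|\rho_E^FJ^F_{2,\ell}\|_{0,\ell}^2\le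 C\,\|(\rho^F)^{-1/2}(\omega_h^2\rho_Fw_h-\omega^2\rho_Fw)\|_{0,\omega_\ell}^2.$$ -/

import Mathlib

open MeasureTheory Set
open scoped InnerProductSpace

noncomputable section

namespace ElastoAcoustic

/-- Euclidean space `ℝ^d`. -/
abbrev Eu (d : ℕ) : Type := EuclideanSpace ℝ (Fin d)

/-- The surface measure on hypersurfaces of `ℝ^d`: the `(d-1)`-dimensional Hausdorff measure,
normalised to agree with the `(d-1)`-dimensional Lebesgue measure on hyperplanes. -/
def surf (d : ℕ) : Measure (Eu d) := μHE[d - 1]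

/-! ### Domains -/

/-- Near each of its boundary points `Ω` is, in suitable orthonormal coordinates, the strict
epigraph of a Lipschitz function of the first `d - 1` coordinates; `e` is the direction of the
last coordinate axis and `y - ⟪e, y⟫ e` holds the other coordinates of `y`. -/
def HasLipschitzBoundary {d : ℕ} (Ω : Set (Eu d)) : Prop :=
  ∀ x ∈ frontier Ω, ∃ e : Eu d, ‖e‖ = 1 ∧ ∃ (L : NNReal) (f : Eu d → ℝ), LipschitzWith L f ∧
    ∃ U ∈ nhds x, ∀ y ∈ U, (y ∈ Ω ↔ f (y - ⟪e, y⟫_ℝ • e) < ⟪e, y⟫_ℝ)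

/-- The simplicial complex `K` is a conforming triangulation of the closure of `Ω`. -/
def IsMesh {d : ℕ} (K : Geometry.SimplicialComplex ℝ (Eu d)) (Ω : Set (Eu d)) : Prop :=
  K.faces.Finite ∧ K.space = closure Ω

/-- Bounded polygonal (polyhedral) domains with Lipschitz boundary. -/
structure IsPolyhedralDomain {d : ℕ} (Ω : Set (Eu d)) : Prop where
  isOpen : IsOpen Ω
  isConnected : IsConnected Ω
  isBounded : Bornology.IsBounded Ω
  lipschitz : HasLipschitzBoundary Ω
  polyhedral : ∃ K : Geometry.SimplicialComplex ℝ (Eu d), IsMesh K Ω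

/-- The fluid domain `Ωf`, the solid domain `Ωs`, the interface `Sig` (the set `Σ`), the open
boundary `Γ0` of the fluid, and the clamped and free parts `ΓD`, `ΓN` of the boundary of the
solid. -/
structure Config (d : ℕ) where
  Ωf : Set (Eu d)
  Ωs : Set (Eu d)
  Sig : Set (Eu d)
  Γ0 : Set (Eu d)
  ΓD : Set (Eu d)
  ΓN : Set (Eu d)
  fluid_domain : IsPolyhedralDomain Ωf
  solid_domain : IsPolyhedralDomain Ωs
  disjoint : Disjoint Ωf Ωs
  closed_Sig : IsClosed Sig
  closed_Γ0 : IsClosed Γ0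
  closed_ΓD : IsClosed ΓD
  closed_ΓN : IsClosed ΓN
  frontier_fluid : frontier Ωf = Sig ∪ Γ0
  frontier_solid : frontier Ωs = Sig ∪ ΓD ∪ ΓN
  null_Sig_Γ0 : surf d (Sig ∩ Γ0) = 0
  null_Sig_ΓD : surf d (Sig ∩ ΓD) = 0
  null_Sig_ΓN : surf d (Sig ∩ ΓN) = 0
  null_ΓD_ΓN : surf d (ΓD ∩ ΓN) = 0

/-! ### Function spaces

An element of a Sobolev space is a representative together with representatives of its weak
derivatives and traces, all of which it determines almost everywhere. -/

/-- Smooth compactly supported functions on `ℝ^d`. -/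
def IsTest {d : ℕ} (φ : Eu d → ℝ) : Prop := ContDiff ℝ ((⊤ : ℕ∞) : WithTop ℕ∞) φ ∧ HasCompactSupport φ

/-- `H(div, Ω)`. -/
structure HDiv {d : ℕ} (Ω : Set (Eu d)) where
  fn : Eu d → Eu d
  div : Eu d → ℝ
  memLp_fn : MemLp fn 2 (volume.restrict Ω)
  memLp_div : MemLp div 2 (volume.restrict Ω)
  weak_div : ∀ φ : Eu d → ℝ, IsTest φ → tsupport φ ⊆ Ω →
    ∫ x in Ω, fderiv ℝ φ x (fn x) = -∫ x in Ω, div x * φ x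

/-- `H¹(Ω)^d`; `grad x i j` is the derivative of the `i`-th component in the `j`-th direction. -/
structure H1Vec {d : ℕ} (Ω : Set (Eu d)) where
  fn : Eu d → Eu d
  grad : Eu d → Fin d → Fin d → ℝ
  memLp_fn : MemLp fn 2 (volume.restrict Ω)
  memLp_grad : ∀ i j, MemLp (fun x => grad x i j) 2 (volume.restrict Ω)
  weak_grad : ∀ i j, ∀ φ : Eu d → ℝ, IsTest φ → tsupport φ ⊆ Ω →
    ∫ x in Ω, fn x i * fderiv ℝ φ x (EuclideanSpace.single j 1) = -∫ x in Ω, grad x i j * φ x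

/-- The divergence of an `H¹` field. -/
def H1Vec.div {d : ℕ} {Ω : Set (Eu d)} (v : H1Vec Ω) (x : Eu d) : ℝ := ∑ i, v.grad x i i

/-- The strain tensor `ε(v)`. -/
def H1Vec.strain {d : ℕ} {Ω : Set (Eu d)} (v : H1Vec Ω) (x : Eu d) (i j : Fin d) : ℝ :=
  (v.grad x i j + v.grad x j i) / 2

variable {d : ℕ}

/-- `V`: the fields in `H¹(Ωs)^d` that vanish on `ΓD` in the sense of traces, i.e. for which the
boundary term of Green's formula vanishes for all `φ` supported away from the rest of the
boundary. -/
structure VSpace (G : Config d) extends H1Vec G.Ωs where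
  clamped : ∀ i j, ∀ φ : Eu d → ℝ, IsTest φ → Disjoint (tsupport φ) (G.Sig ∪ G.ΓN) →
    ∫ x in G.Ωs, fn x i * fderiv ℝ φ x (EuclideanSpace.single j 1)
      = -∫ x in G.Ωs, grad x i j * φ x

/-- `W`: the fields in `H(div, Ωf)` whose normal trace on `Γ0` is a function `ntr` in `L²(Γ0)`;
the normal trace is defined through Green's formula. -/
structure WSpace (G : Config d) extends HDiv G.Ωf where
  ntr : Eu d → ℝ
  memLp_ntr : MemLp ntr 2 ((surf d).restrict G.Γ0)
  green : ∀ φ : Eu d → ℝ, IsTest φ → Disjoint (tsupport φ) G.Sig →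
    (∫ x in G.Ωf, fderiv ℝ φ x (fn x)) + (∫ x in G.Ωf, div x * φ x)
      = ∫ x in G.Γ0, ntr x * φ x ∂(surf d)

/-- `H = Y × Q`: triples `((v, τ), q)` in `V × W × L²(Ωs)` with `v·n - τ·n = 0` on `Σ`. The
transmission condition is imposed weakly, through Green's formula in both domains (the unit
normals outward to `Ωf` and to `Ωs` are opposite to each other on `Σ`). -/
structure HSpace (G : Config d) where
  v : VSpace G
  τ : WSpace G
  q : Eu d → ℝ
  memLp_q : MemLp q 2 (volume.restrict G.Ωs)
  transmission : ∀ φ : Eu d → ℝ, IsTest φ → Disjoint (tsupport φ) (G.Γ0 ∪ G.ΓD ∪ G.ΓN) →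
    ((∫ x in G.Ωf, fderiv ℝ φ x (τ.fn x)) + ∫ x in G.Ωf, τ.div x * φ x)
      + ((∫ x in G.Ωs, fderiv ℝ φ x (v.fn x)) + ∫ x in G.Ωs, v.div x * φ x) = 0

/-- The triple is zero as an element of `H`. -/
def HSpace.IsZero {G : Config d} (z : HSpace G) : Prop :=
  (∀ᵐ x ∂volume.restrict G.Ωs, z.v.fn x = 0) ∧ (∀ᵐ x ∂volume.restrict G.Ωf, z.τ.fn x = 0) ∧
    ∀ᵐ x ∂volume.restrict G.Ωs, z.q x = 0

/-! ### The coupled eigenvalue problem -/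

/-- Young modulus and Poisson ratio of the solid, its density `ρs`, and the gravity `g`. The
incompressible limit `ν = 1/2` is allowed. -/
structure Material (d : ℕ) where
  young : Eu d → ℝ
  poisson : Eu d → ℝ
  ρs : ℝ
  g : ℝ
  measurable_young : Measurable young
  measurable_poisson : Measurable poisson
  young_bounds : ∃ m M : ℝ, 0 < m ∧ ∀ x, m ≤ young x ∧ young x ≤ M
  poisson_bounds : ∃ m : ℝ, 0 < m ∧ ∀ x, m ≤ poisson x ∧ poisson x ≤ 1 / 2
  ρs_pos : 0 < ρs
  g_pos : 0 < g

/-- The Lamé parameter `μ = E / (2 (1 + ν))`. -/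
def Material.mu (m : Material d) (x : Eu d) : ℝ := m.young x / (2 * (1 + m.poisson x))

/-- `1/λ = (1 + ν)(1 - 2ν) / (E ν)`, which vanishes in the incompressible limit `ν = 1/2`. -/
def Material.invLam (m : Material d) (x : Eu d) : ℝ :=
  (1 + m.poisson x) * (1 - 2 * m.poisson x) / (m.young x * m.poisson x)

/-- The bilinear form `B`. -/
def formB (G : Config d) (m : Material d) (ρF : ℝ) (z z' : HSpace G) : ℝ :=
  (∫ x in G.Ωs, m.ρs * ⟪z.v.fn x, z'.v.fn x⟫_ℝ) + ∫ x in G.Ωf, ρF * ⟪z.τ.fn x, z'.τ.fn x⟫_ℝ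

/-- The bilinear form `A`. -/
def formA (G : Config d) (m : Material d) (c ρF : ℝ) (z z' : HSpace G) : ℝ :=
  (∫ x in G.Ωs, 2 * m.mu x * ∑ i, ∑ j, z.v.strain x i j * z'.v.strain x i j)
    - (∫ x in G.Ωs, z.q x * z'.v.div x)
    + (∫ x in G.Ωf, c ^ 2 * ρF * z.τ.div x * z'.τ.div x)
    + (∫ x in G.Γ0, m.g * ρF * z.τ.ntr x * z'.τ.ntr x ∂(surf d))
    - (∫ x in G.Ωs, z'.q x * z.v.div x)
    - (∫ x in G.Ωs, m.invLam x * z.q x * z'.q x)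
    + formB G m ρF z z'

/-- `z` is an eigenfunction, with eigenvalue `κ`, of the problem posed in the subspace `S` of
`H`: `0 ≠ z ∈ S` and `A(z, z') = (κ + 1) B(z, z')` for all `z' ∈ S`. -/
def IsEigen (G : Config d) (m : Material d) (c ρF : ℝ) (S : Set (HSpace G)) (κ : ℝ)
    (z : HSpace G) : Prop :=
  z ∈ S ∧ ¬ z.IsZero ∧ ∀ z' ∈ S, formA G m c ρF z z' = (κ + 1) * formB G m ρF z z'

/-! ### Meshes and discrete spaces -/

/-- The simplex with vertex set `s`. -/
def hull (s : Finset (Eu d)) : Set (Eu d) := convexHull ℝ (s : Set (Eu d))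

/-- The diameter of the simplex with vertex set `s`. -/
def size (s : Finset (Eu d)) : ℝ := Metric.diam (hull s)

/-- The elements (triangles or tetrahedra) of the mesh. -/
def IsCell (K : Geometry.SimplicialComplex ℝ (Eu d)) (T : Finset (Eu d)) : Prop :=
  T ∈ K.faces ∧ T.card = d + 1

/-- `l` is the interior facet of the mesh shared by the two distinct elements `T` and `T'`. -/
structure IsSharedFacet (K : Geometry.SimplicialComplex ℝ (Eu d))
    (l T T' : Finset (Eu d)) : Prop where
  facet : l ∈ K.faces ∧ l.card = d
  cell : IsCell K T
  cell' : IsCell K T'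
  ne : T ≠ T'
  subset : l ⊆ T
  subset' : l ⊆ T'

/-- `n` is the unit normal, outward to the simplex `T`, on the facet `l` of `T`. -/
structure IsOuterNormal (T l : Finset (Eu d)) (n : Eu d) : Prop where
  unit : ‖n‖ = 1
  normal : ∀ x ∈ hull l, ∀ y ∈ hull l, ⟪n, y - x⟫_ℝ = 0
  outer : ∀ x ∈ hull l, ∀ y ∈ hull T, ⟪n, y - x⟫_ℝ ≤ 0

/-- Shape regularity with parameter `σ`: every element contains a ball of radius `r > 0` with
`h_T ≤ σ r`. -/
def IsShapeRegular (σ : ℝ) (K : Geometry.SimplicialComplex ℝ (Eu d)) : Prop :=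
  ∀ T, IsCell K T → ∃ x : Eu d, ∃ r : ℝ, 0 < r ∧ Metric.closedBall x r ⊆ hull T ∧ size T ≤ σ * r

/-- Vector fields with polynomial components. -/
abbrev PolyField (d : ℕ) : Type := Fin d → MvPolynomial (Fin d) ℝ

/-- The value of a polynomial at a point. -/
def pval (p : MvPolynomial (Fin d) ℝ) (x : Eu d) : ℝ := MvPolynomial.eval (fun i => x i) p

/-- The value of a polynomial field at a point. -/
def PolyField.val (P : PolyField d) (x : Eu d) : Eu d := WithLp.toLp 2 fun i => pval (P i) x

/-- The divergence of a polynomial field. -/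
def PolyField.div (P : PolyField d) : MvPolynomial (Fin d) ℝ := ∑ i, MvPolynomial.pderiv i (P i)

/-- The gradient of a polynomial at a point. -/
def pgrad (p : MvPolynomial (Fin d) ℝ) (x : Eu d) : Eu d :=
  WithLp.toLp 2 fun i => pval (MvPolynomial.pderiv i p) x

/-- On each element `T` of the mesh `w` is the polynomial field `P T`, of degree at most `k`. -/
def IsPiecewisePoly (K : Geometry.SimplicialComplex ℝ (Eu d)) (k : ℕ) (w : Eu d → Eu d)
    (P : Finset (Eu d) → PolyField d) : Prop :=
  ∀ T, IsCell K T → (∀ i, (P T i).totalDegree ≤ k) ∧ ∀ x ∈ interior (hull T), w x = (P T).val x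

/-- Conforming finite-dimensional spaces `Vh ⊆ V` and `Qh ⊆ L²(Ωs)` for the solid, such as the
MINI element or the Taylor-Hood element. -/
structure SolidSpaces (G : Config d) where
  Vh : Submodule ℝ (Eu d → Eu d)
  Qh : Submodule ℝ (Eu d → ℝ)
  finite_Vh : FiniteDimensional ℝ Vh
  finite_Qh : FiniteDimensional ℝ Qh
  conforming_Vh : ∀ f ∈ Vh, ∃ v : VSpace G, v.fn = f
  conforming_Qh : ∀ q ∈ Qh, MemLp q 2 (volume.restrict G.Ωs)

/-- The discrete space `Hh = Yh × Qh`: the elements of `H` with solid displacement in `Vh`, fluid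
displacement in the Brezzi-Douglas-Marini space of degree `k` over the mesh `K` of the fluid, and
pressure in `Qh`. -/
def Hh (G : Config d) (D : SolidSpaces G) (K : Geometry.SimplicialComplex ℝ (Eu d)) (k : ℕ) :
    Set (HSpace G) :=
  {z | z.v.fn ∈ D.Vh ∧ (∃ P, IsPiecewisePoly K k z.τ.fn P) ∧ z.q ∈ D.Qh}

/-! ### The residuals and jumps of the fluid -/

/-- Index pairs `i < j`. They index the components of the rotation and of the cross product, of
which there is one if `d = 2` and three if `d = 3`. -/
abbrev Pairs (d : ℕ) : Type := {p : Fin d × Fin d // p.1 < p.2}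

/-- The cross product `v × n`: the scalar `v₁ n₂ - v₂ n₁` if `d = 2`, and up to the order and the
signs of its components the usual vector if `d = 3`. -/
def cross (v n : Eu d) : EuclideanSpace ℝ (Pairs d) :=
  WithLp.toLp 2 fun p => v p.1.1 * n p.1.2 - v p.1.2 * n p.1.1

/-- The rotation: the scalar `∂₁ v₂ - ∂₂ v₁` if `d = 2`, and up to the order and the signs of its
components the usual vector if `d = 3`. -/
def PolyField.rot (P : PolyField d) (x : Eu d) : EuclideanSpace ℝ (Pairs d) :=
  WithLp.toLp 2 fun p => pval (MvPolynomial.pderiv p.1.1 (P p.1.2)) x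
    - pval (MvPolynomial.pderiv p.1.2 (P p.1.1)) x

/-- `R_{1,T} = c² ρF ∇(div w_h) + ω_h² ρF w_h`, where `w_h` is given by `P` on `T`. -/
def resid1 (c ρF ωh : ℝ) (P : PolyField d) (x : Eu d) : Eu d :=
  (c ^ 2 * ρF) • pgrad P.div x + (ωh ^ 2 * ρF) • P.val x

/-- `R_{2,T} = rot (ω_h² ρF w_h)`, where `w_h` is given by `P` on `T`. -/
def resid2 (ρF ωh : ℝ) (P : PolyField d) (x : Eu d) : EuclideanSpace ℝ (Pairs d) :=
  (ωh ^ 2 * ρF) • P.rot x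

/-- `J_{1,ℓ} = ½ [[c² ρF (div w_h) n]]` on a facet shared by two elements, on which `w_h` is given
by `P`, `P'`, and whose outward normals are `n`, `n'`. -/
def jump1 (c ρF : ℝ) (P P' : PolyField d) (n n' : Eu d) (x : Eu d) : Eu d :=
  (1 / 2 : ℝ) • ((c ^ 2 * ρF * pval P.div x) • n + (c ^ 2 * ρF * pval P'.div x) • n')

/-- `J_{2,ℓ} = ½ [[ω_h² ρF w_h × n]]` on a facet shared by two elements. -/
def jump2 (ρF ωh : ℝ) (P P' : PolyField d) (n n' : Eu d) (x : Eu d) :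
    EuclideanSpace ℝ (Pairs d) :=
  (1 / 2 : ℝ) • (cross ((ωh ^ 2 * ρF) • P.val x) n + cross ((ωh ^ 2 * ρF) • P'.val x) n')

/-- `ρ^F = (c² ρF)^(-1/2)`. -/
def wF (c ρF : ℝ) : ℝ := (c ^ 2 * ρF) ^ (-(1 / 2) : ℝ)

/-- `ρ_E^F = min {(c² ρF)^(-1/2) / √2, (ω_h² ρF)^(-1/2) / √2}`. -/
def wFE (c ρF ωh : ℝ) : ℝ :=
  min ((c ^ 2 * ρF) ^ (-(1 / 2) : ℝ) / √2) ((ωh ^ 2 * ρF) ^ (-(1 / 2) : ℝ) / √2)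

/-- The squared norm `‖f‖²_{0,S}` of `L²(S)`, for sets `S` of full dimension. -/
def sqNorm {F : Type*} [NormedAddCommGroup F] (S : Set (Eu d)) (f : Eu d → F) : ℝ :=
  ∫ x in S, ‖f x‖ ^ 2

/-- The squared norm `‖f‖²_{0,ℓ}` of `L²(ℓ)`, for facets `ℓ`. -/
def sqNormFacet {F : Type*} [NormedAddCommGroup F] (l : Finset (Eu d)) (f : Eu d → F) : ℝ :=
  ∫ x in hull l, ‖f x‖ ^ 2 ∂(surf d)

/-- `‖c ρF^(1/2) div (w - w_h)‖²_{0,S}`. -/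
def errDiv {G : Config d} (c ρF : ℝ) (w wh : WSpace G) (S : Set (Eu d)) : ℝ :=
  sqNorm S fun x => c * √ρF * (w.div x - wh.div x)

/-- `‖(ρ^F)^(-1/2) (ω_h² ρF w_h - ω² ρF w)‖²_{0,S}`. -/
def errAcc {G : Config d} (c ρF ω ωh : ℝ) (w wh : WSpace G) (S : Set (Eu d)) : ℝ :=
  sqNorm S fun x => (wF c ρF) ^ (-(1 / 2) : ℝ) •
    ((ωh ^ 2 * ρF) • wh.fn x - (ω ^ 2 * ρF) • w.fn x)

end ElastoAcoustic

end

/-!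
The estimates follow from the bubble function technique. A smooth field with compact support in the
fluid domain, extended by zero to the solid, is an admissible test function of the continuous
problem (`exists_testField`), so on such fields the continuous equation couples neither with the
solid nor with the boundary. Inserting fields `ψ v` with a constant direction `v`, and the
divergence-free fields `∂ᵢψ eⱼ - ∂ⱼψ eᵢ`, and subtracting the piecewise polynomial `w_h` gives two
error equations (`FluidData.error_direction`, `FluidData.error_rot`). Integrating their discrete
side by parts on an element yields the residuals `R₁`, `R₂`, and on two elements that share a facet
it also yields the jumps `J₁`, `J₂`.

The test function for a polynomial `q` (a component of a residual or of a jump) is `q` times a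
smooth bump function. No reference simplex is needed. A shape regular element contains a ball of
radius `h_T / σ` and is contained in a concentric ball of radius `h_T`. About the barycentre of a
facet a ball of radius comparable to the size of the facet is divided by the facet into a half in
either element (`halfBall_subset_hull`, `FluidData.facet_geometry`); there `q` is extended by a
constant in the normal direction. After translation, rotation and scaling, the required inverse
estimates compare quadratic integrals on a finite-dimensional space of polynomials, hence hold with
a constant that depends only on the degree, the dimension and `σ` (`exists_reference_bound`,
`exists_cell_bubble`, `exists_facet_bubble`). The Cauchy-Schwarz inequality in the error equations
and an absorption (`absorb`) then bound residuals and jumps (`exists_cell_bound`,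
`exists_facet_bound`); for the jumps, the bounds of the residuals of both elements enter as well.

In the bounds for `R₁` and `J₁` the error `ω_h² ρF w_h - ω² ρF w` comes with the factor `h_T²`,
which is at most the squared diameter of the fluid domain.
-/

noncomputable section

namespace ElastoAcoustic

/-! ### Polynomials as functions -/

lemma pval_add {d : ℕ} (p q : MvPolynomial (Fin d) ℝ) (x : Eu d) :
    pval (p + q) x = pval p x + pval q x := by simp [pval]

lemma pval_sub {d : ℕ} (p q : MvPolynomial (Fin d) ℝ) (x : Eu d) :
    pval (p - q) x = pval p x - pval q x := by simp [pval]

lemma pval_mul {d : ℕ} (p q : MvPolynomial (Fin d) ℝ) (x : Eu d) :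
    pval (p * q) x = pval p x * pval q x := by simp [pval]

lemma pval_C {d : ℕ} (a : ℝ) (x : Eu d) : pval (MvPolynomial.C a : MvPolynomial (Fin d) ℝ) x = a := by
  simp [pval]

lemma pval_sum {d : ℕ} {ι : Type*} (s : Finset ι) (p : ι → MvPolynomial (Fin d) ℝ) (x : Eu d) :
    pval (∑ i ∈ s, p i) x = ∑ i ∈ s, pval (p i) x := by simp [pval]

lemma hasFDerivAt_pval {d : ℕ} (p : MvPolynomial (Fin d) ℝ) (x : Eu d) :
    HasFDerivAt (pval p) (∑ i, pval (MvPolynomial.pderiv i p) x •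
      (EuclideanSpace.proj i : Eu d →L[ℝ] ℝ)) x := by
  induction p using MvPolynomial.induction_on with
  | C a =>
    have : pval (MvPolynomial.C a : MvPolynomial (Fin d) ℝ) = fun _ => a := by
      funext y; simp [pval]
    rw [this]
    simpa [pval] using hasFDerivAt_const a x
  | add p q hp hq =>
    have : pval (p + q) = fun y => pval p y + pval q y := by funext y; simp [pval]
    rw [this]
    refine (hp.add hq).congr_fderiv ?_
    simp [pval, add_smul, Finset.sum_add_distrib]
  | mul_X p i hp =>
    have : pval (p * MvPolynomial.X i) = fun y => pval p y * y i := by funext y; simp [pval]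
    rw [this]
    have hX : HasFDerivAt (fun y : Eu d => y i) (EuclideanSpace.proj i : Eu d →L[ℝ] ℝ) x :=
      (EuclideanSpace.proj i : Eu d →L[ℝ] ℝ).hasFDerivAt
    refine (hp.mul hX).congr_fderiv ?_
    have key : ∀ j, pval (MvPolynomial.pderiv j (p * MvPolynomial.X i)) x
        = pval p x * (if i = j then 1 else 0) + x i * pval (MvPolynomial.pderiv j p) x := by
      intro j
      rw [MvPolynomial.pderiv_mul, MvPolynomial.pderiv_X, pval_add, pval_mul, pval_mul]
      by_cases h : i = j
      · subst h; simp [pval]; ring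
      · simp [pval, h]; ring
    ext v
    simp only [key]
    simp [add_mul, Finset.sum_add_distrib, Finset.mul_sum, mul_assoc]

lemma contDiff_pval {d : ℕ} (p : MvPolynomial (Fin d) ℝ) {n : WithTop ℕ∞} :
    ContDiff ℝ n (pval p) := by
  induction p using MvPolynomial.induction_on with
  | C a =>
    have : pval (MvPolynomial.C a : MvPolynomial (Fin d) ℝ) = fun _ => a := by
      funext y; simp [pval]
    rw [this]; exact contDiff_const
  | add p q hp hq =>
    have : pval (p + q) = fun y => pval p y + pval q y := by funext y; simp [pval]
    rw [this]; exact hp.add hq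
  | mul_X p i hp =>
    have : pval (p * MvPolynomial.X i) = fun y => pval p y * y i := by funext y; simp [pval]
    rw [this]; exact hp.mul (EuclideanSpace.proj i : Eu d →L[ℝ] ℝ).contDiff

lemma continuous_pval {d : ℕ} (p : MvPolynomial (Fin d) ℝ) : Continuous (pval p) :=
  (contDiff_pval p (n := 0)).continuous

lemma fderiv_pval_single {d : ℕ} (p : MvPolynomial (Fin d) ℝ) (x : Eu d) (i : Fin d) :
    fderiv ℝ (pval p) x (EuclideanSpace.single i 1) = pval (MvPolynomial.pderiv i p) x := by
  rw [(hasFDerivAt_pval p x).fderiv]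
  simp

lemma totalDegree_pderiv_le {d : ℕ} (i : Fin d) (p : MvPolynomial (Fin d) ℝ) :
    (MvPolynomial.pderiv i p).totalDegree ≤ p.totalDegree := by
  conv_lhs => rw [p.as_sum, map_sum]
  refine MvPolynomial.totalDegree_finsetSum_le fun s hs => ?_
  rw [MvPolynomial.pderiv_monomial]
  refine (MvPolynomial.totalDegree_monomial_le _ _).trans ?_
  refine le_trans ?_ (MvPolynomial.le_totalDegree hs)
  rw [Finsupp.sum_fintype _ _ (by simp), Finsupp.sum_fintype _ _ (by simp)]
  exact Finset.sum_le_sum fun j _ => by simp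

/-- Polynomials of degree at most `k` are stable under composition with affine maps. -/
lemma exists_pval_comp_affine {m d : ℕ} (L : Eu m →ₗ[ℝ] Eu d) (a : Eu d)
    (p : MvPolynomial (Fin d) ℝ) :
    ∃ q : MvPolynomial (Fin m) ℝ, q.totalDegree ≤ p.totalDegree ∧
      ∀ y, pval q y = pval p (a + L y) := by
  let c : Fin d → MvPolynomial (Fin m) ℝ := fun i =>
    MvPolynomial.C (a i) + ∑ j, MvPolynomial.C (L (EuclideanSpace.single j 1) i) * MvPolynomial.X j
  have hc : ∀ i, (c i).totalDegree ≤ 1 := by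
    intro i
    refine (MvPolynomial.totalDegree_add _ _).trans (max_le (by simp) ?_)
    refine MvPolynomial.totalDegree_finsetSum_le fun j _ => ?_
    exact (MvPolynomial.totalDegree_mul _ _).trans (by simp)
  have hcv : ∀ i (y : Eu m), MvPolynomial.eval (fun j => y j) (c i) = (a + L y) i := by
    intro i y
    have hy : y = ∑ j, y j • EuclideanSpace.single j (1 : ℝ) := by
      ext j; simp [Finset.sum_apply, Pi.single_apply]
    conv_rhs => rw [hy]
    simp [c, map_sum, mul_comm]
  refine ⟨MvPolynomial.bind₁ c p, ?_, fun y => ?_⟩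
  · conv_lhs => rw [p.as_sum, map_sum]
    refine MvPolynomial.totalDegree_finsetSum_le fun s hs => ?_
    rw [MvPolynomial.bind₁_monomial]
    refine (MvPolynomial.totalDegree_mul _ _).trans ?_
    rw [MvPolynomial.totalDegree_C, zero_add]
    refine (MvPolynomial.totalDegree_finsetProd _ _).trans ?_
    refine le_trans ?_ (MvPolynomial.le_totalDegree hs)
    refine Finset.sum_le_sum fun i _ => ?_
    exact (MvPolynomial.totalDegree_pow _ _).trans (by nlinarith [hc i])
  · have h1 : ∀ g : Fin m → ℝ, MvPolynomial.eval g (MvPolynomial.bind₁ c p)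
        = MvPolynomial.eval (fun i => MvPolynomial.eval g (c i)) p := by
      intro g
      exact MvPolynomial.eval₂Hom_bind₁ (RingHom.id ℝ) g c p
    rw [pval, h1, pval]
    congr 1
    congr 1
    funext i
    exact hcv i y

lemma eq_zero_of_pval_ball {d : ℕ} {p : MvPolynomial (Fin d) ℝ} {r : ℝ} (hr : 0 < r)
    (h : ∀ x ∈ Metric.ball (0 : Eu d) r, pval p x = 0) : p = 0 := by
  have hnhds : ∀ᶠ x : Eu d in nhds 0, pval p x = 0 :=
    Filter.mem_of_superset (Metric.ball_mem_nhds _ hr) h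
  have h2 : ∀ᶠ x : Fin d → ℝ in nhds 0, pval p (WithLp.toLp 2 x) = 0 := by
    have hc : Filter.Tendsto (fun x : Fin d → ℝ => (WithLp.toLp 2 x : Eu d)) (nhds 0) (nhds 0) := by
      have := (PiLp.continuous_toLp 2 (fun _ : Fin d => ℝ)).tendsto 0
      simpa using this
    exact hc.eventually hnhds
  obtain ⟨ε, hε, hb⟩ := Metric.eventually_nhds_iff.1 h2
  refine MvPolynomial.funext_set (fun _ => Set.Ioo (-ε) ε)
    (fun _ => Set.Ioo_infinite (by linarith)) fun x hx => ?_
  have : pval p (WithLp.toLp 2 x) = 0 := by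
    apply hb
    rw [dist_pi_lt_iff hε]
    intro i
    have := hx i (mem_univ i)
    simpa [abs_lt] using this
  simpa [pval] using this

/-! ### Comparison of quadratic integrals on a finite-dimensional space -/

/-- A linear map is bounded by any injective one on a finite-dimensional space. -/
lemma exists_norm_sq_le {V F₁ F₂ : Type*} [AddCommGroup V] [Module ℝ V] [FiniteDimensional ℝ V]
    [NormedAddCommGroup F₁] [NormedSpace ℝ F₁] [NormedAddCommGroup F₂] [NormedSpace ℝ F₂]
    (A : V →ₗ[ℝ] F₁) (B : V →ₗ[ℝ] F₂) (hA : A.ker = ⊥) :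
    ∃ C : ℝ, 0 < C ∧ ∀ v, ‖B v‖ ^ 2 ≤ C * ‖A v‖ ^ 2 := by
  have hinj : Function.Injective A := LinearMap.ker_eq_bot.1 hA
  let e : V ≃ₗ[ℝ] A.range := LinearEquiv.ofInjective A hinj
  let T : A.range →L[ℝ] F₂ := LinearMap.toContinuousLinearMap (B ∘ₗ e.symm.toLinearMap)
  refine ⟨‖T‖ ^ 2 + 1, by positivity, fun v => ?_⟩
  have h1 : T (e v) = B v := by simp [T]
  have h2 : ‖B v‖ ≤ ‖T‖ * ‖A v‖ := by
    rw [← h1]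
    exact T.le_opNorm (e v)
  calc ‖B v‖ ^ 2 ≤ (‖T‖ * ‖A v‖) ^ 2 := by gcongr
    _ = ‖T‖ ^ 2 * ‖A v‖ ^ 2 := by ring
    _ ≤ _ := by nlinarith [sq_nonneg ‖A v‖]

lemma norm_toLp_sq {X F : Type*} [MeasurableSpace X] {μ : Measure X} [NormedAddCommGroup F]
    {f : X → F} (hf : MemLp f 2 μ) : ‖hf.toLp f‖ ^ 2 = ∫ x, ‖f x‖ ^ 2 ∂μ := by
  rw [Lp.norm_toLp, hf.eLpNorm_eq_integral_rpow_norm (by norm_num) (by norm_num)]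
  have h0 : 0 ≤ ∫ x, ‖f x‖ ^ 2 ∂μ := integral_nonneg fun x => by positivity
  simp only [ENNReal.toReal_ofNat, Real.rpow_ofNat]
  rw [ENNReal.toReal_ofReal (by positivity), ← Real.rpow_natCast, ← Real.rpow_mul h0]
  norm_num

/-- On a finite-dimensional space, a quadratic integral is bounded by any definite one. -/
lemma exists_integral_sq_le {V X Y F₁ F₂ : Type*} [AddCommGroup V] [Module ℝ V]
    [FiniteDimensional ℝ V] [MeasurableSpace X] [MeasurableSpace Y] {μ : Measure X} {ν : Measure Y}
    [NormedAddCommGroup F₁] [NormedSpace ℝ F₁] [NormedAddCommGroup F₂] [NormedSpace ℝ F₂]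
    (f : V → X → F₁) (g : V → Y → F₂)
    (hf_add : ∀ u v, f (u + v) = f u + f v) (hf_smul : ∀ (c : ℝ) v, f (c • v) = c • f v)
    (hg_add : ∀ u v, g (u + v) = g u + g v) (hg_smul : ∀ (c : ℝ) v, g (c • v) = c • g v)
    (hf : ∀ v, MemLp (f v) 2 μ) (hg : ∀ v, MemLp (g v) 2 ν)
    (h0 : ∀ v, f v =ᵐ[μ] 0 → v = 0) :
    ∃ C : ℝ, 0 < C ∧ ∀ v, ∫ y, ‖g v y‖ ^ 2 ∂ν ≤ C * ∫ x, ‖f v x‖ ^ 2 ∂μ := by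
  let A : V →ₗ[ℝ] Lp F₁ 2 μ :=
    { toFun := fun v => (hf v).toLp (f v)
      map_add' := fun u v => by
        rw [← MemLp.toLp_add]; congr 1; exact hf_add u v
      map_smul' := fun c v => by
        rw [RingHom.id_apply, ← MemLp.toLp_const_smul]; congr 1; exact hf_smul c v }
  let B : V →ₗ[ℝ] Lp F₂ 2 ν :=
    { toFun := fun v => (hg v).toLp (g v)
      map_add' := fun u v => by
        rw [← MemLp.toLp_add]; congr 1; exact hg_add u v
      map_smul' := fun c v => by
        rw [RingHom.id_apply, ← MemLp.toLp_const_smul]; congr 1; exact hg_smul c v }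
  have hA : A.ker = ⊥ := by
    rw [LinearMap.ker_eq_bot']
    intro v hv
    exact h0 v ((hf v).coeFn_toLp.symm.trans ((Lp.eq_zero_iff_ae_eq_zero).1 hv))
  obtain ⟨C, hC, h⟩ := exists_norm_sq_le A B hA
  refine ⟨C, hC, fun v => ?_⟩
  have := h v
  rwa [show A v = (hf v).toLp (f v) from rfl, show B v = (hg v).toLp (g v) from rfl,
    norm_toLp_sq, norm_toLp_sq] at this

/-! ### Bump functions and inverse estimates -/

/-- A radial smooth bump function, equal to `1` for `‖y‖ ≤ 1/4` and to `0` for `1/2 ≤ ‖y‖`. -/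
def refBump {d : ℕ} (y : Eu d) : ℝ := Real.smoothTransition (2 - 8 * ‖y‖ ^ 2)

lemma contDiff_refBump {d : ℕ} :
    ContDiff ℝ ((⊤ : ℕ∞) : WithTop ℕ∞) (refBump : Eu d → ℝ) :=
  Real.smoothTransition.contDiff.comp
    (contDiff_const.sub (contDiff_const.mul (contDiff_norm_sq ℝ)))

lemma refBump_nonneg {d : ℕ} (y : Eu d) : 0 ≤ refBump y := Real.smoothTransition.nonneg _

lemma refBump_eq_one {d : ℕ} {y : Eu d} (hy : ‖y‖ ≤ 1 / 4) : refBump y = 1 :=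
  Real.smoothTransition.one_of_one_le (by nlinarith [norm_nonneg y])

lemma refBump_eq_zero {d : ℕ} {y : Eu d} (hy : 1 / 2 ≤ ‖y‖) : refBump y = 0 :=
  Real.smoothTransition.zero_of_nonpos (by nlinarith [norm_nonneg y])

lemma tsupport_refBump_mul_subset {d : ℕ} (f : Eu d → ℝ) :
    tsupport (fun y => refBump y * f y) ⊆ Metric.closedBall 0 (1 / 2) := by
  refine closure_minimal (fun y hy => ?_) Metric.isClosed_closedBall
  rw [mem_closedBall_zero_iff]
  by_contra h
  exact hy (by simp [refBump_eq_zero (not_le.1 h).le])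

lemma hasCompactSupport_refBump_mul {d : ℕ} (f : Eu d → ℝ) :
    HasCompactSupport (fun y => refBump y * f y) :=
  (isCompact_closedBall _ _).of_isClosed_subset (isClosed_tsupport _)
    (tsupport_refBump_mul_subset f)

lemma memLp_two_restrict_closedBall {d : ℕ} {f : Eu d → ℝ} (hf : Continuous f) (x : Eu d) (r : ℝ) :
    MemLp f 2 (volume.restrict (Metric.closedBall x r)) := by
  rw [memLp_two_iff_integrable_sq hf.aestronglyMeasurable]
  exact (hf.pow 2).continuousOn.integrableOn_compact (isCompact_closedBall _ _)

/-- Inverse estimates on the reference configuration; the polynomial `q` in `m` variables is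
extended to `ℝ^D` by means of the linear map `π`. -/
lemma exists_reference_bound (m D k : ℕ) (σ : ℝ) (π : Eu D →L[ℝ] Eu m) :
    ∃ C : ℝ, 0 < C ∧ ∀ q : MvPolynomial (Fin m) ℝ, q.totalDegree ≤ k →
      (∫ y in Metric.closedBall (0 : Eu m) σ, pval q y ^ 2)
          ≤ C * (∫ y : Eu m, refBump y * pval q y ^ 2) ∧
      (∫ y : Eu D, (refBump y * pval q (π y)) ^ 2)
          ≤ C * (∫ y : Eu m, refBump y * pval q y ^ 2) ∧
      (∫ y : Eu D, ‖fderiv ℝ (fun y => refBump y * pval q (π y)) y‖ ^ 2)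
          ≤ C * (∫ y : Eu m, refBump y * pval q y ^ 2) := by
  let V := MvPolynomial.restrictTotalDegree (Fin m) ℝ k
  let B : Set (Eu m) := Metric.closedBall 0 (1 / 4)
  let f : V → Eu m → ℝ := fun q => pval (q : MvPolynomial (Fin m) ℝ)
  let g : V → Eu D → ℝ := fun q y => refBump y * pval (q : MvPolynomial (Fin m) ℝ) (π y)
  have f_add : ∀ u v, f (u + v) = f u + f v := fun u v => by
    funext y; simp [f, pval]
  have f_smul : ∀ (c : ℝ) v, f (c • v) = c • f v := fun c v => by
    funext y; simp [f, pval]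
  have g_add : ∀ u v, g (u + v) = g u + g v := fun u v => by
    funext y; simp [g, pval, mul_add]
  have g_smul : ∀ (c : ℝ) v, g (c • v) = c • g v := fun c v => by
    funext y; simp [g, pval]; ring
  have f_cont : ∀ v, Continuous (f v) := fun v => continuous_pval _
  have g_smooth : ∀ v, ContDiff ℝ ((⊤ : ℕ∞) : WithTop ℕ∞) (g v) := fun v =>
    contDiff_refBump.mul ((contDiff_pval _).comp π.contDiff)
  have g_diff : ∀ v y, DifferentiableAt ℝ (g v) y := fun v =>
    (g_smooth v).differentiable (by simp)
  have g_supp : ∀ v, HasCompactSupport (g v) := fun v => hasCompactSupport_refBump_mul _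
  have hf : ∀ v, MemLp (f v) 2 (volume.restrict B) := fun v =>
    memLp_two_restrict_closedBall (f_cont v) _ _
  have h0 : ∀ v, f v =ᵐ[volume.restrict B] 0 → v = 0 := fun v hv => by
    have hv' : f v =ᵐ[volume.restrict (Metric.ball (0 : Eu m) (1 / 4))] 0 :=
      ae_mono (Measure.restrict_mono Metric.ball_subset_closedBall le_rfl) hv
    have := Measure.eqOn_open_of_ae_eq hv' Metric.isOpen_ball (f_cont v).continuousOn
      continuousOn_const
    exact Subtype.ext (eq_zero_of_pval_ball (by norm_num) this)
  obtain ⟨C₁, hC₁, h₁⟩ := exists_integral_sq_le f f f_add f_smul f_add f_smul hf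
    (fun v => memLp_two_restrict_closedBall (f_cont v) 0 σ) h0
  obtain ⟨C₂, hC₂, h₂⟩ := exists_integral_sq_le (ν := (volume : Measure (Eu D)))
    f g f_add f_smul g_add g_smul hf
    (fun v => (g_smooth v).continuous.memLp_of_hasCompactSupport (g_supp v)) h0
  obtain ⟨C₃, hC₃, h₃⟩ := exists_integral_sq_le (ν := (volume : Measure (Eu D)))
    f (fun v => fderiv ℝ (g v)) f_add f_smul
    (fun u v => by
      funext y; rw [g_add]; exact fderiv_add (g_diff u y) (g_diff v y))
    (fun c v => by
      funext y; rw [g_smul]; exact fderiv_const_smul (g_diff v y) c) hf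
    (fun v => ((g_smooth v).continuous_fderiv (by simp)).memLp_of_hasCompactSupport
      ((g_supp v).fderiv ℝ)) h0
  refine ⟨C₁ + C₂ + C₃, by positivity, fun q hq => ?_⟩
  let v : V := ⟨q, (MvPolynomial.mem_restrictTotalDegree _ _ _).2 hq⟩
  have hI : ∫ y in B, ‖f v y‖ ^ 2 ≤ ∫ y : Eu m, refBump y * pval q y ^ 2 := by
    have e1 : ∫ y in B, ‖f v y‖ ^ 2 = ∫ y in B, refBump y * pval q y ^ 2 := by
      refine setIntegral_congr_fun Metric.isClosed_closedBall.measurableSet fun y hy => ?_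
      have : refBump y = 1 := refBump_eq_one (by simpa [B] using hy)
      simp [f, v, this]
    rw [e1]
    refine setIntegral_le_integral ?_ (Filter.Eventually.of_forall fun y => ?_)
    · exact (contDiff_refBump.continuous.mul ((continuous_pval q).pow 2)).integrable_of_hasCompactSupport
        (hasCompactSupport_refBump_mul _)
    · exact mul_nonneg (refBump_nonneg y) (sq_nonneg _)
  have hI0 : 0 ≤ ∫ y in B, ‖f v y‖ ^ 2 := integral_nonneg fun y => by positivity
  have key : ∀ c, 0 < c → c ≤ C₁ + C₂ + C₃ → c * ∫ y in B, ‖f v y‖ ^ 2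
      ≤ (C₁ + C₂ + C₃) * ∫ y : Eu m, refBump y * pval q y ^ 2 := fun c hc hc' =>
    mul_le_mul hc' hI hI0 (by positivity)
  refine ⟨?_, ?_, ?_⟩
  · have := (h₁ v).trans (key C₁ hC₁ (by linarith))
    simpa [f, v] using this
  · have := (h₂ v).trans (key C₂ hC₂ (by linarith))
    simpa only [g, v, Real.norm_eq_abs, sq_abs] using this
  · exact (h₃ v).trans (key C₃ hC₃ (by linarith))

lemma integral_comp_frame {d : ℕ} (x₀ : Eu d) {r : ℝ} (hr : 0 < r) (Θ : Eu d ≃ₗᵢ[ℝ] Eu d)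
    (f : Eu d → ℝ) : ∫ x, f (Θ.symm (r⁻¹ • (x - x₀))) = r ^ d * ∫ y, f y := by
  rw [integral_sub_right_eq_self (fun x => f (Θ.symm (r⁻¹ • x))) x₀,
    Measure.integral_comp_inv_smul_of_nonneg volume (fun x => f (Θ.symm x)) hr.le,
    Θ.symm.measurePreserving.integral_comp Θ.symm.toHomeomorph.measurableEmbedding f]
  simp

/-- The polynomial `q`, given in the coordinates `y` with `x = x₀ + r Θ y`, times the bump function
of the ball of centre `x₀` and radius `r / 2`. -/
def bumpFn {m D : ℕ} (π : Eu D →L[ℝ] Eu m) (x₀ : Eu D) (r : ℝ) (Θ : Eu D ≃ₗᵢ[ℝ] Eu D)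
    (q : MvPolynomial (Fin m) ℝ) (x : Eu D) : ℝ :=
  refBump (Θ.symm (r⁻¹ • (x - x₀))) * pval q (π (Θ.symm (r⁻¹ • (x - x₀))))

lemma tsupport_bumpFn_subset {m D : ℕ} (π : Eu D →L[ℝ] Eu m) (x₀ : Eu D) {r : ℝ} (hr : 0 < r)
    (Θ : Eu D ≃ₗᵢ[ℝ] Eu D) (q : MvPolynomial (Fin m) ℝ) :
    tsupport (bumpFn π x₀ r Θ q) ⊆ Metric.closedBall x₀ (r / 2) := by
  refine closure_minimal (fun x hx => ?_) Metric.isClosed_closedBall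
  rw [mem_closedBall_iff_norm]
  by_contra h
  refine hx ?_
  rw [bumpFn, refBump_eq_zero, zero_mul]
  rw [LinearIsometryEquiv.norm_map, norm_smul, norm_inv, Real.norm_of_nonneg hr.le,
    inv_mul_eq_div, le_div_iff₀ hr]
  linarith

lemma isTest_bumpFn {m D : ℕ} (π : Eu D →L[ℝ] Eu m) (x₀ : Eu D) {r : ℝ} (hr : 0 < r)
    (Θ : Eu D ≃ₗᵢ[ℝ] Eu D) (q : MvPolynomial (Fin m) ℝ) : IsTest (bumpFn π x₀ r Θ q) := by
  refine ⟨?_, (isCompact_closedBall _ _).of_isClosed_subset (isClosed_tsupport _)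
    (tsupport_bumpFn_subset π x₀ hr Θ q)⟩
  have h : ContDiff ℝ ((⊤ : ℕ∞) : WithTop ℕ∞) fun x : Eu D => Θ.symm (r⁻¹ • (x - x₀)) :=
    Θ.symm.contDiff.comp ((contDiff_id.sub contDiff_const).const_smul r⁻¹)
  exact (contDiff_refBump.comp h).mul ((contDiff_pval q).comp (π.contDiff.comp h))

lemma integrable_norm_fderiv_sq {d : ℕ} {ψ : Eu d → ℝ} (hψ : IsTest ψ) :
    Integrable fun x => ‖fderiv ℝ ψ x‖ ^ 2 := by
  have h : HasCompactSupport fun x => ‖fderiv ℝ ψ x‖ ^ 2 :=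
    (hψ.2.fderiv ℝ).norm.comp_left (g := fun t : ℝ => t ^ 2) (by simp)
  exact Continuous.integrable_of_hasCompactSupport
    ((hψ.1.continuous_fderiv (by simp)).norm.pow 2) h

/-- The inverse estimates of `exists_reference_bound`, scaled to a ball of radius `r`. -/
lemma exists_bumpFn_bound (m D k : ℕ) (σ : ℝ) (π : Eu D →L[ℝ] Eu m) :
    ∃ C : ℝ, 0 < C ∧ ∀ (x₀ : Eu D) (r : ℝ), 0 < r → ∀ (Θ : Eu D ≃ₗᵢ[ℝ] Eu D)
      (q : MvPolynomial (Fin m) ℝ), q.totalDegree ≤ k →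
      (∫ y in Metric.closedBall (0 : Eu m) σ, pval q y ^ 2)
          ≤ C * (∫ y : Eu m, refBump y * pval q y ^ 2) ∧
      (∫ x, bumpFn π x₀ r Θ q x ^ 2)
          ≤ C * r ^ D * (∫ y : Eu m, refBump y * pval q y ^ 2) ∧
      r ^ 2 * (∫ x, ‖fderiv ℝ (bumpFn π x₀ r Θ q) x‖ ^ 2)
          ≤ C * r ^ D * (∫ y : Eu m, refBump y * pval q y ^ 2) := by
  obtain ⟨C, hC, h⟩ := exists_reference_bound m D k σ π
  refine ⟨C, hC, fun x₀ r hr Θ q hq => ⟨(h q hq).1, ?_, ?_⟩⟩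
  · have := integral_comp_frame x₀ hr Θ fun y => (refBump y * pval q (π y)) ^ 2
    simp only [bumpFn]
    rw [this]
    nlinarith [mul_le_mul_of_nonneg_left (h q hq).2.1 (pow_pos hr D).le]
  · let g : Eu D → ℝ := fun y => refBump y * pval q (π y)
    have g_smooth : ContDiff ℝ ((⊤ : ℕ∞) : WithTop ℕ∞) g :=
      contDiff_refBump.mul ((contDiff_pval _).comp π.contDiff)
    have g_supp : HasCompactSupport g := hasCompactSupport_refBump_mul _
    have hpt : ∀ x, r ^ 2 * ‖fderiv ℝ (bumpFn π x₀ r Θ q) x‖ ^ 2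
        ≤ ‖fderiv ℝ g (Θ.symm (r⁻¹ • (x - x₀)))‖ ^ 2 := by
      intro x
      let A : Eu D →L[ℝ] Eu D := r⁻¹ • (Θ.symm.toContinuousLinearEquiv : Eu D →L[ℝ] Eu D)
      have hA : HasFDerivAt (fun x : Eu D => Θ.symm (r⁻¹ • (x - x₀))) A x := by
        have h1 : (fun x : Eu D => Θ.symm (r⁻¹ • (x - x₀))) = fun x => A (x - x₀) := by
          funext x; simp [A]
        rw [h1]
        exact A.hasFDerivAt.comp x ((hasFDerivAt_id x).sub_const x₀)
      have hg : HasFDerivAt g (fderiv ℝ g (Θ.symm (r⁻¹ • (x - x₀)))) (Θ.symm (r⁻¹ • (x - x₀))) :=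
        ((g_smooth.differentiable (by simp)) _).hasFDerivAt
      have hfd : fderiv ℝ (bumpFn π x₀ r Θ q) x
          = (fderiv ℝ g (Θ.symm (r⁻¹ • (x - x₀)))).comp A :=
        HasFDerivAt.fderiv (HasFDerivAt.comp (g := g) x hg hA)
      have hAn : ‖A‖ ≤ r⁻¹ := by
        refine A.opNorm_le_bound (by positivity) fun v => ?_
        simp [A, norm_smul, abs_of_pos hr]
      have hle : r * ‖fderiv ℝ (bumpFn π x₀ r Θ q) x‖
          ≤ ‖fderiv ℝ g (Θ.symm (r⁻¹ • (x - x₀)))‖ := by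
        rw [hfd]
        calc _ ≤ r * (‖fderiv ℝ g (Θ.symm (r⁻¹ • (x - x₀)))‖ * r⁻¹) := by
              gcongr
              exact (ContinuousLinearMap.opNorm_comp_le _ _).trans (by gcongr)
          _ = _ := by field_simp
      calc _ = (r * ‖fderiv ℝ (bumpFn π x₀ r Θ q) x‖) ^ 2 := by ring
        _ ≤ _ := by gcongr
    have hgi := integrable_norm_fderiv_sq ⟨g_smooth, g_supp⟩
    have hbi := integrable_norm_fderiv_sq (isTest_bumpFn π x₀ hr Θ q)
    have hgi' : Integrable (fun x => ‖fderiv ℝ g (Θ.symm (r⁻¹ • (x - x₀)))‖ ^ 2) := by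
      have h1 := (Θ.symm.measurePreserving.integrable_comp_emb
        Θ.symm.toHomeomorph.measurableEmbedding).2 hgi
      exact ((integrable_comp_smul_iff volume _ (inv_ne_zero hr.ne')).2 h1).comp_sub_right x₀
    rw [← integral_const_mul]
    refine (integral_mono (hbi.const_mul _) hgi' hpt).trans ?_
    rw [integral_comp_frame x₀ hr Θ fun y => ‖fderiv ℝ g y‖ ^ 2]
    have h3 := (h q hq).2.2
    calc _ ≤ r ^ D * (C * ∫ y : Eu m, refBump y * pval q y ^ 2) := by gcongr
      _ = _ := by ring

/-! ### Coordinates adapted to a hyperplane -/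

/-- The inclusion of `ℝ^m` into `ℝ^(m+1)` as the coordinate hyperplane `x₀ = 0`. -/
def hyperIncl (m : ℕ) : Eu m →ₗᵢ[ℝ] Eu (m + 1) where
  toFun y := WithLp.toLp 2 (Fin.cons 0 fun i => y i)
  map_add' u v := by
    ext i; refine Fin.cases ?_ (fun j => ?_) i <;> simp
  map_smul' c v := by
    ext i; refine Fin.cases ?_ (fun j => ?_) i <;> simp
  norm_map' y := by
    simp [EuclideanSpace.norm_eq, Fin.sum_univ_succ]

lemma hyperIncl_zero {m : ℕ} (y : Eu m) : hyperIncl m y 0 = 0 := rfl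

lemma hyperIncl_succ {m : ℕ} (y : Eu m) (i : Fin m) : hyperIncl m y i.succ = y i := rfl

/-- The projection of `ℝ^(m+1)` onto `ℝ^m` that forgets the coordinate `x₀`. -/
def hyperProj (m : ℕ) : Eu (m + 1) →L[ℝ] Eu m :=
  LinearMap.toContinuousLinearMap
    { toFun := fun x => WithLp.toLp 2 fun i => x i.succ
      map_add' := fun u v => by ext i; simp
      map_smul' := fun c v => by ext i; simp }

lemma hyperProj_apply {m : ℕ} (x : Eu (m + 1)) (i : Fin m) : hyperProj m x i = x i.succ := rfl

lemma hyperProj_hyperIncl {m : ℕ} (y : Eu m) : hyperProj m (hyperIncl m y) = y := by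
  ext i; rfl

lemma eq_smul_single_add_hyperIncl {m : ℕ} (x : Eu (m + 1)) :
    x = x 0 • EuclideanSpace.single 0 1 + hyperIncl m (hyperProj m x) := by
  ext i
  refine Fin.cases ?_ (fun j => ?_) i
  · simp [hyperIncl_zero]
  · simp [hyperIncl_succ, hyperProj_apply]

/-- A rotation that takes the first coordinate axis to the direction `n`. -/
lemma exists_rotation {m : ℕ} {n : Eu (m + 1)} (hn : ‖n‖ = 1) :
    ∃ Θ : Eu (m + 1) ≃ₗᵢ[ℝ] Eu (m + 1), Θ (EuclideanSpace.single 0 1) = n := by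
  have ho : Orthonormal ℝ (({0} : Set (Fin (m + 1))).domRestrict fun _ => n) := by
    refine ⟨fun i => hn, fun i j hij => ?_⟩
    exact absurd (Subsingleton.elim i j) hij
  obtain ⟨b, hb⟩ := ho.exists_orthonormalBasis_extension_of_card_eq (by simp)
  refine ⟨b.repr.symm, ?_⟩
  rw [OrthonormalBasis.repr_symm_single]
  exact hb 0 (by simp)

/-! ### Bubble functions of cells and facets -/

lemma integral_comp_scale {d : ℕ} (x₀ : Eu d) {r : ℝ} (hr : 0 < r) (f : Eu d → ℝ) :
    ∫ x, f (r⁻¹ • (x - x₀)) = r ^ d * ∫ y, f y :=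
  integral_comp_frame x₀ hr (LinearIsometryEquiv.refl ℝ (Eu d)) f

/-- Bubble functions of a cell: for a polynomial `q` there is a multiple `ψ` of `q` by a bump
function of an inscribed ball for which inverse estimates hold. -/
lemma exists_cell_bubble (d k : ℕ) (σ : ℝ) :
    ∃ C : ℝ, 0 < C ∧ ∀ (x₀ : Eu d) (r : ℝ), 0 < r →
      ∀ q : MvPolynomial (Fin d) ℝ, q.totalDegree ≤ k →
      ∃ ψ : Eu d → ℝ, IsTest ψ ∧ tsupport ψ ⊆ Metric.closedBall x₀ (r / 2) ∧
        (∫ x in Metric.closedBall x₀ (σ * r), pval q x ^ 2) ≤ C * (∫ x, ψ x * pval q x) ∧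
        (∫ x, ψ x ^ 2) ≤ C * (∫ x, ψ x * pval q x) ∧
        r ^ 2 * (∫ x, ‖fderiv ℝ ψ x‖ ^ 2) ≤ C * (∫ x, ψ x * pval q x) := by
  obtain ⟨C, hC, h⟩ := exists_bumpFn_bound d d k σ (ContinuousLinearMap.id ℝ (Eu d))
  refine ⟨C, hC, fun x₀ r hr q hq => ?_⟩
  obtain ⟨q', hq', hval⟩ := exists_pval_comp_affine (r • (LinearMap.id : Eu d →ₗ[ℝ] Eu d)) x₀ q
  let Θ := LinearIsometryEquiv.refl ℝ (Eu d)
  obtain ⟨h1, h2, h3⟩ := h x₀ r hr Θ q' (hq'.trans hq)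
  have hback : ∀ x, pval q' (r⁻¹ • (x - x₀)) = pval q x := fun x => by
    rw [hval]; simp [smul_smul, hr.ne']
  have hX : ∫ x, bumpFn (ContinuousLinearMap.id ℝ (Eu d)) x₀ r Θ q' x * pval q x
      = r ^ d * ∫ y : Eu d, refBump y * pval q' y ^ 2 := by
    rw [← integral_comp_scale x₀ hr]
    refine integral_congr_ae (Filter.Eventually.of_forall fun x => ?_)
    have e1 : bumpFn (ContinuousLinearMap.id ℝ (Eu d)) x₀ r Θ q' x
        = refBump (r⁻¹ • (x - x₀)) * pval q' (r⁻¹ • (x - x₀)) := rfl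
    simp only [e1, hback]
    ring
  have hS : ∫ x in Metric.closedBall x₀ (σ * r), pval q x ^ 2
      = r ^ d * ∫ y in Metric.closedBall (0 : Eu d) σ, pval q' y ^ 2 := by
    rw [← integral_indicator Metric.isClosed_closedBall.measurableSet,
      ← integral_indicator Metric.isClosed_closedBall.measurableSet,
      ← integral_comp_scale x₀ hr]
    refine integral_congr_ae (Filter.Eventually.of_forall fun x => ?_)
    have hmem : r⁻¹ • (x - x₀) ∈ Metric.closedBall (0 : Eu d) σ ↔
        x ∈ Metric.closedBall x₀ (σ * r) := by
      rw [mem_closedBall_zero_iff, mem_closedBall_iff_norm, norm_smul, norm_inv,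
        Real.norm_of_nonneg hr.le, inv_mul_eq_div, div_le_iff₀ hr]
    classical simp only [indicator_apply, hmem, hback]
  refine ⟨bumpFn (ContinuousLinearMap.id ℝ (Eu d)) x₀ r Θ q', isTest_bumpFn _ _ hr _ _,
    tsupport_bumpFn_subset _ _ hr _ _, ?_, ?_, ?_⟩
  · rw [hS, hX]
    nlinarith [mul_le_mul_of_nonneg_left h1 (pow_pos hr d).le]
  · rw [hX]; linarith
  · rw [hX]; linarith

/-- Bubble functions of a facet: a polynomial `q` on the hyperplane `x₀ + Θ (ℝ^m)` is extended to a
function that is constant in the normal direction and multiplied by a bump function. -/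
lemma exists_facet_bubble (m k : ℕ) (σ : ℝ) :
    ∃ C : ℝ, 0 < C ∧ ∀ (x₀ : Eu (m + 1)) (r : ℝ), 0 < r →
      ∀ (Θ : Eu (m + 1) ≃ₗᵢ[ℝ] Eu (m + 1)) (q : MvPolynomial (Fin (m + 1)) ℝ), q.totalDegree ≤ k →
      ∃ ψ : Eu (m + 1) → ℝ, IsTest ψ ∧ tsupport ψ ⊆ Metric.closedBall x₀ (r / 2) ∧
        (∫ y in Metric.closedBall (0 : Eu m) (σ * r), pval q (x₀ + Θ (hyperIncl m y)) ^ 2)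
          ≤ C * (∫ y : Eu m, ψ (x₀ + Θ (hyperIncl m y)) * pval q (x₀ + Θ (hyperIncl m y))) ∧
        (∫ x, ψ x ^ 2) ≤ C * r *
          (∫ y : Eu m, ψ (x₀ + Θ (hyperIncl m y)) * pval q (x₀ + Θ (hyperIncl m y))) ∧
        r ^ 2 * (∫ x, ‖fderiv ℝ ψ x‖ ^ 2) ≤ C * r *
          (∫ y : Eu m, ψ (x₀ + Θ (hyperIncl m y)) * pval q (x₀ + Θ (hyperIncl m y))) := by
  obtain ⟨C, hC, h⟩ := exists_bumpFn_bound m (m + 1) k σ (hyperProj m)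
  refine ⟨C, hC, fun x₀ r hr Θ q hq => ?_⟩
  obtain ⟨q', hq', hval⟩ := exists_pval_comp_affine
    (r • (Θ.toLinearEquiv.toLinearMap ∘ₗ (hyperIncl m).toLinearMap)) x₀ q
  obtain ⟨h1, h2, h3⟩ := h x₀ r hr Θ q' (hq'.trans hq)
  have hback : ∀ y, pval q' (r⁻¹ • y) = pval q (x₀ + Θ (hyperIncl m y)) := fun y => by
    rw [hval]; simp [smul_smul, hr.ne']
  have hX : ∫ y : Eu m, bumpFn (hyperProj m) x₀ r Θ q' (x₀ + Θ (hyperIncl m y))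
        * pval q (x₀ + Θ (hyperIncl m y))
      = r ^ m * ∫ y : Eu m, refBump y * pval q' y ^ 2 := by
    rw [← integral_comp_scale (0 : Eu m) hr]
    refine integral_congr_ae (Filter.Eventually.of_forall fun y => ?_)
    have e1 : Θ.symm (r⁻¹ • (x₀ + Θ (hyperIncl m y) - x₀)) = hyperIncl m (r⁻¹ • y) := by
      simp
    have e2 : refBump (hyperIncl m (r⁻¹ • y)) = refBump (r⁻¹ • y) := by
      rw [refBump, refBump, LinearIsometry.norm_map]
    simp only [bumpFn, e1, e2, hyperProj_hyperIncl, hback, sub_zero]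
    ring
  have hS : ∫ y in Metric.closedBall (0 : Eu m) (σ * r), pval q (x₀ + Θ (hyperIncl m y)) ^ 2
      = r ^ m * ∫ y in Metric.closedBall (0 : Eu m) σ, pval q' y ^ 2 := by
    rw [← integral_indicator Metric.isClosed_closedBall.measurableSet,
      ← integral_indicator Metric.isClosed_closedBall.measurableSet,
      ← integral_comp_scale (0 : Eu m) hr]
    refine integral_congr_ae (Filter.Eventually.of_forall fun y => ?_)
    have hmem : r⁻¹ • y ∈ Metric.closedBall (0 : Eu m) σ ↔
        y ∈ Metric.closedBall (0 : Eu m) (σ * r) := by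
      rw [mem_closedBall_zero_iff, mem_closedBall_zero_iff, norm_smul, norm_inv,
        Real.norm_of_nonneg hr.le, inv_mul_eq_div, div_le_iff₀ hr]
    classical simp only [indicator_apply, sub_zero, hmem, hback]
  refine ⟨bumpFn (hyperProj m) x₀ r Θ q', isTest_bumpFn _ _ hr _ _,
    tsupport_bumpFn_subset _ _ hr _ _, ?_, ?_, ?_⟩
  · rw [hS, hX]
    nlinarith [mul_le_mul_of_nonneg_left h1 (pow_pos hr m).le]
  · rw [hX]; rw [pow_succ] at h2; linarith
  · rw [hX]; rw [pow_succ r m] at h3; linarith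

/-! ### Green's formula on a half-space -/

lemma integral_fderiv_apply_eq_zero {d : ℕ} {f : Eu d → ℝ} (hf : ContDiff ℝ 1 f)
    (hc : HasCompactSupport f) (v : Eu d) : ∫ x, fderiv ℝ f x v = 0 := by
  have hi : Integrable fun x => fderiv ℝ f x v :=
    ((hf.continuous_fderiv (by simp)).clm_apply continuous_const).integrable_of_hasCompactSupport
      (hc.fderiv_apply ℝ v)
  have := integral_mul_fderiv_eq_neg_fderiv_mul_of_integrable (μ := (volume : Measure (Eu d)))
    (f := fun _ => (1 : ℝ)) (g := f) (v := v) (by simp) (by simpa using hi)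
    (by simpa using hf.continuous.integrable_of_hasCompactSupport hc)
    (fun x _ => differentiableAt_const _) (fun x _ => hf.differentiable (by simp) x)
  simpa using this

/-- `ℝ^(m+1)` as a product of the first axis and the hyperplane. -/
lemma measurePreserving_axis_prod (m : ℕ) :
    MeasurePreserving (fun p : ℝ × Eu m => p.1 • EuclideanSpace.single 0 1 + hyperIncl m p.2)
      volume volume := by
  have h1 := (volume_preserving_piFinSuccAbove (fun _ : Fin (m + 1) => ℝ) 0).symm
  have h2 := (EuclideanSpace.volume_preserving_symm_measurableEquiv_toLp (Fin m))
  have h3 := (EuclideanSpace.volume_preserving_symm_measurableEquiv_toLp (Fin (m + 1))).symm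
  have h4 := h3.comp (h1.comp ((MeasurePreserving.id (volume : Measure ℝ)).prod h2))
  have e : (fun p : ℝ × Eu m => p.1 • EuclideanSpace.single 0 1 + hyperIncl m p.2)
      = ((MeasurableEquiv.toLp 2 (Fin (m + 1) → ℝ)).symm.symm ∘
        (MeasurableEquiv.piFinSuccAbove (fun _ : Fin (m + 1) => ℝ) 0).symm ∘
        Prod.map id (MeasurableEquiv.toLp 2 (Fin m → ℝ)).symm) := by
    funext p
    ext i
    refine Fin.cases ?_ (fun j => ?_) i
    · simp [hyperIncl_zero, MeasurableEquiv.piFinSuccAbove, Fin.consEquiv]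
    · simp [hyperIncl_succ, MeasurableEquiv.piFinSuccAbove, Fin.consEquiv]
  rw [e]
  exact h4

lemma isometry_axis {m : ℕ} (y : Eu m) :
    Isometry fun t : ℝ => t • EuclideanSpace.single (0 : Fin (m + 1)) (1 : ℝ) + hyperIncl m y := by
  refine Isometry.of_dist_eq fun s t => ?_
  rw [dist_add_right, dist_eq_norm, ← sub_smul, norm_smul]
  simp [Real.dist_eq]

lemma isometry_hyperIncl_add {m : ℕ} (a : Eu (m + 1)) :
    Isometry fun y : Eu m => a + hyperIncl m y := by
  refine Isometry.of_dist_eq fun s t => ?_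
  rw [dist_add_left, (hyperIncl m).dist_map]

lemma integral_fderiv_halfspace_zero {m : ℕ} {f : Eu (m + 1) → ℝ} (hf : ContDiff ℝ 1 f)
    (hc : HasCompactSupport f) (v : Eu (m + 1)) :
    ∫ x in {x : Eu (m + 1) | x 0 < 0}, fderiv ℝ f x v
      = v 0 * ∫ y : Eu m, f (hyperIncl m y) := by
  let e₀ : Eu (m + 1) := EuclideanSpace.single 0 1
  let J : ℝ × Eu m → Eu (m + 1) := fun p => p.1 • e₀ + hyperIncl m p.2
  have hJ : MeasurePreserving J volume volume := measurePreserving_axis_prod m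
  have hJc : Continuous J := by
    have := (hyperIncl m).continuous
    fun_prop
  have hdf : ∀ u, Continuous fun x => fderiv ℝ f x u := fun u =>
    (hf.continuous_fderiv (by simp)).clm_apply continuous_const
  have hint : ∀ u, Integrable fun x => fderiv ℝ f x u := fun u =>
    (hdf u).integrable_of_hasCompactSupport (hc.fderiv_apply ℝ u)
  have hdiff : ∀ x, HasFDerivAt f (fderiv ℝ f x) x := fun x =>
    (hf.differentiable (by simp) x).hasFDerivAt
  have hmeas : MeasurableSet {x : Eu (m + 1) | x 0 < 0} :=
    measurableSet_lt (by fun_prop) measurable_const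
  have hpre : J ⁻¹' {x : Eu (m + 1) | x 0 < 0} = Iio 0 ×ˢ univ := by
    ext p
    simp [J, e₀, hyperIncl_zero]
  have hintJ : ∀ u, Integrable (fun p => fderiv ℝ f (J p) u) (volume.prod volume) := fun u =>
    hJ.integrable_comp_of_integrable (hint u)
  have hpull : ∀ u, ∫ x in {x : Eu (m + 1) | x 0 < 0}, fderiv ℝ f x u
      = ∫ p in Iio (0 : ℝ) ×ˢ (univ : Set (Eu m)), fderiv ℝ f (J p) u ∂(volume.prod volume) := by
    intro u
    rw [← hJ.map_eq, setIntegral_map hmeas (by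
      rw [hJ.map_eq]; exact (hdf u).aestronglyMeasurable) hJ.measurable.aemeasurable, hpre]
    rfl
  have hnormal : ∫ x in {x : Eu (m + 1) | x 0 < 0}, fderiv ℝ f x e₀
      = ∫ y : Eu m, f (hyperIncl m y) := by
    rw [hpull, ← Measure.prod_restrict, Measure.restrict_univ, integral_prod_symm _ (by
      have := (hintJ e₀).integrableOn (s := Iio (0 : ℝ) ×ˢ (univ : Set (Eu m)))
      rwa [IntegrableOn, ← Measure.prod_restrict, Measure.restrict_univ] at this)]
    refine integral_congr_ae (Filter.Eventually.of_forall fun y => ?_)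
    have h1 : ContDiff ℝ 1 fun t : ℝ => f (J (t, y)) := by
      refine hf.comp ?_
      exact (contDiff_id.smul contDiff_const).add (contDiff_const (c := hyperIncl m y))
    have h2 : HasCompactSupport fun t : ℝ => f (J (t, y)) :=
      hc.comp_isClosedEmbedding (isometry_axis y).isClosedEmbedding
    have h3 := h2.integral_Iic_deriv_eq h1 0
    rw [integral_Iic_eq_integral_Iio] at h3
    have h4 : ∀ t, deriv (fun t : ℝ => f (J (t, y))) t = fderiv ℝ f (J (t, y)) e₀ := by
      intro t
      have h5 : HasDerivAt (fun t : ℝ => J (t, y)) e₀ t := by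
        simpa [J] using ((hasDerivAt_id t).smul_const e₀).add_const (hyperIncl m y)
      exact ((hdiff (J (t, y))).comp_hasDerivAt t h5).deriv
    simp only [h4] at h3
    simpa [J] using h3
  have htang : ∀ u : Eu m, ∫ x in {x : Eu (m + 1) | x 0 < 0}, fderiv ℝ f x (hyperIncl m u)
      = 0 := by
    intro u
    rw [hpull, ← Measure.prod_restrict, Measure.restrict_univ, integral_prod _ (by
      have := (hintJ (hyperIncl m u)).integrableOn (s := Iio (0 : ℝ) ×ˢ (univ : Set (Eu m)))
      rwa [IntegrableOn, ← Measure.prod_restrict, Measure.restrict_univ] at this)]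
    rw [integral_congr_ae (g := fun _ => 0) (Filter.Eventually.of_forall fun t => ?_)]
    · simp
    have h1 : ContDiff ℝ 1 fun y : Eu m => f (J (t, y)) := by
      refine hf.comp ?_
      exact (contDiff_const (c := t • e₀)).add (hyperIncl m).contDiff
    have h2 : HasCompactSupport fun y : Eu m => f (J (t, y)) :=
      hc.comp_isClosedEmbedding (isometry_hyperIncl_add (t • e₀)).isClosedEmbedding
    have h3 := integral_fderiv_apply_eq_zero h1 h2 u
    have h4 : ∀ y, fderiv ℝ (fun y : Eu m => f (J (t, y))) y u
        = fderiv ℝ f (J (t, y)) (hyperIncl m u) := by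
      intro y
      have h5 : HasFDerivAt (fun y : Eu m => J (t, y)) (hyperIncl m).toContinuousLinearMap y :=
        ((hyperIncl m).toContinuousLinearMap.hasFDerivAt).const_add (t • e₀)
      have h6 : HasFDerivAt (fun y : Eu m => f (J (t, y))) _ y :=
        HasFDerivAt.comp (g := f) y (hdiff (J (t, y))) h5
      rw [h6.fderiv]
      rfl
    simpa only [h4] using h3
  have hv := eq_smul_single_add_hyperIncl v
  calc _ = ∫ x in {x : Eu (m + 1) | x 0 < 0},
        (v 0 * fderiv ℝ f x e₀ + fderiv ℝ f x (hyperIncl m (hyperProj m v))) := by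
        refine integral_congr_ae (Filter.Eventually.of_forall fun x => ?_)
        conv_lhs => rw [hv]
        simp [e₀]
    _ = _ := by
        rw [integral_add ((hint _).integrableOn.const_mul _) (hint _).integrableOn,
          integral_const_mul, hnormal, htang, add_zero]

/-- The divergence theorem on the half-space `⟪n, x - x₀⟫ < 0`, whose boundary hyperplane is
parametrised by `y ↦ x₀ + Θ y`, for a rotation `Θ` that takes the first axis to `n`. -/
lemma integral_fderiv_halfspace {m : ℕ} {f : Eu (m + 1) → ℝ} (hf : ContDiff ℝ 1 f)
    (hc : HasCompactSupport f) (x₀ : Eu (m + 1)) (Θ : Eu (m + 1) ≃ₗᵢ[ℝ] Eu (m + 1))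
    (v : Eu (m + 1)) :
    ∫ x in {x | ⟪Θ (EuclideanSpace.single 0 1), x - x₀⟫_ℝ < 0}, fderiv ℝ f x v
      = ⟪Θ (EuclideanSpace.single 0 1), v⟫_ℝ * ∫ y : Eu m, f (x₀ + Θ (hyperIncl m y)) := by
  let J : Eu (m + 1) → Eu (m + 1) := fun y => x₀ + Θ y
  have hJ : MeasurePreserving J volume volume :=
    (measurePreserving_add_left volume x₀).comp Θ.measurePreserving
  have hJi : Isometry J := by
    refine Isometry.of_dist_eq fun s t => ?_
    rw [dist_add_left, Θ.dist_map]
  have hJe : MeasurableEmbedding J := hJi.isClosedEmbedding.measurableEmbedding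
  have hpre : J ⁻¹' {x | ⟪Θ (EuclideanSpace.single 0 1), x - x₀⟫_ℝ < 0}
      = {y : Eu (m + 1) | y 0 < 0} := by
    ext y
    simp [J, EuclideanSpace.inner_single_left]
  rw [← hJ.setIntegral_preimage_emb hJe, hpre]
  have hfd : ∀ y, fderiv ℝ f (J y) v = fderiv ℝ (fun y => f (J y)) y (Θ.symm v) := by
    intro y
    have h5 : HasFDerivAt J (Θ.toContinuousLinearEquiv : Eu (m + 1) →L[ℝ] Eu (m + 1)) y :=
      ((Θ.toContinuousLinearEquiv : Eu (m + 1) →L[ℝ] Eu (m + 1)).hasFDerivAt).const_add x₀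
    have h6 : HasFDerivAt (fun y => f (J y)) _ y :=
      HasFDerivAt.comp (g := f) y (hf.differentiable (by simp) (J y)).hasFDerivAt h5
    rw [h6.fderiv]
    simp
  simp only [hfd]
  rw [integral_fderiv_halfspace_zero]
  · congr 1
    rw [← Θ.symm.inner_map_map]
    simp [EuclideanSpace.inner_single_left]
  · exact hf.comp ((contDiff_const (c := x₀)).add Θ.contDiff)
  · exact hc.comp_isClosedEmbedding hJi.isClosedEmbedding

/-! ### Integration by parts with polynomials, and surface integrals -/

section IntegrationByParts

variable {d : ℕ} {p ψ : Eu d → ℝ}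

lemma fderiv_mul_test_apply (hp : ContDiff ℝ 1 p) (hψ : IsTest ψ) (x v : Eu d) :
    fderiv ℝ (fun x => p x * ψ x) x v = p x * fderiv ℝ ψ x v + fderiv ℝ p x v * ψ x := by
  rw [fderiv_fun_mul (hp.differentiable (by simp) x) (hψ.1.differentiable (by simp) x)]
  simp; ring

lemma IsTest.fderiv_apply (hψ : IsTest ψ) (v : Eu d) : IsTest fun x => fderiv ℝ ψ x v :=
  ⟨(hψ.1.fderiv_right (m := ((⊤ : ℕ∞) : WithTop ℕ∞)) (by simp)).clm_apply contDiff_const,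
    hψ.2.fderiv_apply ℝ v⟩

lemma integrable_mul_test (hp : Continuous p) (hψ : IsTest ψ) : Integrable fun x => p x * ψ x :=
  (hp.mul hψ.1.continuous).integrable_of_hasCompactSupport hψ.2.mul_left

lemma integral_mul_fderiv_test (hp : ContDiff ℝ 1 p) (hψ : IsTest ψ) (v : Eu d) :
    ∫ x, p x * fderiv ℝ ψ x v = -∫ x, fderiv ℝ p x v * ψ x := by
  have h := integral_fderiv_apply_eq_zero (f := fun x => p x * ψ x)
    (hp.mul (hψ.1.of_le (by exact_mod_cast le_top))) hψ.2.mul_left v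
  simp only [fderiv_mul_test_apply hp hψ] at h
  rw [integral_add (integrable_mul_test hp.continuous (hψ.fderiv_apply v))
    (integrable_mul_test ((hp.continuous_fderiv (by simp)).clm_apply continuous_const) hψ)] at h
  linarith

end IntegrationByParts

section HalfSpace

variable {m : ℕ} {p ψ : Eu (m + 1) → ℝ} {n : Eu (m + 1)} {Θ : Eu (m + 1) ≃ₗᵢ[ℝ] Eu (m + 1)}

lemma setIntegral_halfspace_mul_fderiv (hΘ : Θ (EuclideanSpace.single 0 1) = n)
    (hp : ContDiff ℝ 1 p) (hψ : IsTest ψ) (x₀ v : Eu (m + 1)) :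
    ∫ x in {x | ⟪n, x - x₀⟫_ℝ < 0}, p x * fderiv ℝ ψ x v
      = ⟪n, v⟫_ℝ * (∫ y : Eu m, p (x₀ + Θ (hyperIncl m y)) * ψ (x₀ + Θ (hyperIncl m y)))
        - ∫ x in {x | ⟪n, x - x₀⟫_ℝ < 0}, fderiv ℝ p x v * ψ x := by
  subst hΘ
  have h := integral_fderiv_halfspace (f := fun x => p x * ψ x)
    (hp.mul (hψ.1.of_le (by exact_mod_cast le_top))) hψ.2.mul_left x₀ Θ v
  simp only [fderiv_mul_test_apply hp hψ] at h
  rw [integral_add (integrable_mul_test hp.continuous (hψ.fderiv_apply v)).integrableOn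
    (integrable_mul_test ((hp.continuous_fderiv (by simp)).clm_apply continuous_const)
      hψ).integrableOn] at h
  linarith

lemma measurableSet_halfspace (n x₀ : Eu (m + 1)) :
    MeasurableSet {x | ⟪n, x - x₀⟫_ℝ < 0} :=
  measurableSet_lt (by fun_prop) measurable_const

lemma setIntegral_compl_halfspace_mul_fderiv (hΘ : Θ (EuclideanSpace.single 0 1) = n)
    (hp : ContDiff ℝ 1 p) (hψ : IsTest ψ) (x₀ v : Eu (m + 1)) :
    ∫ x in {x | ⟪n, x - x₀⟫_ℝ < 0}ᶜ, p x * fderiv ℝ ψ x v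
      = -(⟪n, v⟫_ℝ * ∫ y : Eu m, p (x₀ + Θ (hyperIncl m y)) * ψ (x₀ + Θ (hyperIncl m y)))
        - ∫ x in {x | ⟪n, x - x₀⟫_ℝ < 0}ᶜ, fderiv ℝ p x v * ψ x := by
  have h := setIntegral_halfspace_mul_fderiv hΘ hp hψ x₀ v
  have h2 := integral_mul_fderiv_test hp hψ v
  rw [← integral_add_compl (measurableSet_halfspace n x₀)
    (integrable_mul_test hp.continuous (hψ.fderiv_apply v)),
    ← integral_add_compl (measurableSet_halfspace n x₀) (integrable_mul_test
      ((hp.continuous_fderiv (by simp)).clm_apply continuous_const) hψ)] at h2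
  linarith

/-- Isometric coordinates of a hyperplane take the surface measure on it to the Lebesgue measure, by
the normalisation of the Hausdorff measure. -/
lemma setIntegral_surf_le {S : Set (Eu (m + 1))} {x₀ : Eu (m + 1)} {R : ℝ}
    (hS : ∀ x ∈ S, ∃ y ∈ Metric.closedBall (0 : Eu m) R, x₀ + Θ (hyperIncl m y) = x)
    {g : Eu (m + 1) → ℝ} (hg : Continuous g) (hg0 : ∀ x, 0 ≤ g x) :
    ∫ x in S, g x ∂(surf (m + 1))
      ≤ ∫ y in Metric.closedBall (0 : Eu m) R, g (x₀ + Θ (hyperIncl m y)) := by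
  let J : Eu m → Eu (m + 1) := fun y => x₀ + Θ (hyperIncl m y)
  have hJ : Isometry J := by
    refine Isometry.of_dist_eq fun s t => ?_
    rw [dist_add_left, Θ.dist_map, (hyperIncl m).dist_map]
  have hJe : MeasurableEmbedding J := hJ.isClosedEmbedding.measurableEmbedding
  have hmap : (volume : Measure (Eu m)).map J = (surf (m + 1)).restrict (range J) := by
    rw [← EuclideanSpace.euclideanHausdorffMeasure_eq_volume]
    exact hJ.map_euclideanHausdorffMeasure
  have hsub : S ⊆ J '' Metric.closedBall 0 R := fun x hx => by
    obtain ⟨y, hy, h⟩ := hS x hx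
    exact ⟨y, hy, h⟩
  have hres : (surf (m + 1)).restrict (J '' Metric.closedBall 0 R)
      = ((volume : Measure (Eu m)).map J).restrict (J '' Metric.closedBall 0 R) := by
    rw [hmap, Measure.restrict_restrict_of_subset (image_subset_range _ _)]
  have hpre : J ⁻¹' (J '' Metric.closedBall 0 R) = Metric.closedBall 0 R :=
    preimage_image_eq _ hJ.injective
  have hint : IntegrableOn g (J '' Metric.closedBall 0 R) (surf (m + 1)) := by
    rw [IntegrableOn, hres, ← IntegrableOn, hJe.integrableOn_map_iff, hpre]
    exact (hg.comp hJ.continuous).continuousOn.integrableOn_compact (isCompact_closedBall _ _)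
  calc _ ≤ ∫ x in J '' Metric.closedBall 0 R, g x ∂(surf (m + 1)) :=
        setIntegral_mono_set hint (Filter.Eventually.of_forall fun x => hg0 x)
          (Filter.Eventually.of_forall hsub)
    _ = _ := by rw [hres, hJe.setIntegral_map, hpre]

end HalfSpace

/-! ### Simplices -/

lemma isCompact_hull {d : ℕ} (T : Finset (Eu d)) : IsCompact (hull T) :=
  Set.Finite.isCompact_convexHull (𝕜 := ℝ) T.finite_toSet

lemma hull_mono {d : ℕ} {l T : Finset (Eu d)} (h : l ⊆ T) : hull l ⊆ hull T :=
  convexHull_mono (by exact_mod_cast h)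

lemma size_mono {d : ℕ} {l T : Finset (Eu d)} (h : l ⊆ T) : size l ≤ size T :=
  Metric.diam_mono (hull_mono h) (isCompact_hull T).isBounded

lemma size_pos {d : ℕ} {l : Finset (Eu d)} (h : 1 < l.card) : 0 < size l := by
  obtain ⟨a, ha, b, hb, hab⟩ := Finset.one_lt_card.1 h
  exact (dist_pos.2 hab).trans_le (Metric.dist_le_diam_of_mem (isCompact_hull l).isBounded
    (subset_convexHull ℝ _ ha) (subset_convexHull ℝ _ hb))

/-- The barycentre of the simplex with vertex set `l`. -/
def bary {d : ℕ} (l : Finset (Eu d)) : Eu d := ∑ v ∈ l, (l.card : ℝ)⁻¹ • v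

lemma bary_mem_hull {d : ℕ} {l : Finset (Eu d)} (hl : l.Nonempty) : bary l ∈ hull l := by
  have hc : (l.card : ℝ) ≠ 0 := by exact_mod_cast hl.card_ne_zero
  refine (convex_convexHull ℝ _).sum_mem (fun _ _ => by positivity) ?_
    fun v hv => subset_convexHull ℝ _ hv
  simp [hc]

/-- Barycentric coordinates of a simplex of full dimension. -/
lemma exists_affineBasis {d : ℕ} {T : Finset (Eu d)}
    (hT : AffineIndependent ℝ ((↑) : T → Eu d)) (hc : T.card = d + 1) :
    ∃ b : AffineBasis T ℝ (Eu d), ∀ i, b i = i := by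
  have htop : affineSpan ℝ (range ((↑) : T → Eu d)) = ⊤ := by
    rw [hT.affineSpan_eq_top_iff_card_eq_finrank_add_one]
    simp [hc]
  exact ⟨⟨_, hT, htop⟩, fun i => rfl⟩

section Facet

variable {d : ℕ} {T l : Finset (Eu d)} {a : Eu d} {b : AffineBasis T ℝ (Eu d)}

lemma mem_hull_iff (hb : ∀ i, b i = i) (y : Eu d) : y ∈ hull T ↔ ∀ i, 0 ≤ b.coord i y := by
  have : (T : Set (Eu d)) = range b := by
    ext x; simp [hb]
  rw [hull, this, b.convexHull_eq_nonneg_coord]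
  rfl

lemma coord_sub (i : T) (y x : Eu d) :
    b.coord i y - b.coord i x = (b.coord i).linear (y - x) := by
  simpa using ((b.coord i).linearMap_vsub y x).symm

lemma coord_bary (hb : ∀ i, b i = i) (hl : l ⊆ T) (hne : l.Nonempty) (i : T) :
    b.coord i (bary l) = if (i : Eu d) ∈ l then (l.card : ℝ)⁻¹ else 0 := by
  have hc : (l.card : ℝ) ≠ 0 := by exact_mod_cast hne.card_ne_zero
  have h1 : ∀ y, b.coord i y = (b.coord i).linear y + b.coord i 0 := fun y => by
    have := coord_sub (b := b) i y 0
    rw [sub_zero] at this; linarith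
  have h2 : b.coord i (bary l) = ∑ v ∈ l, (l.card : ℝ)⁻¹ * b.coord i v := by
    simp_rw [h1 (bary l), bary, map_sum, map_smul, smul_eq_mul]
    conv_rhs => enter [2, v]; rw [h1 v, mul_add]
    rw [Finset.sum_add_distrib]
    simp [hc]
  have h3 : ∀ v ∈ l, b.coord i v = if v = i then 1 else 0 := fun v hv => by
    have := b.coord_apply i ⟨v, hl hv⟩
    rw [hb] at this
    simp only [this, Subtype.ext_iff, eq_comm]
  rw [h2, Finset.sum_congr rfl fun v hv => by rw [h3 v hv]]
  simp

lemma inner_sub_bary (hb : ∀ i, b i = i) (haT : a ∈ T) (hl : ∀ v ∈ T, v ≠ a → v ∈ l)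
    (hne : l.Nonempty) {n : Eu d} (hn : ∀ x ∈ hull l, ∀ y ∈ hull l, ⟪n, y - x⟫_ℝ = 0) (y : Eu d) :
    ⟪n, y - bary l⟫_ℝ = b.coord ⟨a, haT⟩ y * ⟪n, a - bary l⟫_ℝ := by
  have h1 : y - bary l = ∑ i, b.coord i y • ((i : Eu d) - bary l) := by
    simp_rw [smul_sub]
    rw [Finset.sum_sub_distrib, ← Finset.sum_smul, b.sum_coord_apply_eq_one, one_smul]
    congr 1
    have := b.linear_combination_coord_eq_self y
    simpa [hb] using this.symm
  conv_lhs => rw [h1]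
  rw [inner_sum, Finset.sum_eq_single ⟨a, haT⟩]
  · rw [inner_smul_right]
  · intro i _ hi
    have hil : (i : Eu d) ∈ l := hl i i.2 fun h => hi (Subtype.ext h)
    rw [inner_smul_right, hn _ (bary_mem_hull hne) _ (subset_convexHull ℝ _ hil), mul_zero]
  · simp

/-- Barycentric coordinates of a simplex that contains a ball of radius `r` are Lipschitz with
constant `1 / (2 r)`. -/
lemma abs_coord_linear_le (hb : ∀ i, b i = i) {c : Eu d} {r : ℝ}
    (hball : Metric.closedBall c r ⊆ hull T) (i : T) {v : Eu d} (hv : ‖v‖ ≤ r) :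
    |(b.coord i).linear v| ≤ 1 / 2 := by
  have h01 : ∀ y ∈ hull T, 0 ≤ b.coord i y ∧ b.coord i y ≤ 1 := fun y hy => by
    have h := (mem_hull_iff hb y).1 hy
    refine ⟨h i, ?_⟩
    rw [← b.sum_coord_apply_eq_one y]
    exact Finset.single_le_sum (f := fun i => b.coord i y) (fun j _ => h j) (Finset.mem_univ i)
  have hp := h01 (c + v) (hball (by simpa [mem_closedBall_iff_norm] using hv))
  have hm := h01 (c - v) (hball (by simpa [mem_closedBall_iff_norm] using hv))
  have h := coord_sub (b := b) i (c + v) (c - v)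
  rw [show c + v - (c - v) = (2 : ℝ) • v by rw [two_smul]; abel, map_smul, smul_eq_mul] at h
  rw [abs_le]
  constructor <;> linarith [hp.1, hp.2, hm.1, hm.2]

end Facet

section SharedFacet

variable {m : ℕ} {T l : Finset (Eu (m + 1))} {n : Eu (m + 1)}

lemma exists_opposite_vertex (hcT : T.card = m + 1 + 1) (hcl : l.card = m + 1) (hl : l ⊆ T) :
    ∃ a ∈ T, a ∉ l ∧ ∀ v ∈ T, v ≠ a → v ∈ l := by
  have h1 : (T \ l).card = 1 := by
    rw [Finset.card_sdiff_of_subset hl]; omega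
  obtain ⟨a, ha⟩ := Finset.card_eq_one.1 h1
  have ha' : ∀ v, v ∈ T \ l ↔ v = a := fun v => by rw [ha]; simp
  have h2 := (ha' a).2 rfl
  rw [Finset.mem_sdiff] at h2
  refine ⟨a, h2.1, h2.2, fun v hv hne => ?_⟩
  by_contra hvl
  exact hne ((ha' v).1 (Finset.mem_sdiff.2 ⟨hv, hvl⟩))

/-- The half-ball about the barycentre of a facet, on the inner side of the facet, lies in the
simplex if the simplex contains a ball of comparable radius. -/
lemma halfBall_subset_hull (hT : AffineIndependent ℝ ((↑) : T → Eu (m + 1)))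
    (hcT : T.card = m + 1 + 1) (hcl : l.card = m + 1) (hl : l ⊆ T) (hn : IsOuterNormal T l n)
    {c : Eu (m + 1)} {r : ℝ} (hball : Metric.closedBall c r ⊆ hull T) {y : Eu (m + 1)}
    (hy : ‖y - bary l‖ ≤ 2 * r / (m + 1)) (hny : ⟪n, y - bary l⟫_ℝ ≤ 0) : y ∈ hull T := by
  obtain ⟨b, hb⟩ := exists_affineBasis hT hcT
  obtain ⟨a, haT, hal, hla⟩ := exists_opposite_vertex hcT hcl hl
  have hne : l.Nonempty := Finset.card_pos.1 (by omega)
  have hinner := inner_sub_bary hb haT hla hne hn.normal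
  have hm : (0 : ℝ) < m + 1 := by positivity
  rw [mem_hull_iff hb]
  intro i
  by_cases hia : (i : Eu (m + 1)) = a
  · have h1 : ⟪n, a - bary l⟫_ℝ ≤ 0 :=
      hn.outer _ (bary_mem_hull hne) _ (subset_convexHull ℝ _ haT)
    have h2 : ⟪n, a - bary l⟫_ℝ ≠ 0 := fun h0 => by
      have h3 := hinner (bary l + n)
      rw [h0, mul_zero, add_sub_cancel_left, real_inner_self_eq_norm_sq, hn.unit] at h3
      norm_num at h3
    rw [show i = ⟨a, haT⟩ from Subtype.ext hia]
    have h3 := hinner y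
    by_contra hneg
    have := mul_pos_of_neg_of_neg (not_le.1 hneg) (lt_of_le_of_ne h1 h2)
    linarith
  · have hil : (i : Eu (m + 1)) ∈ l := hla i i.2 hia
    have h1 := coord_bary hb hl hne i
    rw [if_pos hil, hcl] at h1
    have h2 := abs_coord_linear_le hb hball i (v := (((m : ℝ) + 1) / 2) • (y - bary l)) (by
      rw [norm_smul, Real.norm_of_nonneg (by positivity)]
      rw [le_div_iff₀ hm] at hy
      linarith)
    rw [map_smul, smul_eq_mul, ← coord_sub, h1] at h2
    push_cast at h2
    have h3 := (abs_le.1 h2).1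
    have h4 : ((m : ℝ) + 1) * ((m : ℝ) + 1)⁻¹ = 1 := mul_inv_cancel₀ hm.ne'
    by_contra hneg
    nlinarith [not_le.1 hneg]

/-- The outward normals of two simplices on a common facet are opposite to each other. -/
lemma outerNormal_eq_neg {K : Geometry.SimplicialComplex ℝ (Eu (m + 1))}
    {T' : Finset (Eu (m + 1))} {n' : Eu (m + 1)} (hs : IsSharedFacet K l T T')
    (hn : IsOuterNormal T l n) (hn' : IsOuterNormal T' l n') {c c' : Eu (m + 1)} {r r' : ℝ}
    (hr : 0 < r) (hr' : 0 < r') (hball : Metric.closedBall c r ⊆ hull T)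
    (hball' : Metric.closedBall c' r' ⊆ hull T') : n' = -n := by
  have hcl := hs.facet.2
  have hne : l.Nonempty := Finset.card_pos.1 (by omega)
  obtain ⟨b, hb⟩ := exists_affineBasis (K.indep hs.cell.1) hs.cell.2
  obtain ⟨a, haT, hal, hla⟩ := exists_opposite_vertex hs.cell.2 hcl hs.subset
  have hinner := inner_sub_bary hb haT hla hne hn.normal
  have hinner' := inner_sub_bary hb haT hla hne hn'.normal
  have hnn : ⟪n, n⟫_ℝ = 1 := by rw [real_inner_self_eq_norm_sq, hn.unit]; norm_num
  have hnn' : ⟪n', n'⟫_ℝ = 1 := by rw [real_inner_self_eq_norm_sq, hn'.unit]; norm_num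
  have h2 : ⟪n, a - bary l⟫_ℝ ≠ 0 := fun h0 => by
    have h3 := hinner (bary l + n)
    rw [h0, mul_zero, add_sub_cancel_left, hnn] at h3
    norm_num at h3
  -- Both normals are orthogonal to the facet, so they are proportional.
  have hpar : n' = ⟪n, n'⟫_ℝ • n := by
    let u := n' - ⟪n, n'⟫_ℝ • n
    have hu : ⟪n, u⟫_ℝ = 0 := by
      simp only [u, inner_sub_right, inner_smul_right, hnn]; ring
    have h3 := hinner (bary l + u)
    rw [add_sub_cancel_left, hu] at h3
    have h4 := (mul_eq_zero.1 h3.symm).resolve_right h2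
    have h5 := hinner' (bary l + u)
    rw [h4, zero_mul, add_sub_cancel_left] at h5
    have h6 : ⟪u, u⟫_ℝ = 0 := by
      have : ⟪u, u⟫_ℝ = ⟪n', u⟫_ℝ - ⟪n, n'⟫_ℝ * ⟪n, u⟫_ℝ := by
        conv_lhs => arg 2; rw [show u = n' - ⟪n, n'⟫_ℝ • n from rfl]
        rw [inner_sub_left, inner_smul_left]; simp
      rw [this, h5, hu]; ring
    have h7 : u = 0 := inner_self_eq_zero.1 h6
    exact sub_eq_zero.1 h7
  set s := ⟪n, n'⟫_ℝ
  have hs2 : s * s = 1 := by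
    rw [hpar, inner_smul_left, inner_smul_right, hnn] at hnn'
    simpa using hnn'
  rcases mul_self_eq_one_iff.1 hs2 with h | h
  · exfalso
    rw [h, one_smul] at hpar
    -- Equal normals would put a small half-ball into both simplices.
    let t := min (2 * r / (m + 1)) (2 * r' / (m + 1))
    have ht : 0 < t := lt_min (by positivity) (by positivity)
    let y := bary l - t • n
    have hy : y - bary l = -(t • n) := by simp [y]
    have hyn : ‖y - bary l‖ = t := by
      rw [hy, norm_neg, norm_smul, hn.unit, Real.norm_of_nonneg ht.le, mul_one]
    have hyi : ⟪n, y - bary l⟫_ℝ = -t := by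
      rw [hy, inner_neg_right, inner_smul_right, hnn, mul_one]
    have hyT : y ∈ hull T := halfBall_subset_hull (K.indep hs.cell.1) hs.cell.2 hcl hs.subset hn
      hball (hyn.trans_le (min_le_left _ _)) (by linarith)
    have hyT' : y ∈ hull T' := halfBall_subset_hull (K.indep hs.cell'.1) hs.cell'.2 hcl hs.subset'
      hn' hball' (hyn.trans_le (min_le_right _ _)) (by rw [hpar]; linarith)
    have hinter : T ∩ T' ⊆ l := by
      have h1 : l ⊆ T ∩ T' := Finset.subset_inter hs.subset hs.subset'
      have h3 : (T ∩ T').card ≤ l.card := by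
        by_contra hlt
        have h4 : T ∩ T' = T := Finset.eq_of_subset_of_card_le Finset.inter_subset_left (by
          rw [hs.cell.2]; omega)
        have h5 : T ∩ T' = T' := Finset.eq_of_subset_of_card_le Finset.inter_subset_right (by
          rw [hs.cell'.2]; omega)
        exact hs.ne (h4.symm.trans h5)
      exact (Finset.eq_of_subset_of_card_le h1 h3).symm.subset
    have hyl : y ∈ hull l := by
      have := K.inter_subset_convexHull hs.cell.1 hs.cell'.1 ⟨hyT, hyT'⟩
      rw [← Finset.coe_inter] at this
      exact convexHull_mono (by exact_mod_cast hinter) this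
    have := hn.normal _ (bary_mem_hull hne) _ hyl
    linarith
  · rw [hpar, h]; simp

lemma exists_hyperIncl_eq {Θ : Eu (m + 1) ≃ₗᵢ[ℝ] Eu (m + 1)}
    (hΘ : Θ (EuclideanSpace.single 0 1) = n)
    (hn : ∀ x ∈ hull l, ∀ y ∈ hull l, ⟪n, y - x⟫_ℝ = 0) (hne : l.Nonempty) :
    ∀ x ∈ hull l, ∃ y ∈ Metric.closedBall (0 : Eu m) (size l),
      bary l + Θ (hyperIncl m y) = x := by
  intro x hx
  let z := Θ.symm (x - bary l)
  have hz0 : z 0 = 0 := by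
    have h := hn _ (bary_mem_hull hne) x hx
    rw [← hΘ, ← Θ.symm.inner_map_map] at h
    simpa [z, EuclideanSpace.inner_single_left] using h
  have hz : hyperIncl m (hyperProj m z) = z := by
    conv_rhs => rw [eq_smul_single_add_hyperIncl z, hz0, zero_smul, zero_add]
  refine ⟨hyperProj m z, ?_, ?_⟩
  · rw [mem_closedBall_zero_iff, ← (hyperIncl m).norm_map, hz, Θ.symm.norm_map, ← dist_eq_norm]
    exact Metric.dist_le_diam_of_mem (isCompact_hull l).isBounded hx (bary_mem_hull hne)
  · rw [hz]; simp [z]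

end SharedFacet

/-! ### Domains with Lipschitz boundary -/

/-- A Lipschitz domain lies on one side of its boundary. -/
lemma interior_closure_eq {d : ℕ} {Ω : Set (Eu d)} (ho : IsOpen Ω) (hL : HasLipschitzBoundary Ω) :
    interior (closure Ω) = Ω := by
  refine Subset.antisymm (fun x hx => ?_) (ho.subset_interior_closure)
  by_contra hxΩ
  have hxf : x ∈ frontier Ω := ⟨interior_subset hx, by rwa [ho.interior_eq]⟩
  obtain ⟨e, he, L, f, hf, U, hU, h⟩ := hL x hxf
  have hxU : x ∈ U := mem_of_mem_nhds hU
  have hfx : ⟪e, x⟫_ℝ ≤ f (x - ⟪e, x⟫_ℝ • e) := by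
    by_contra hlt
    exact hxΩ ((h x hxU).2 (not_le.1 hlt))
  -- Points `x - s e` with small `s > 0` are exterior.
  have hee : ⟪e, e⟫_ℝ = 1 := by rw [real_inner_self_eq_norm_sq, he]; norm_num
  have hV : interior U ∩ interior (closure Ω) ∈ nhds x :=
    Filter.inter_mem (interior_mem_nhds.2 hU) (isOpen_interior.mem_nhds hx)
  have hc : Filter.Tendsto (fun s : ℝ => x - s • e) (nhdsWithin 0 (Ioi 0)) (nhds x) := by
    have : Continuous fun s : ℝ => x - s • e := by fun_prop
    have h0 := this.tendsto 0
    simp only [zero_smul, sub_zero] at h0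
    exact h0.mono_left nhdsWithin_le_nhds
  obtain ⟨s, hsV, hs⟩ := ((hc.eventually hV).and self_mem_nhdsWithin).exists
  have hs : 0 < s := hs
  let y := x - s • e
  have hopen : IsOpen (interior U ∩ {z | ⟪e, z⟫_ℝ < f (z - ⟪e, z⟫_ℝ • e)}) := by
    refine isOpen_interior.inter (isOpen_lt (by fun_prop) (hf.continuous.comp (by fun_prop)))
  have hy : y ∈ interior U ∩ {z | ⟪e, z⟫_ℝ < f (z - ⟪e, z⟫_ℝ • e)} := by
    refine ⟨hsV.1, ?_⟩
    have h1 : ⟪e, y⟫_ℝ = ⟪e, x⟫_ℝ - s := by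
      simp only [y, inner_sub_right, inner_smul_right, hee]; ring
    have h2 : y - ⟪e, y⟫_ℝ • e = x - ⟪e, x⟫_ℝ • e := by
      rw [h1, sub_smul]; simp only [y]; abel
    change ⟪e, y⟫_ℝ < f (y - ⟪e, y⟫_ℝ • e)
    rw [h2, h1]
    linarith
  obtain ⟨z, hz1, hz2⟩ := mem_closure_iff.1 (interior_subset hsV.2) _ hopen hy
  have := (h z (interior_subset hz1.1)).1 hz2
  have h3 : ⟪e, z⟫_ℝ < f (z - ⟪e, z⟫_ℝ • e) := hz1.2
  linarith

/-! ### Smooth test fields in the fluid -/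

section TestField

variable {d : ℕ}

lemma setIntegral_eq_of_tsupport_subset {f ψ : Eu d → ℝ} {S : Set (Eu d)}
    (hS : tsupport ψ ⊆ S) (hf : ∀ x, x ∉ tsupport ψ → f x = 0) : ∫ x in S, f x = ∫ x, f x :=
  setIntegral_eq_integral_of_forall_compl_eq_zero fun x hx => hf x fun h => hx (hS h)

lemma fderiv_eq_zero_of_notMem_tsupport {ψ : Eu d → ℝ} {x : Eu d} (hx : x ∉ tsupport ψ) :
    fderiv ℝ ψ x = 0 := by
  by_contra h
  exact hx (support_fderiv_subset ℝ h)

lemma toLp_eq_sum_single (v : Eu d) : v = ∑ i, v i • EuclideanSpace.single i (1 : ℝ) := by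
  ext j; simp [Finset.sum_apply, Pi.single_apply]

/-- Green's formula without boundary term for smooth fields supported in `Ω`. -/
lemma green_testField {Ω : Set (Eu d)} {τ : Fin d → Eu d → ℝ} (hτ : ∀ i, IsTest (τ i))
    (hs : ∀ i, tsupport (τ i) ⊆ Ω) {φ : Eu d → ℝ} (hφ : IsTest φ) :
    (∫ x in Ω, fderiv ℝ φ x (WithLp.toLp 2 fun i => τ i x))
      + (∫ x in Ω, (∑ i, fderiv ℝ (τ i) x (EuclideanSpace.single i 1)) * φ x) = 0 := by
  have h1 : ∀ x, fderiv ℝ φ x (WithLp.toLp 2 fun i => τ i x)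
      = ∑ i, fderiv ℝ φ x (EuclideanSpace.single i 1) * τ i x := fun x => by
    rw [toLp_eq_sum_single (WithLp.toLp 2 fun i => τ i x), map_sum]
    refine Finset.sum_congr rfl fun i _ => ?_
    rw [map_smul, smul_eq_mul, mul_comm]
  have hφc : ∀ v, Continuous fun x => fderiv ℝ φ x v := fun v => (hφ.fderiv_apply v).1.continuous
  simp_rw [h1, Finset.sum_mul]
  rw [integral_finsetSum _ fun i _ => (integrable_mul_test (hφc _) (hτ i)).integrableOn,
    integral_finsetSum _ fun i _ => (integrable_mul_test (p := fun x =>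
      fderiv ℝ (τ i) x (EuclideanSpace.single i 1)) ((hτ i).fderiv_apply _).1.continuous
      hφ).integrableOn,
    ← Finset.sum_add_distrib]
  refine Finset.sum_eq_zero fun i _ => ?_
  have h2 := integral_mul_fderiv_test (p := φ) (hφ.1.of_le (by exact_mod_cast le_top)) (hτ i)
    (EuclideanSpace.single i 1)
  rw [setIntegral_eq_of_tsupport_subset (hs i) fun x hx => by
      rw [image_eq_zero_of_notMem_tsupport hx, mul_zero],
    setIntegral_eq_of_tsupport_subset (hs i) fun x hx => by
      rw [fderiv_eq_zero_of_notMem_tsupport hx]; simp]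
  simp_rw [mul_comm (fderiv ℝ (τ i) _ _)]
  linarith

/-- A smooth field supported in the fluid domain, extended by zero to the solid, is an admissible
test function of the coupled problem. -/
lemma exists_testField (G : Config d) {τ : Fin d → Eu d → ℝ} (hτ : ∀ i, IsTest (τ i))
    (hs : ∀ i, tsupport (τ i) ⊆ G.Ωf) :
    ∃ z : HSpace G, z.v.fn = 0 ∧ z.v.grad = 0 ∧ z.q = 0 ∧
      (z.τ.fn = fun x => WithLp.toLp 2 fun i => τ i x) ∧
      (z.τ.div = fun x => ∑ i, fderiv ℝ (τ i) x (EuclideanSpace.single i 1)) ∧ z.τ.ntr = 0 := by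
  have hc : Continuous fun x => (WithLp.toLp 2 fun i => τ i x : Eu d) :=
    (PiLp.continuous_toLp 2 _).comp (continuous_pi fun i => (hτ i).1.continuous)
  have hcs : HasCompactSupport fun x => (WithLp.toLp 2 fun i => τ i x : Eu d) := by
    refine HasCompactSupport.intro (K := ⋃ i, tsupport (τ i))
      (isCompact_iUnion fun i => (hτ i).2) fun x hx => ?_
    ext i
    exact image_eq_zero_of_notMem_tsupport (f := τ i) fun h => hx (mem_iUnion.2 ⟨i, h⟩)
  let t : WSpace G :=
    { fn := fun x => WithLp.toLp 2 fun i => τ i x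
      div := fun x => ∑ i, fderiv ℝ (τ i) x (EuclideanSpace.single i 1)
      memLp_fn := (hc.memLp_of_hasCompactSupport hcs).restrict _
      memLp_div := memLp_finsetSum _ fun i _ =>
        (((hτ i).fderiv_apply _).1.continuous.memLp_of_hasCompactSupport
          ((hτ i).fderiv_apply _).2).restrict _
      weak_div := fun φ hφ _ => by
        have := green_testField hτ hs hφ
        linarith
      ntr := 0
      memLp_ntr := MemLp.zero'
      green := fun φ hφ _ => by
        rw [green_testField hτ hs hφ]; simp }
  let v : VSpace G :=
    { fn := 0
      grad := 0
      memLp_fn := MemLp.zero'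
      memLp_grad := fun i j => MemLp.zero'
      weak_grad := fun i j φ _ _ => by simp
      clamped := fun i j φ _ _ => by simp }
  refine ⟨⟨v, t, 0, MemLp.zero', fun φ hφ _ => ?_⟩, rfl, rfl, rfl, rfl, rfl, rfl⟩
  rw [green_testField hτ hs hφ]
  simp [v, H1Vec.div]

variable {G : Config d} {m : Material d} {c ρF ω : ℝ} {z : HSpace G}

/-- The equation of the fluid, tested with a smooth field supported in the fluid domain. -/
lemma eigen_testField (hz : IsEigen G m c ρF univ (ω ^ 2) z) {τ : Fin d → Eu d → ℝ}
    (hτ : ∀ i, IsTest (τ i)) (hs : ∀ i, tsupport (τ i) ⊆ G.Ωf) :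
    (∫ x in G.Ωf, c ^ 2 * ρF * z.τ.div x * ∑ i, fderiv ℝ (τ i) x (EuclideanSpace.single i 1))
      = ω ^ 2 * ∫ x in G.Ωf, ρF * ∑ i, z.τ.fn x i * τ i x := by
  obtain ⟨z', hv, hg, hq, hf, hd, hn⟩ := exists_testField G hτ hs
  have h := hz.2.2 z' (mem_univ _)
  simp only [formA, formB, H1Vec.strain, H1Vec.div, hv, hg, hq, hf, hd, hn] at h
  simp only [PiLp.inner_apply] at h
  simp at h
  simp_rw [mul_comm (z.τ.fn _ _)]
  linarith

lemma IsTest.mul_const {ψ : Eu d → ℝ} (hψ : IsTest ψ) (a : ℝ) : IsTest fun x => ψ x * a :=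
  ⟨hψ.1.mul contDiff_const, hψ.2.mul_right⟩

lemma IsTest.sub {φ ψ : Eu d → ℝ} (hφ : IsTest φ) (hψ : IsTest ψ) : IsTest fun x => φ x - ψ x :=
  ⟨hφ.1.sub hψ.1, hφ.2.sub hψ.2⟩

lemma fderiv_eq_sum (ψ : Eu d → ℝ) (x v : Eu d) :
    fderiv ℝ ψ x v = ∑ i, fderiv ℝ ψ x (EuclideanSpace.single i 1) * v i := by
  conv_lhs => rw [toLp_eq_sum_single v, map_sum]
  refine Finset.sum_congr rfl fun i _ => ?_
  rw [map_smul, smul_eq_mul, mul_comm]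

/-- The equation of the fluid for test fields `ψ v` with a constant direction `v`. -/
lemma eigen_direction (hz : IsEigen G m c ρF univ (ω ^ 2) z) {ψ : Eu d → ℝ} (hψ : IsTest ψ)
    (hs : tsupport ψ ⊆ G.Ωf) (v : Eu d) :
    (∫ x in G.Ωf, c ^ 2 * ρF * z.τ.div x * fderiv ℝ ψ x v)
      = ω ^ 2 * ∫ x in G.Ωf, ρF * (⟪v, z.τ.fn x⟫_ℝ * ψ x) := by
  have h := eigen_testField hz (τ := fun i x => ψ x * v i) (fun i => hψ.mul_const _)
    (fun i => (tsupport_mul_subset_left).trans hs)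
  have h1 : ∀ x, ∑ i, fderiv ℝ (fun x => ψ x * v i) x (EuclideanSpace.single i 1)
      = fderiv ℝ ψ x v := fun x => by
    rw [fderiv_eq_sum ψ x v]
    refine Finset.sum_congr rfl fun i _ => ?_
    rw [fderiv_mul_const (hψ.1.differentiable (by simp) x)]
    simp [mul_comm]
  have h2 : ∀ x, ∑ i, z.τ.fn x i * (ψ x * v i) = ⟪v, z.τ.fn x⟫_ℝ * ψ x := fun x => by
    rw [PiLp.inner_apply, Finset.sum_mul]
    refine Finset.sum_congr rfl fun i _ => ?_
    simp; ring
  simp only [h1, h2] at h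
  exact h

lemma fderiv_fderiv_comm {ψ : Eu d → ℝ} (hψ : IsTest ψ) (x u v : Eu d) :
    fderiv ℝ (fun x => fderiv ℝ ψ x u) x v = fderiv ℝ (fun x => fderiv ℝ ψ x v) x u := by
  have hsymm : IsSymmSndFDerivAt ℝ ψ x :=
    (hψ.1.contDiffAt).isSymmSndFDerivAt (by
      rw [minSmoothness_of_isRCLikeNormedField]
      exact WithTop.coe_le_coe.2 (le_top : (2 : ℕ∞) ≤ ⊤))
  have hd : DifferentiableAt ℝ (fderiv ℝ ψ) x :=
    ((hψ.1.fderiv_right (m := ((⊤ : ℕ∞) : WithTop ℕ∞)) (by simp)).differentiable (by simp)) x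
  rw [fderiv_clm_apply hd (differentiableAt_const _), fderiv_clm_apply hd (differentiableAt_const _)]
  simpa using hsymm v u

/-- The equation of the fluid for the divergence-free test fields `∂ᵢψ eⱼ - ∂ⱼψ eᵢ`. -/
lemma eigen_rot (hρ : ρF ≠ 0) (hω : ω ≠ 0) (hz : IsEigen G m c ρF univ (ω ^ 2) z)
    {ψ : Eu d → ℝ} (hψ : IsTest ψ) (hs : tsupport ψ ⊆ G.Ωf) (i j : Fin d) :
    (∫ x in G.Ωf, (z.τ.fn x j * fderiv ℝ ψ x (EuclideanSpace.single i 1)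
      - z.τ.fn x i * fderiv ℝ ψ x (EuclideanSpace.single j 1))) = 0 := by
  let δ : Fin d → Fin d → ℝ := fun a b => if a = b then 1 else 0
  let e : Fin d → Eu d := fun i => EuclideanSpace.single i 1
  have hD : ∀ v, tsupport (fun x => fderiv ℝ ψ x v) ⊆ G.Ωf := fun v =>
    (tsupport_fderiv_apply_subset ℝ v).trans hs
  have h := eigen_testField hz
    (τ := fun l x => fderiv ℝ ψ x (e i) * δ l j - fderiv ℝ ψ x (e j) * δ l i)
    (fun l => ((hψ.fderiv_apply _).mul_const _).sub ((hψ.fderiv_apply _).mul_const _))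
    (fun l => (tsupport_sub _ _).trans
      (union_subset ((tsupport_mul_subset_left).trans (hD _))
        ((tsupport_mul_subset_left).trans (hD _))))
  have h1 : ∀ x, ∑ l, fderiv ℝ (fun x => fderiv ℝ ψ x (e i) * δ l j
      - fderiv ℝ ψ x (e j) * δ l i) x (EuclideanSpace.single l 1) = 0 := fun x => by
    have hdf : ∀ v, DifferentiableAt ℝ (fun x => fderiv ℝ ψ x v) x := fun v =>
      (hψ.fderiv_apply v).1.differentiable (by simp) x
    have h2 : ∀ l, fderiv ℝ (fun x => fderiv ℝ ψ x (e i) * δ l j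
        - fderiv ℝ ψ x (e j) * δ l i) x (EuclideanSpace.single l 1)
        = fderiv ℝ (fun x => fderiv ℝ ψ x (e i)) x (e l) * δ l j
          - fderiv ℝ (fun x => fderiv ℝ ψ x (e j)) x (e l) * δ l i := fun l => by
      rw [fderiv_fun_sub ((hdf _).mul_const _) ((hdf _).mul_const _),
        fderiv_mul_const (hdf _), fderiv_mul_const (hdf _)]
      simp [e, mul_comm]
    simp_rw [h2]
    rw [Finset.sum_sub_distrib]
    simp [δ, fderiv_fderiv_comm hψ x (e i) (e j)]
  have h3 : ∀ x, ∑ l, z.τ.fn x l * (fderiv ℝ ψ x (e i) * δ l j - fderiv ℝ ψ x (e j) * δ l i)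
      = z.τ.fn x j * fderiv ℝ ψ x (e i) - z.τ.fn x i * fderiv ℝ ψ x (e j) := fun x => by
    simp_rw [mul_sub]
    rw [Finset.sum_sub_distrib]
    simp [δ]
  simp only [h1, h3, mul_zero, integral_zero, integral_const_mul] at h
  have h4 := (mul_eq_zero.1 h.symm).resolve_left (pow_ne_zero 2 hω)
  exact (mul_eq_zero.1 h4).resolve_left hρ

end TestField

/-! ### Elementary inequalities -/

lemma abs_integral_mul_le {X : Type*} [MeasurableSpace X] {μ : Measure X} {f g : X → ℝ}
    (hf : MemLp f 2 μ) (hg : MemLp g 2 μ) :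
    |∫ x, f x * g x ∂μ| ≤ √(∫ x, f x ^ 2 ∂μ) * √(∫ x, g x ^ 2 ∂μ) := by
  have hn : ∀ {f : X → ℝ} (hf : MemLp f 2 μ), ‖hf.toLp f‖ = √(∫ x, f x ^ 2 ∂μ) := fun hf => by
    rw [← Real.sqrt_sq (norm_nonneg _), norm_toLp_sq]
    simp
  have h := abs_real_inner_le_norm (hg.toLp g) (hf.toLp f)
  rw [L2.inner_def, hn hf, hn hg] at h
  have e : ∫ x, ⟪(hg.toLp g) x, (hf.toLp f) x⟫_ℝ ∂μ = ∫ x, f x * g x ∂μ := by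
    refine integral_congr_ae ?_
    filter_upwards [hf.coeFn_toLp, hg.coeFn_toLp] with x h1 h2
    rw [h1, h2]
    simp
  rw [e] at h
  linarith

lemma IsTest.memLp {d : ℕ} {ψ : Eu d → ℝ} (hψ : IsTest ψ) : MemLp ψ 2 volume :=
  hψ.1.continuous.memLp_of_hasCompactSupport hψ.2

lemma IsTest.integrable_sq {d : ℕ} {ψ : Eu d → ℝ} (hψ : IsTest ψ) : Integrable fun x => ψ x ^ 2 :=
  (memLp_two_iff_integrable_sq hψ.1.continuous.aestronglyMeasurable).1 hψ.memLp

lemma abs_setIntegral_mul_test_le {d : ℕ} {f φ : Eu d → ℝ} {S : Set (Eu d)}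
    (hf : MemLp f 2 (volume.restrict S)) (hφ : IsTest φ) :
    |∫ x in S, f x * φ x| ≤ √(∫ x in S, f x ^ 2) * √(∫ x, φ x ^ 2) := by
  refine (abs_integral_mul_le hf (hφ.memLp.restrict S)).trans ?_
  refine mul_le_mul_of_nonneg_left (Real.sqrt_le_sqrt ?_) (Real.sqrt_nonneg _)
  exact setIntegral_le_integral hφ.integrable_sq (Filter.Eventually.of_forall fun x => sq_nonneg _)

lemma integral_fderiv_apply_sq_le {d : ℕ} {ψ : Eu d → ℝ} (hψ : IsTest ψ) {v : Eu d}
    (hv : ‖v‖ = 1) : ∫ x, (fderiv ℝ ψ x v) ^ 2 ≤ ∫ x, ‖fderiv ℝ ψ x‖ ^ 2 := by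
  refine integral_mono (hψ.fderiv_apply v).integrable_sq (integrable_norm_fderiv_sq hψ) fun x => ?_
  have h := (fderiv ℝ ψ x).le_opNorm v
  rw [hv, mul_one, Real.norm_eq_abs] at h
  calc (fderiv ℝ ψ x v) ^ 2 = |fderiv ℝ ψ x v| ^ 2 := (sq_abs _).symm
    _ ≤ _ := by gcongr

lemma pderiv_test_sq_le {d : ℕ} {ψ : Eu d → ℝ} (hψ : IsTest ψ) (i : Fin d) :
    ∫ x, (fderiv ℝ ψ x (EuclideanSpace.single i 1)) ^ 2 ≤ ∫ x, ‖fderiv ℝ ψ x‖ ^ 2 :=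
  integral_fderiv_apply_sq_le hψ (by simp)

/-- The absorption argument of the bubble function technique: `X` is the weighted residual, `G` and
`P` are the squared norms of the gradient and of the values of the test function. -/
lemma absorb {X G P F B M r : ℝ} (hr : 0 < r) (hF : 0 ≤ F) (hB : 0 ≤ B)
    (hM : 0 ≤ M) (hX : X ≤ √F * √G + √B * √P) (hG : r ^ 2 * G ≤ M * X) (hP : P ≤ M * X) :
    r ^ 2 * X ≤ 2 * M * (F + r ^ 2 * B) := by
  rcases le_or_gt X 0 with h0 | h0
  · have : r ^ 2 * X ≤ 0 := mul_nonpos_of_nonneg_of_nonpos (by positivity) h0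
    exact this.trans (by positivity)
  have hMX : 0 ≤ M * X := by positivity
  have hG' : r * √G ≤ √(M * X) := by
    rw [← Real.sqrt_sq hr.le, ← Real.sqrt_mul (by positivity)]
    exact Real.sqrt_le_sqrt hG
  have hP' : √P ≤ √(M * X) := Real.sqrt_le_sqrt hP
  have h1 : r * X ≤ √(M * X) * (√F + r * √B) := by
    calc r * X ≤ r * (√F * √G + √B * √P) := by gcongr
      _ = √F * (r * √G) + r * √B * √P := by ring
      _ ≤ √F * √(M * X) + r * √B * √(M * X) := by gcongr
      _ = _ := by ring
  have h2 : (r * X) ^ 2 ≤ M * X * (2 * (F + r ^ 2 * B)) := by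
    calc (r * X) ^ 2 ≤ (√(M * X) * (√F + r * √B)) ^ 2 := by gcongr
      _ = M * X * (√F + r * √B) ^ 2 := by rw [mul_pow, Real.sq_sqrt hMX]
      _ ≤ _ := by
        gcongr
        have e1 := Real.sq_sqrt hF
        have e2 := Real.sq_sqrt hB
        nlinarith [sq_nonneg (√F - r * √B)]
  nlinarith

lemma mul_add_le_add_one_mul {s a b : ℝ} (hs : 0 ≤ s) (ha : 0 ≤ a) (hb : 0 ≤ b) :
    s * a + b ≤ (s + 1) * (a + b) := by nlinarith [mul_nonneg hs hb]

lemma sqrt_add_three_le {a b c : ℝ} (ha : 0 ≤ a) (hb : 0 ≤ b) (hc : 0 ≤ c) :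
    √a + √b + √c ≤ √(3 * (a + b + c)) := by
  refine Real.le_sqrt_of_sq_le ?_
  have e1 := Real.sq_sqrt ha
  have e2 := Real.sq_sqrt hb
  have e3 := Real.sq_sqrt hc
  nlinarith [sq_nonneg (√a - √b), sq_nonneg (√b - √c), sq_nonneg (√a - √c)]

/-! ### The error equations -/

lemma hull_subset_closure {d : ℕ} {K : Geometry.SimplicialComplex ℝ (Eu d)} {Ω : Set (Eu d)}
    (hK : IsMesh K Ω) {T : Finset (Eu d)} (hT : IsCell K T) : hull T ⊆ closure Ω := by
  rw [← hK.2]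
  exact K.convexHull_subset_space hT.1

/-- The standing assumptions: an eigenpair of the continuous problem, and an element of the space
`H` that is piecewise polynomial in the fluid, together with the coefficients of the problem and a
shape regular mesh of the fluid. -/
structure FluidData {d : ℕ} (G : Config d) (c ρF σ ω ωh : ℝ) (k : ℕ)
    (K : Geometry.SimplicialComplex ℝ (Eu d)) (z zh : HSpace G)
    (P : Finset (Eu d) → PolyField d) : Prop where
  ρF_pos : 0 < ρF
  σ_pos : 0 < σ
  ω_pos : 0 < ω
  mesh : IsMesh K G.Ωf
  regular : IsShapeRegular σ K
  eigen : ∃ m : Material d, IsEigen G m c ρF univ (ω ^ 2) z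
  poly : IsPiecewisePoly K k zh.τ.fn P

/-- The error `div (w - w_h)` of the divergence. -/
def divErr {d : ℕ} {G : Config d} (z zh : HSpace G) (x : Eu d) : ℝ := z.τ.div x - zh.τ.div x

/-- The error `ω_h² ρF w_h - ω² ρF w` of the acceleration. -/
def accErr {d : ℕ} {G : Config d} (ρF ω ωh : ℝ) (z zh : HSpace G) (x : Eu d) : Eu d :=
  (ωh ^ 2 * ρF) • zh.τ.fn x - (ω ^ 2 * ρF) • z.τ.fn x

lemma memLp_divErr {d : ℕ} {G : Config d} (z zh : HSpace G) :
    MemLp (divErr z zh) 2 (volume.restrict G.Ωf) := z.τ.memLp_div.sub zh.τ.memLp_div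

lemma memLp_accErr {d : ℕ} {G : Config d} (ρF ω ωh : ℝ) (z zh : HSpace G) :
    MemLp (accErr ρF ω ωh z zh) 2 (volume.restrict G.Ωf) :=
  MemLp.sub (MemLp.const_smul zh.τ.memLp_fn (ωh ^ 2 * ρF))
    (MemLp.const_smul z.τ.memLp_fn (ω ^ 2 * ρF))

lemma integrable_mul_test_of_memLp {d : ℕ} {f φ : Eu d → ℝ} {S : Set (Eu d)}
    (hf : MemLp f 2 (volume.restrict S)) (hφ : IsTest φ) :
    Integrable (fun x => f x * φ x) (volume.restrict S) :=
  hf.integrable_mul (hφ.memLp.restrict S)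

lemma memLp_coord {d : ℕ} {f : Eu d → Eu d} {μ : Measure (Eu d)} (hf : MemLp f 2 μ) (i : Fin d) :
    MemLp (fun x => f x i) 2 μ :=
  (EuclideanSpace.proj i : Eu d →L[ℝ] ℝ).comp_memLp' hf

/-- An integral over a domain of a function that vanishes off a set on which it is given by one of
two expressions, on either side of a dividing surface. -/
lemma setIntegral_eq_add_compl {d : ℕ} {f φ g g' ψ : Eu d → ℝ} {Ω W : Set (Eu d)}
    (hW : MeasurableSet W) (hs : tsupport ψ ⊆ Ω) (hφ0 : ∀ x, x ∉ tsupport ψ → φ x = 0)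
    (hint : Integrable (fun x => f x * φ x) (volume.restrict Ω))
    (hg : ∀ᵐ x, x ∈ tsupport ψ → x ∈ W → f x = g x)
    (hg' : ∀ᵐ x, x ∈ tsupport ψ → x ∉ W → f x = g' x) :
    ∫ x in Ω, f x * φ x = (∫ x in W, g x * φ x) + ∫ x in Wᶜ, g' x * φ x := by
  have h0 : ∀ x, x ∉ tsupport ψ → f x * φ x = 0 := fun x hx => by rw [hφ0 x hx, mul_zero]
  have hfull : Integrable fun x => f x * φ x := by
    refine (integrableOn_iff_integrable_of_support_subset (s := Ω) fun x hx => hs ?_).1 hint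
    by_contra h
    exact hx (h0 x h)
  rw [setIntegral_eq_of_tsupport_subset hs h0, ← integral_add_compl hW hfull]
  congr 1
  · refine setIntegral_congr_ae hW ?_
    filter_upwards [hg] with x hx hxW
    by_cases h : x ∈ tsupport ψ
    · rw [hx h hxW]
    · rw [hφ0 x h, mul_zero, mul_zero]
  · refine setIntegral_congr_ae hW.compl ?_
    filter_upwards [hg'] with x hx hxW
    by_cases h : x ∈ tsupport ψ
    · rw [hx h hxW]
    · rw [hφ0 x h, mul_zero, mul_zero]

namespace FluidData

variable {d : ℕ} {G : Config d} {c ρF σ ω ωh : ℝ} {k : ℕ}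
  {K : Geometry.SimplicialComplex ℝ (Eu d)} {z zh : HSpace G} {P : Finset (Eu d) → PolyField d}

lemma subset_domain {S : Set (Eu d)}
    (ho : IsOpen S) (hS : S ⊆ closure G.Ωf) : S ⊆ G.Ωf := by
  rw [← interior_closure_eq G.fluid_domain.isOpen G.fluid_domain.lipschitz]
  exact interior_maximal hS ho

lemma interior_hull_subset (h : FluidData G c ρF σ ω ωh k K z zh P) {T : Finset (Eu d)}
    (hT : IsCell K T) : interior (hull T) ⊆ G.Ωf :=
  subset_domain isOpen_interior (interior_subset.trans (hull_subset_closure h.mesh hT))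

lemma ae_mem_interior (T : Finset (Eu d)) : ∀ᵐ x, x ∈ hull T → x ∈ interior (hull T) := by
  have h0 : volume (frontier (hull T)) = 0 := (convex_convexHull ℝ _).addHaar_frontier volume
  filter_upwards [measure_eq_zero_iff_ae_notMem.1 h0] with x hx hxT
  by_contra hi
  exact hx ⟨subset_closure hxT, hi⟩

lemma hull_ae_le (h : FluidData G c ρF σ ω ωh k K z zh P) {T : Finset (Eu d)}
    (hT : IsCell K T) : ∀ᵐ x, x ∈ hull T → x ∈ G.Ωf := by
  filter_upwards [ae_mem_interior T] with x hx hxT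
  exact h.interior_hull_subset hT (hx hxT)

lemma memLp_of_ae_le {F : Type*} [NormedAddCommGroup F] {f : Eu d → F} {S : Set (Eu d)}
    (hf : MemLp f 2 (volume.restrict G.Ωf)) (hS : ∀ᵐ x, x ∈ S → x ∈ G.Ωf) :
    MemLp f 2 (volume.restrict S) :=
  hf.mono_measure (Measure.restrict_mono' hS le_rfl)

/-- On an element the weak divergence of `w_h` is the divergence of the polynomial field. -/
lemma div_ae_eq (h : FluidData G c ρF σ ω ωh k K z zh P) {T : Finset (Eu d)} (hT : IsCell K T) :
    ∀ᵐ x, x ∈ interior (hull T) → zh.τ.div x = pval (P T).div x := by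
  let U := interior (hull T)
  have hU : U ⊆ G.Ωf := h.interior_hull_subset hT
  have hdiv : MemLp zh.τ.div 2 (volume.restrict U) :=
    memLp_of_ae_le zh.τ.memLp_div (Filter.Eventually.of_forall fun x hx => hU hx)
  have hUc : volume U ≠ ⊤ :=
    ((measure_mono interior_subset).trans_lt (isCompact_hull T).measure_lt_top).ne
  have hfin : IsFiniteMeasure (volume.restrict U) := ⟨by
    simpa using hUc.lt_top⟩
  have hloc : LocallyIntegrableOn (fun x => zh.τ.div x - pval (P T).div x) U volume :=
    LocallyIntegrableOn.sub (IntegrableOn.locallyIntegrableOn (hdiv.integrable (by norm_num)))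
      ((continuous_pval _).locallyIntegrable.locallyIntegrableOn _)
  have key := isOpen_interior.ae_eq_zero_of_integral_contDiff_smul_eq_zero hloc fun g hg hgc hgs => by
    have hgt : IsTest g := ⟨hg, hgc⟩
    have h1 := zh.τ.weak_div g hgt (hgs.trans hU)
    have h2 : ∫ x in G.Ωf, fderiv ℝ g x (zh.τ.fn x) = ∫ x, fderiv ℝ g x ((P T).val x) := by
      rw [setIntegral_eq_of_tsupport_subset (hgs.trans hU) fun x hx => by
        rw [fderiv_eq_zero_of_notMem_tsupport hx]; simp]
      refine integral_congr_ae (Filter.Eventually.of_forall fun x => ?_)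
      by_cases hx : x ∈ tsupport g
      · simp only [(h.poly T hT).2 x (hgs hx)]
      · simp only [fderiv_eq_zero_of_notMem_tsupport hx, zero_apply]
    have h3 : ∫ x, fderiv ℝ g x ((P T).val x) = -∫ x, pval (P T).div x * g x := by
      have e1 : ∀ x, fderiv ℝ g x ((P T).val x)
          = ∑ i, pval (P T i) x * fderiv ℝ g x (EuclideanSpace.single i 1) := fun x => by
        rw [fderiv_eq_sum]
        exact Finset.sum_congr rfl fun i _ => mul_comm _ _
      have e2 : ∀ x, pval (P T).div x * g x
          = ∑ i, pval (MvPolynomial.pderiv i (P T i)) x * g x := fun x => by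
        rw [PolyField.div, pval_sum, Finset.sum_mul]
      simp_rw [e1, e2]
      rw [integral_finsetSum _ fun i _ => integrable_mul_test (continuous_pval _)
          (hgt.fderiv_apply _),
        integral_finsetSum _ fun i _ => integrable_mul_test (continuous_pval _) hgt,
        ← Finset.sum_neg_distrib]
      refine Finset.sum_congr rfl fun i _ => ?_
      rw [integral_mul_fderiv_test (contDiff_pval _) hgt]
      simp_rw [fderiv_pval_single]
    have h4 : ∫ x in G.Ωf, zh.τ.div x * g x = ∫ x, zh.τ.div x * g x :=
      setIntegral_eq_of_tsupport_subset (hgs.trans hU) fun x hx => by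
        rw [image_eq_zero_of_notMem_tsupport hx, mul_zero]
    have h5 : Integrable fun x => zh.τ.div x * g x := by
      refine (integrableOn_iff_integrable_of_support_subset (s := U) fun x hx => hgs ?_).1
        (integrable_mul_test_of_memLp hdiv hgt)
      exact subset_tsupport _ (right_ne_zero_of_mul hx)
    have h6 : ∫ x, g x • (zh.τ.div x - pval (P T).div x)
        = (∫ x, zh.τ.div x * g x) - ∫ x, pval (P T).div x * g x := by
      rw [← integral_sub h5 (integrable_mul_test (continuous_pval _) hgt)]
      refine integral_congr_ae (Filter.Eventually.of_forall fun x => ?_)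
      simp only [smul_eq_mul]; ring
    rw [h6]
    linarith
  filter_upwards [key] with x hx hxU
  have := hx hxU
  linarith

variable {ψ : Eu d → ℝ}

/-- The error equation for test fields with a constant direction. -/
lemma error_direction (h : FluidData G c ρF σ ω ωh k K z zh P) (hψ : IsTest ψ)
    (hs : tsupport ψ ⊆ G.Ωf) (v : Eu d) :
    c ^ 2 * ρF * (∫ x in G.Ωf, divErr z zh x * fderiv ℝ ψ x v)
        + ∫ x in G.Ωf, ⟪v, accErr ρF ω ωh z zh x⟫_ℝ * ψ x
      = ωh ^ 2 * ρF * (∫ x in G.Ωf, ⟪v, zh.τ.fn x⟫_ℝ * ψ x)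
        - c ^ 2 * ρF * ∫ x in G.Ωf, zh.τ.div x * fderiv ℝ ψ x v := by
  obtain ⟨m, hm⟩ := h.eigen
  have h1 := eigen_direction hm hψ hs v
  have e1 : ∫ x in G.Ωf, divErr z zh x * fderiv ℝ ψ x v
      = (∫ x in G.Ωf, z.τ.div x * fderiv ℝ ψ x v)
        - ∫ x in G.Ωf, zh.τ.div x * fderiv ℝ ψ x v := by
    rw [← integral_sub (integrable_mul_test_of_memLp z.τ.memLp_div (hψ.fderiv_apply v))
      (integrable_mul_test_of_memLp zh.τ.memLp_div (hψ.fderiv_apply v))]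
    simp_rw [divErr, sub_mul]
  have e2 : ∫ x in G.Ωf, ⟪v, accErr ρF ω ωh z zh x⟫_ℝ * ψ x
      = ωh ^ 2 * ρF * (∫ x in G.Ωf, ⟪v, zh.τ.fn x⟫_ℝ * ψ x)
        - ω ^ 2 * ρF * ∫ x in G.Ωf, ⟪v, z.τ.fn x⟫_ℝ * ψ x := by
    rw [← integral_const_mul, ← integral_const_mul,
      ← integral_sub ((integrable_mul_test_of_memLp (zh.τ.memLp_fn.const_inner v) hψ).const_mul _)
      ((integrable_mul_test_of_memLp (z.τ.memLp_fn.const_inner v) hψ).const_mul _)]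
    simp_rw [accErr, inner_sub_right, inner_smul_right, sub_mul, mul_assoc]
  rw [integral_const_mul] at h1
  simp_rw [mul_assoc (c ^ 2 * ρF)] at h1
  rw [integral_const_mul] at h1
  rw [e1, e2]
  linarith

/-- The error equation for divergence-free test fields. -/
lemma error_rot (h : FluidData G c ρF σ ω ωh k K z zh P) (hψ : IsTest ψ)
    (hs : tsupport ψ ⊆ G.Ωf) (i j : Fin d) :
    (∫ x in G.Ωf, accErr ρF ω ωh z zh x j * fderiv ℝ ψ x (EuclideanSpace.single i 1))
        - ∫ x in G.Ωf, accErr ρF ω ωh z zh x i * fderiv ℝ ψ x (EuclideanSpace.single j 1)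
      = ωh ^ 2 * ρF * ((∫ x in G.Ωf, zh.τ.fn x j * fderiv ℝ ψ x (EuclideanSpace.single i 1))
        - ∫ x in G.Ωf, zh.τ.fn x i * fderiv ℝ ψ x (EuclideanSpace.single j 1)) := by
  obtain ⟨m, hm⟩ := h.eigen
  have h1 := eigen_rot h.ρF_pos.ne' h.ω_pos.ne' hm hψ hs i j
  have e2 : ∀ a b : Fin d, ∫ x in G.Ωf, accErr ρF ω ωh z zh x a
        * fderiv ℝ ψ x (EuclideanSpace.single b 1)
      = ωh ^ 2 * ρF * (∫ x in G.Ωf, zh.τ.fn x a * fderiv ℝ ψ x (EuclideanSpace.single b 1))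
        - ω ^ 2 * ρF * ∫ x in G.Ωf, z.τ.fn x a * fderiv ℝ ψ x (EuclideanSpace.single b 1) := by
    intro a b
    rw [← integral_const_mul, ← integral_const_mul,
      ← integral_sub ((integrable_mul_test_of_memLp (memLp_coord zh.τ.memLp_fn a)
        (hψ.fderiv_apply _)).const_mul _)
      ((integrable_mul_test_of_memLp (memLp_coord z.τ.memLp_fn a)
        (hψ.fderiv_apply _)).const_mul _)]
    simp [accErr, sub_mul, mul_assoc]
  rw [integral_sub (integrable_mul_test_of_memLp (memLp_coord z.τ.memLp_fn j) (hψ.fderiv_apply _))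
    (integrable_mul_test_of_memLp (memLp_coord z.τ.memLp_fn i) (hψ.fderiv_apply _))] at h1
  rw [e2, e2, sub_eq_zero.1 h1]
  ring

end FluidData

/-! ### The residuals as polynomials -/

section Residual

variable {d : ℕ}

lemma fderiv_pval_eq_inner (p : MvPolynomial (Fin d) ℝ) (x v : Eu d) :
    fderiv ℝ (pval p) x v = ⟪v, pgrad p x⟫_ℝ := by
  rw [fderiv_eq_sum, PiLp.inner_apply]
  refine Finset.sum_congr rfl fun i _ => ?_
  rw [fderiv_pval_single]
  simp [pgrad]

/-- The components of the residual `R₁` as polynomials. -/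
def resid1Poly (c ρF ωh : ℝ) (P : PolyField d) (i : Fin d) : MvPolynomial (Fin d) ℝ :=
  MvPolynomial.C (c ^ 2 * ρF) * MvPolynomial.pderiv i P.div + MvPolynomial.C (ωh ^ 2 * ρF) * P i

lemma pval_resid1Poly (c ρF ωh : ℝ) (P : PolyField d) (i : Fin d) (x : Eu d) :
    pval (resid1Poly c ρF ωh P i) x = resid1 c ρF ωh P x i := by
  rw [resid1Poly, pval_add, pval_mul, pval_mul, pval_C, pval_C]
  rfl

lemma totalDegree_C_mul_le (a : ℝ) (p : MvPolynomial (Fin d) ℝ) :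
    (MvPolynomial.C a * p).totalDegree ≤ p.totalDegree :=
  (MvPolynomial.totalDegree_mul _ _).trans (by simp)

lemma totalDegree_add_le_of_le {p q : MvPolynomial (Fin d) ℝ} {k : ℕ} (hp : p.totalDegree ≤ k)
    (hq : q.totalDegree ≤ k) : (p + q).totalDegree ≤ k :=
  (MvPolynomial.totalDegree_add _ _).trans (max_le hp hq)

lemma totalDegree_sub_le_of_le {p q : MvPolynomial (Fin d) ℝ} {k : ℕ} (hp : p.totalDegree ≤ k)
    (hq : q.totalDegree ≤ k) : (p - q).totalDegree ≤ k :=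
  (MvPolynomial.totalDegree_sub _ _).trans (max_le hp hq)

lemma totalDegree_div_le {P : PolyField d} {k : ℕ} (hP : ∀ i, (P i).totalDegree ≤ k) :
    P.div.totalDegree ≤ k :=
  MvPolynomial.totalDegree_finsetSum_le fun i _ => (totalDegree_pderiv_le i _).trans (hP i)

lemma totalDegree_resid1Poly_le (c ρF ωh : ℝ) {P : PolyField d} {k : ℕ}
    (hP : ∀ i, (P i).totalDegree ≤ k) (i : Fin d) : (resid1Poly c ρF ωh P i).totalDegree ≤ k :=
  totalDegree_add_le_of_le
    ((totalDegree_C_mul_le _ _).trans ((totalDegree_pderiv_le i _).trans (totalDegree_div_le hP)))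
    ((totalDegree_C_mul_le _ _).trans (hP i))

/-- The components of the residual `R₂` as polynomials. -/
def resid2Poly (ρF ωh : ℝ) (P : PolyField d) (i j : Fin d) : MvPolynomial (Fin d) ℝ :=
  MvPolynomial.C (ωh ^ 2 * ρF) * (MvPolynomial.pderiv i (P j) - MvPolynomial.pderiv j (P i))

lemma pval_resid2Poly (ρF ωh : ℝ) (P : PolyField d) (p : Pairs d) (x : Eu d) :
    pval (resid2Poly ρF ωh P p.1.1 p.1.2) x = resid2 ρF ωh P x p := by
  rw [resid2Poly, pval_mul, pval_C, pval_sub]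
  rfl

lemma totalDegree_resid2Poly_le (ρF ωh : ℝ) {P : PolyField d} {k : ℕ}
    (hP : ∀ i, (P i).totalDegree ≤ k) (i j : Fin d) : (resid2Poly ρF ωh P i j).totalDegree ≤ k :=
  (totalDegree_C_mul_le _ _).trans (totalDegree_sub_le_of_le
    ((totalDegree_pderiv_le i _).trans (hP j)) ((totalDegree_pderiv_le j _).trans (hP i)))

lemma continuous_val (P : PolyField d) : Continuous P.val :=
  (PiLp.continuous_toLp 2 _).comp (continuous_pi fun i => continuous_pval (P i))

lemma continuous_pgrad (p : MvPolynomial (Fin d) ℝ) : Continuous (pgrad p) :=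
  (PiLp.continuous_toLp 2 _).comp (continuous_pi fun _ => continuous_pval _)

lemma continuous_resid1 (c ρF ωh : ℝ) (P : PolyField d) : Continuous (resid1 c ρF ωh P) :=
  ((continuous_pgrad P.div).const_smul (c ^ 2 * ρF)).add ((continuous_val P).const_smul (ωh ^ 2 * ρF))

lemma inner_resid1 (c ρF ωh : ℝ) (P : PolyField d) (x v : Eu d) :
    ⟪v, resid1 c ρF ωh P x⟫_ℝ
      = c ^ 2 * ρF * fderiv ℝ (pval P.div) x v + ωh ^ 2 * ρF * ⟪v, P.val x⟫_ℝ := by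
  rw [resid1, inner_add_right, inner_smul_right, inner_smul_right, fderiv_pval_eq_inner]

end Residual

namespace FluidData

variable {d : ℕ} {G : Config d} {c ρF σ ω ωh : ℝ} {k : ℕ}
  {K : Geometry.SimplicialComplex ℝ (Eu d)} {z zh : HSpace G} {P : Finset (Eu d) → PolyField d}
  {ψ : Eu d → ℝ} {T T' : Finset (Eu d)} {W : Set (Eu d)}

/-! ### Local form of the error equations -/

/-- The error equation for test fields with a constant direction, on two elements `T` and `T'` on
either side of a dividing surface; `T = T'` is allowed. -/
lemma error_direction_piecewise (h : FluidData G c ρF σ ω ωh k K z zh P) (hT : IsCell K T)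
    (hT' : IsCell K T') (hψ : IsTest ψ) (hs : tsupport ψ ⊆ G.Ωf) (hW : MeasurableSet W)
    (hi : ∀ᵐ x, x ∈ tsupport ψ → x ∈ W → x ∈ interior (hull T))
    (hi' : ∀ᵐ x, x ∈ tsupport ψ → x ∉ W → x ∈ interior (hull T')) (v : Eu d) :
    c ^ 2 * ρF * (∫ x in G.Ωf, divErr z zh x * fderiv ℝ ψ x v)
        + ∫ x in G.Ωf, ⟪v, accErr ρF ω ωh z zh x⟫_ℝ * ψ x
      = (ωh ^ 2 * ρF * (∫ x in W, ⟪v, (P T).val x⟫_ℝ * ψ x)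
          - c ^ 2 * ρF * ∫ x in W, pval (P T).div x * fderiv ℝ ψ x v)
        + (ωh ^ 2 * ρF * (∫ x in Wᶜ, ⟪v, (P T').val x⟫_ℝ * ψ x)
          - c ^ 2 * ρF * ∫ x in Wᶜ, pval (P T').div x * fderiv ℝ ψ x v) := by
  rw [h.error_direction hψ hs v,
    setIntegral_eq_add_compl (f := fun x => ⟪v, zh.τ.fn x⟫_ℝ) (φ := ψ)
      (g := fun x => ⟪v, (P T).val x⟫_ℝ) (g' := fun x => ⟪v, (P T').val x⟫_ℝ) hW hs
      (fun x hx => image_eq_zero_of_notMem_tsupport hx)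
      (integrable_mul_test_of_memLp (zh.τ.memLp_fn.const_inner v) hψ)
      (by filter_upwards [hi] with x hx h1 h2; rw [(h.poly T hT).2 x (hx h1 h2)])
      (by filter_upwards [hi'] with x hx h1 h2; rw [(h.poly T' hT').2 x (hx h1 h2)]),
    setIntegral_eq_add_compl (f := zh.τ.div) (φ := fun x => fderiv ℝ ψ x v)
      (g := pval (P T).div) (g' := pval (P T').div) hW hs
      (fun x hx => by rw [fderiv_eq_zero_of_notMem_tsupport hx]; simp)
      (integrable_mul_test_of_memLp zh.τ.memLp_div (hψ.fderiv_apply v))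
      (by filter_upwards [hi, h.div_ae_eq hT] with x hx hd h1 h2; rw [hd (hx h1 h2)])
      (by filter_upwards [hi', h.div_ae_eq hT'] with x hx hd h1 h2; rw [hd (hx h1 h2)])]
  ring

lemma error_rot_piecewise (h : FluidData G c ρF σ ω ωh k K z zh P) (hT : IsCell K T)
    (hT' : IsCell K T') (hψ : IsTest ψ) (hs : tsupport ψ ⊆ G.Ωf) (hW : MeasurableSet W)
    (hi : ∀ᵐ x, x ∈ tsupport ψ → x ∈ W → x ∈ interior (hull T))
    (hi' : ∀ᵐ x, x ∈ tsupport ψ → x ∉ W → x ∈ interior (hull T')) (i j : Fin d) :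
    (∫ x in G.Ωf, accErr ρF ω ωh z zh x j * fderiv ℝ ψ x (EuclideanSpace.single i 1))
        - ∫ x in G.Ωf, accErr ρF ω ωh z zh x i * fderiv ℝ ψ x (EuclideanSpace.single j 1)
      = ωh ^ 2 * ρF * (((∫ x in W, pval (P T j) x * fderiv ℝ ψ x (EuclideanSpace.single i 1))
          + ∫ x in Wᶜ, pval (P T' j) x * fderiv ℝ ψ x (EuclideanSpace.single i 1))
        - ((∫ x in W, pval (P T i) x * fderiv ℝ ψ x (EuclideanSpace.single j 1))
          + ∫ x in Wᶜ, pval (P T' i) x * fderiv ℝ ψ x (EuclideanSpace.single j 1))) := by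
  have key : ∀ a b : Fin d, ∫ x in G.Ωf, zh.τ.fn x a * fderiv ℝ ψ x (EuclideanSpace.single b 1)
      = (∫ x in W, pval (P T a) x * fderiv ℝ ψ x (EuclideanSpace.single b 1))
        + ∫ x in Wᶜ, pval (P T' a) x * fderiv ℝ ψ x (EuclideanSpace.single b 1) := fun a b =>
    setIntegral_eq_add_compl (f := fun x => zh.τ.fn x a)
      (φ := fun x => fderiv ℝ ψ x (EuclideanSpace.single b 1)) hW hs
      (fun x hx => by rw [fderiv_eq_zero_of_notMem_tsupport hx]; simp)
      (integrable_mul_test_of_memLp (memLp_coord zh.τ.memLp_fn a) (hψ.fderiv_apply _))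
      (by filter_upwards [hi] with x hx h1 h2; rw [(h.poly T hT).2 x (hx h1 h2)]; rfl)
      (by filter_upwards [hi'] with x hx h1 h2; rw [(h.poly T' hT').2 x (hx h1 h2)]; rfl)
  rw [h.error_rot hψ hs i j, key, key]

/-- The error equation on one element. -/
lemma error_direction_cell (h : FluidData G c ρF σ ω ωh k K z zh P) (hT : IsCell K T)
    (hψ : IsTest ψ) (hs : tsupport ψ ⊆ interior (hull T)) (v : Eu d) :
    c ^ 2 * ρF * (∫ x in G.Ωf, divErr z zh x * fderiv ℝ ψ x v)
        + ∫ x in G.Ωf, ⟪v, accErr ρF ω ωh z zh x⟫_ℝ * ψ x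
      = ∫ x, ⟪v, resid1 c ρF ωh (P T) x⟫_ℝ * ψ x := by
  rw [h.error_direction_piecewise hT hT hψ (hs.trans (h.interior_hull_subset hT)) MeasurableSet.univ
    (Filter.Eventually.of_forall fun x hx _ => hs hx)
    (Filter.Eventually.of_forall fun x hx _ => hs hx) v]
  simp only [compl_univ, Measure.restrict_univ, Measure.restrict_empty, integral_zero_measure,
    mul_zero, sub_zero, add_zero]
  rw [integral_mul_fderiv_test (contDiff_pval _) hψ]
  simp_rw [inner_resid1, add_mul, mul_assoc _ _ (ψ _)]
  rw [integral_add
    ((integrable_mul_test (((contDiff_pval _).continuous_fderiv one_ne_zero).clm_apply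
      continuous_const) hψ).const_mul _)
    ((integrable_mul_test (continuous_const.inner (continuous_val _)) hψ).const_mul _),
    integral_const_mul, integral_const_mul]
  ring

/-- The error equation for divergence-free test fields on one element. -/
lemma error_rot_cell (h : FluidData G c ρF σ ω ωh k K z zh P) (hT : IsCell K T)
    (hψ : IsTest ψ) (hs : tsupport ψ ⊆ interior (hull T)) (i j : Fin d) :
    (∫ x in G.Ωf, accErr ρF ω ωh z zh x i * fderiv ℝ ψ x (EuclideanSpace.single j 1))
        - ∫ x in G.Ωf, accErr ρF ω ωh z zh x j * fderiv ℝ ψ x (EuclideanSpace.single i 1)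
      = ∫ x, pval (resid2Poly ρF ωh (P T) i j) x * ψ x := by
  have h1 := h.error_rot_piecewise hT hT hψ (hs.trans (h.interior_hull_subset hT))
    MeasurableSet.univ (Filter.Eventually.of_forall fun x hx _ => hs hx)
    (Filter.Eventually.of_forall fun x hx _ => hs hx) i j
  simp only [compl_univ, Measure.restrict_univ, Measure.restrict_empty, integral_zero_measure,
    add_zero] at h1
  rw [integral_mul_fderiv_test (contDiff_pval _) hψ, integral_mul_fderiv_test (contDiff_pval _) hψ]
    at h1
  simp_rw [fderiv_pval_single] at h1
  have h2 : ∀ x, pval (resid2Poly ρF ωh (P T) i j) x * ψ x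
      = ωh ^ 2 * ρF * (pval (MvPolynomial.pderiv i (P T j)) x * ψ x
        - pval (MvPolynomial.pderiv j (P T i)) x * ψ x) := fun x => by
    rw [resid2Poly, pval_mul, pval_C, pval_sub]; ring
  simp_rw [h2]
  rw [integral_const_mul, integral_sub (integrable_mul_test (continuous_pval _) hψ)
    (integrable_mul_test (continuous_pval _) hψ)]
  linarith

/-! ### Bounds for the error terms -/

lemma abs_domain_integral_le {f φ : Eu d → ℝ} {S : Set (Eu d)}
    (hf : MemLp f 2 (volume.restrict G.Ωf)) (hφ : IsTest φ) (hS : ∀ᵐ x, x ∈ S → x ∈ G.Ωf)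
    (hs : tsupport ψ ⊆ S) (hs' : tsupport ψ ⊆ G.Ωf) (h0 : ∀ x, x ∉ tsupport ψ → φ x = 0) :
    |∫ x in G.Ωf, f x * φ x| ≤ √(∫ x in S, f x ^ 2) * √(∫ x, φ x ^ 2) := by
  have h1 : ∀ x, x ∉ tsupport ψ → f x * φ x = 0 := fun x hx => by rw [h0 x hx, mul_zero]
  rw [setIntegral_eq_of_tsupport_subset hs' h1, ← setIntegral_eq_of_tsupport_subset hs h1]
  exact abs_setIntegral_mul_test_le (memLp_of_ae_le hf hS) hφ

lemma setIntegral_inner_sq_le {f : Eu d → Eu d} {S : Set (Eu d)}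
    (hf : MemLp f 2 (volume.restrict S)) {v : Eu d} (hv : ‖v‖ = 1) :
    ∫ x in S, ⟪v, f x⟫_ℝ ^ 2 ≤ ∫ x in S, ‖f x‖ ^ 2 := by
  have h1 : Integrable (fun x => ⟪v, f x⟫_ℝ ^ 2) (volume.restrict S) :=
    (hf.const_inner v).integrable_sq
  have h2 : Integrable (fun x => ‖f x‖ ^ 2) (volume.restrict S) := hf.norm.integrable_sq
  refine integral_mono h1 h2 fun x => ?_
  have h := abs_real_inner_le_norm v (f x)
  rw [hv, one_mul] at h
  calc ⟪v, f x⟫_ℝ ^ 2 = |⟪v, f x⟫_ℝ| ^ 2 := (sq_abs _).symm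
    _ ≤ _ := by gcongr

lemma setIntegral_coord_sq_le {f : Eu d → Eu d} {S : Set (Eu d)}
    (hf : MemLp f 2 (volume.restrict S)) (i : Fin d) :
    ∫ x in S, f x i ^ 2 ≤ ∫ x in S, ‖f x‖ ^ 2 := by
  have := setIntegral_inner_sq_le hf (v := EuclideanSpace.single i 1) (by simp)
  simpa [EuclideanSpace.inner_single_left] using this

lemma abs_error_direction_le (h : FluidData G c ρF σ ω ωh k K z zh P) (hψ : IsTest ψ)
    {S : Set (Eu d)} (hS : ∀ᵐ x, x ∈ S → x ∈ G.Ωf) (hs : tsupport ψ ⊆ S)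
    (hs' : tsupport ψ ⊆ G.Ωf) {v : Eu d} (hv : ‖v‖ = 1) :
    |c ^ 2 * ρF * (∫ x in G.Ωf, divErr z zh x * fderiv ℝ ψ x v)
        + ∫ x in G.Ωf, ⟪v, accErr ρF ω ωh z zh x⟫_ℝ * ψ x|
      ≤ √((c ^ 2 * ρF) ^ 2 * ∫ x in S, divErr z zh x ^ 2) * √(∫ x, ‖fderiv ℝ ψ x‖ ^ 2)
        + √(∫ x in S, ‖accErr ρF ω ωh z zh x‖ ^ 2) * √(∫ x, ψ x ^ 2) := by
  have hc : 0 ≤ c ^ 2 * ρF := mul_nonneg (sq_nonneg _) h.ρF_pos.le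
  have h1 := abs_domain_integral_le (memLp_divErr z zh) (hψ.fderiv_apply v) hS hs hs' fun x hx => by
    rw [fderiv_eq_zero_of_notMem_tsupport hx]; simp
  have h2 := abs_domain_integral_le ((memLp_accErr ρF ω ωh z zh).const_inner v) hψ hS hs hs'
    fun x hx => image_eq_zero_of_notMem_tsupport hx
  have h3 := Real.sqrt_le_sqrt (integral_fderiv_apply_sq_le hψ hv)
  have h4 := Real.sqrt_le_sqrt
    (setIntegral_inner_sq_le (memLp_of_ae_le (memLp_accErr ρF ω ωh z zh) hS) hv)
  refine (abs_add_le _ _).trans (add_le_add ?_ ?_)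
  · rw [abs_mul, abs_of_nonneg hc, Real.sqrt_mul (sq_nonneg _), Real.sqrt_sq hc]
    rw [mul_assoc (c ^ 2 * ρF)]
    refine mul_le_mul_of_nonneg_left (h1.trans ?_) hc
    exact mul_le_mul_of_nonneg_left h3 (Real.sqrt_nonneg _)
  · exact h2.trans (mul_le_mul_of_nonneg_right h4 (Real.sqrt_nonneg _))

lemma abs_error_rot_le (ρF ω ωh : ℝ) (z zh : HSpace G) (hψ : IsTest ψ)
    {S : Set (Eu d)} (hS : ∀ᵐ x, x ∈ S → x ∈ G.Ωf) (hs : tsupport ψ ⊆ S)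
    (hs' : tsupport ψ ⊆ G.Ωf) (i j : Fin d) :
    |(∫ x in G.Ωf, accErr ρF ω ωh z zh x i * fderiv ℝ ψ x (EuclideanSpace.single j 1))
        - ∫ x in G.Ωf, accErr ρF ω ωh z zh x j * fderiv ℝ ψ x (EuclideanSpace.single i 1)|
      ≤ √(4 * ∫ x in S, ‖accErr ρF ω ωh z zh x‖ ^ 2) * √(∫ x, ‖fderiv ℝ ψ x‖ ^ 2) := by
  have key : ∀ a b : Fin d,
      |∫ x in G.Ωf, accErr ρF ω ωh z zh x a * fderiv ℝ ψ x (EuclideanSpace.single b 1)|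
        ≤ √(∫ x in S, ‖accErr ρF ω ωh z zh x‖ ^ 2) * √(∫ x, ‖fderiv ℝ ψ x‖ ^ 2) := fun a b => by
    refine (abs_domain_integral_le (memLp_coord (memLp_accErr ρF ω ωh z zh) a)
      (hψ.fderiv_apply (EuclideanSpace.single b 1)) hS hs hs' fun x hx => by
      rw [fderiv_eq_zero_of_notMem_tsupport hx]; simp).trans ?_
    have h3 := Real.sqrt_le_sqrt (pderiv_test_sq_le hψ b)
    have h4 := Real.sqrt_le_sqrt
      (setIntegral_coord_sq_le (memLp_of_ae_le (memLp_accErr ρF ω ωh z zh) hS) a)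
    exact mul_le_mul h4 h3 (Real.sqrt_nonneg _) (Real.sqrt_nonneg _)
  have h4 : √(4 : ℝ) = 2 := by
    rw [show (4 : ℝ) = 2 ^ 2 by norm_num, Real.sqrt_sq (by norm_num)]
  rw [Real.sqrt_mul (by norm_num), h4]
  refine (abs_sub _ _).trans ?_
  linarith [key i j, key j i]

/-! ### Residuals of the elements -/

/-- A shape regular element contains a ball of radius `h_T / σ`. -/
lemma exists_inscribed_ball (h : FluidData G c ρF σ ω ωh k K z zh P) (hT : IsCell K T) :
    ∃ x, Metric.closedBall x (size T / σ) ⊆ hull T ∧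
      hull T ⊆ Metric.closedBall x (σ * (size T / σ)) := by
  obtain ⟨x, r, hr, hball, hsz⟩ := h.regular T hT
  have hle : size T / σ ≤ r := by
    rw [div_le_iff₀ h.σ_pos]; linarith
  refine ⟨x, (Metric.closedBall_subset_closedBall hle).trans hball, fun y hy => ?_⟩
  rw [mul_div_cancel₀ _ h.σ_pos.ne', Metric.mem_closedBall]
  exact Metric.dist_le_diam_of_mem (isCompact_hull T).isBounded hy
    (hball (Metric.mem_closedBall_self hr.le))

lemma closedBall_half_subset_interior {x : Eu d} {r : ℝ} (hr : 0 < r) {S : Set (Eu d)}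
    (hS : Metric.closedBall x r ⊆ S) : Metric.closedBall x (r / 2) ⊆ interior S :=
  (Metric.closedBall_subset_ball (by linarith)).trans
    (interior_maximal (Metric.ball_subset_closedBall.trans hS) Metric.isOpen_ball)

/-- The bubble function technique on an element, for a polynomial residual `q` that acts on test
functions as an error with gradient part `F` and zero order part `B`. -/
lemma exists_cell_bound (d k : ℕ) {σ : ℝ} (hσ : 0 < σ) : ∃ C : ℝ, 0 < C ∧
    ∀ (q : MvPolynomial (Fin d) ℝ), q.totalDegree ≤ k → ∀ (x₀ : Eu d) (T : Finset (Eu d)) (F B : ℝ),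
      0 < size T → 0 ≤ F → 0 ≤ B → Metric.closedBall x₀ (size T / σ) ⊆ hull T →
      hull T ⊆ Metric.closedBall x₀ (σ * (size T / σ)) →
      (∀ ψ, IsTest ψ → tsupport ψ ⊆ interior (hull T) →
        (∫ x, pval q x * ψ x) ≤ √F * √(∫ x, ‖fderiv ℝ ψ x‖ ^ 2) + √B * √(∫ x, ψ x ^ 2)) →
      size T ^ 2 * (∫ x in hull T, pval q x ^ 2) ≤ C * (F + size T ^ 2 * B) := by
  obtain ⟨C, hC, hb⟩ := exists_cell_bubble d k σ
  refine ⟨2 * C ^ 2 * (σ ^ 2 + 1), by positivity, fun q hq x₀ T F B hs hF hB hin hout hψ => ?_⟩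
  have hr : 0 < size T / σ := div_pos hs hσ
  obtain ⟨ψ, h1, h2, h3, h4, h5⟩ := hb x₀ _ hr q hq
  have hX := hψ ψ h1 (h2.trans (closedBall_half_subset_interior hr hin))
  simp_rw [mul_comm (pval q _)] at hX
  have habs := absorb hr hF hB hC.le hX h5 h4
  have hle : ∫ x in hull T, pval q x ^ 2
      ≤ ∫ x in Metric.closedBall x₀ (σ * (size T / σ)), pval q x ^ 2 :=
    setIntegral_mono_set (((continuous_pval q).pow 2).continuousOn.integrableOn_compact
      (isCompact_closedBall _ _)) (Filter.Eventually.of_forall fun x => sq_nonneg _)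
      (Filter.Eventually.of_forall hout)
  have e : size T = σ * (size T / σ) := (mul_div_cancel₀ _ hσ.ne').symm
  set r := size T / σ
  have h6 : r ^ 2 * ∫ x in hull T, pval q x ^ 2 ≤ 2 * C ^ 2 * (F + r ^ 2 * B) := by
    calc _ ≤ r ^ 2 * (C * ∫ x, ψ x * pval q x) := by gcongr; exact hle.trans h3
      _ = C * (r ^ 2 * ∫ x, ψ x * pval q x) := by ring
      _ ≤ C * (2 * C * (F + r ^ 2 * B)) := by gcongr
      _ = _ := by ring
  rw [e]
  calc _ = σ ^ 2 * (r ^ 2 * ∫ x in hull T, pval q x ^ 2) := by ring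
    _ ≤ σ ^ 2 * (2 * C ^ 2 * (F + r ^ 2 * B)) := by gcongr
    _ = 2 * C ^ 2 * (σ ^ 2 * F + (σ * r) ^ 2 * B) := by ring
    _ ≤ 2 * C ^ 2 * ((σ ^ 2 + 1) * (F + (σ * r) ^ 2 * B)) :=
        mul_le_mul_of_nonneg_left (mul_add_le_add_one_mul (by positivity) hF (by positivity))
          (by positivity)
    _ = _ := by ring

lemma setIntegral_norm_sq_eq_sum {ι : Type*} [Fintype ι] {f : Eu d → EuclideanSpace ℝ ι}
    {q : ι → MvPolynomial (Fin d) ℝ} (hq : ∀ i x, pval (q i) x = f x i) {S : Set (Eu d)}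
    (hS : IsCompact S) : ∫ x in S, ‖f x‖ ^ 2 = ∑ i, ∫ x in S, pval (q i) x ^ 2 := by
  have hi : ∀ i, IntegrableOn (fun x => pval (q i) x ^ 2) S := fun i =>
    ((continuous_pval (q i)).pow 2).continuousOn.integrableOn_compact hS
  rw [← integral_finsetSum _ fun i _ => hi i]
  refine integral_congr_ae (Filter.Eventually.of_forall fun x => ?_)
  simp only [EuclideanSpace.norm_sq_eq, hq, Real.norm_eq_abs, sq_abs]

/-- The residual `R₁` is bounded componentwise, through the error equation on the element for the
directions of the coordinate axes. -/
lemma exists_resid1_bound (d k : ℕ) (hd : 0 < d) {σ : ℝ} (hσ : 0 < σ) (c ρF : ℝ) :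
    ∃ C : ℝ, 0 < C ∧ ∀ (G : Config d) (ω ωh : ℝ) (K : Geometry.SimplicialComplex ℝ (Eu d))
      (z zh : HSpace G) (P : Finset (Eu d) → PolyField d),
      FluidData G c ρF σ ω ωh k K z zh P → ∀ T, IsCell K T →
      size T ^ 2 * (∫ x in hull T, ‖resid1 c ρF ωh (P T) x‖ ^ 2)
        ≤ C * ((∫ x in hull T, divErr z zh x ^ 2)
          + size T ^ 2 * ∫ x in hull T, ‖accErr ρF ω ωh z zh x‖ ^ 2) := by
  obtain ⟨C, hC, hb⟩ := exists_cell_bound d k hσ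
  refine ⟨d * C * ((c ^ 2 * ρF) ^ 2 + 1), by positivity, fun G ω ωh K z zh P h T hT => ?_⟩
  have hsz : 0 < size T := size_pos (by rw [hT.2]; omega)
  obtain ⟨x₀, hin, hout⟩ := h.exists_inscribed_ball hT
  set D := ∫ x in hull T, divErr z zh x ^ 2
  set A := ∫ x in hull T, ‖accErr ρF ω ωh z zh x‖ ^ 2
  have hD : 0 ≤ D := integral_nonneg fun x => sq_nonneg _
  have hA : 0 ≤ A := integral_nonneg fun x => sq_nonneg _
  rw [setIntegral_norm_sq_eq_sum (pval_resid1Poly c ρF ωh (P T)) (isCompact_hull T),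
    Finset.mul_sum]
  have hi : ∀ i, size T ^ 2 * (∫ x in hull T, pval (resid1Poly c ρF ωh (P T) i) x ^ 2)
      ≤ C * ((c ^ 2 * ρF) ^ 2 * D + size T ^ 2 * A) := fun i => by
    refine hb _ (totalDegree_resid1Poly_le c ρF ωh (h.poly T hT).1 i) x₀ T _ _ hsz
      (by positivity) hA hin hout fun ψ hψ hs => ?_
    have h1 := h.error_direction_cell hT hψ hs (EuclideanSpace.single i 1)
    have h2 := h.abs_error_direction_le hψ (h.hull_ae_le hT) (hs.trans interior_subset)
      (hs.trans (h.interior_hull_subset hT)) (v := EuclideanSpace.single i 1) (by simp)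
    rw [h1] at h2
    refine le_trans (le_of_eq ?_) ((le_abs_self _).trans h2)
    simp [pval_resid1Poly, EuclideanSpace.inner_single_left]
  calc _ ≤ ∑ i : Fin d, C * ((c ^ 2 * ρF) ^ 2 * D + size T ^ 2 * A) :=
        Finset.sum_le_sum fun i _ => hi i
    _ = d * C * ((c ^ 2 * ρF) ^ 2 * D + size T ^ 2 * A) := by simp; ring
    _ ≤ d * C * (((c ^ 2 * ρF) ^ 2 + 1) * (D + size T ^ 2 * A)) :=
        mul_le_mul_of_nonneg_left (mul_add_le_add_one_mul (by positivity) hD (by positivity))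
          (by positivity)
    _ = _ := by ring

/-- The divergence error does not enter here, and `accErr` enters without a power of the size of the
element, since the test fields `∂ᵢψ eⱼ - ∂ⱼψ eᵢ` are first derivatives of `ψ` and divergence-free. -/
lemma exists_resid2_bound (d k : ℕ) (hd : 0 < d) {σ : ℝ} (hσ : 0 < σ) :
    ∃ C : ℝ, 0 < C ∧ ∀ (G : Config d) (c ρF ω ωh : ℝ) (K : Geometry.SimplicialComplex ℝ (Eu d))
      (z zh : HSpace G) (P : Finset (Eu d) → PolyField d),
      FluidData G c ρF σ ω ωh k K z zh P → ∀ T, IsCell K T →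
      size T ^ 2 * (∫ x in hull T, ‖resid2 ρF ωh (P T) x‖ ^ 2)
        ≤ C * ∫ x in hull T, ‖accErr ρF ω ωh z zh x‖ ^ 2 := by
  obtain ⟨C, hC, hb⟩ := exists_cell_bound d k hσ
  refine ⟨(Fintype.card (Pairs d) + 1) * C * 4, by positivity,
    fun G c ρF ω ωh K z zh P h T hT => ?_⟩
  have hsz : 0 < size T := size_pos (by rw [hT.2]; omega)
  obtain ⟨x₀, hin, hout⟩ := h.exists_inscribed_ball hT
  set A := ∫ x in hull T, ‖accErr ρF ω ωh z zh x‖ ^ 2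
  have hA : 0 ≤ A := integral_nonneg fun x => sq_nonneg _
  rw [setIntegral_norm_sq_eq_sum (pval_resid2Poly ρF ωh (P T)) (isCompact_hull T),
    Finset.mul_sum]
  have hi : ∀ p : Pairs d,
      size T ^ 2 * (∫ x in hull T, pval (resid2Poly ρF ωh (P T) p.1.1 p.1.2) x ^ 2)
      ≤ C * (4 * A + size T ^ 2 * 0) := fun p => by
    refine hb _ (totalDegree_resid2Poly_le ρF ωh (h.poly T hT).1 _ _) x₀ T _ _ hsz
      (by positivity) le_rfl hin hout fun ψ hψ hs => ?_
    have h1 := h.error_rot_cell hT hψ hs p.1.1 p.1.2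
    have h2 := abs_error_rot_le ρF ω ωh z zh hψ (h.hull_ae_le hT) (hs.trans interior_subset)
      (hs.trans (h.interior_hull_subset hT)) p.1.1 p.1.2
    rw [h1] at h2
    simpa using (le_abs_self _).trans h2
  calc _ ≤ ∑ p : Pairs d, C * (4 * A + size T ^ 2 * 0) := Finset.sum_le_sum fun i _ => hi i
    _ = Fintype.card (Pairs d) * (C * (4 * A)) := by
        rw [Finset.sum_const, Finset.card_univ, nsmul_eq_mul]; ring
    _ ≤ (Fintype.card (Pairs d) + 1) * (C * (4 * A)) := by gcongr; linarith
    _ = _ := by ring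

end FluidData

/-! ### Jumps across interior facets -/

/-- The bubble function technique on a facet, for a polynomial jump `q` that acts on test functions
as an error with gradient part `F` and zero order part `B`. -/
lemma exists_facet_bound (m k : ℕ) {σ : ℝ} (hσ : 0 < σ) : ∃ C : ℝ, 0 < C ∧
    ∀ (q : MvPolynomial (Fin (m + 1)) ℝ), q.totalDegree ≤ k →
      ∀ (x₀ : Eu (m + 1)) (Θ : Eu (m + 1) ≃ₗᵢ[ℝ] Eu (m + 1)) (s F B : ℝ),
      0 < s → 0 ≤ F → 0 ≤ B →
      (∀ ψ, IsTest ψ → tsupport ψ ⊆ Metric.closedBall x₀ (s / σ / 2) →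
        (∫ y : Eu m, pval q (x₀ + Θ (hyperIncl m y)) * ψ (x₀ + Θ (hyperIncl m y)))
          ≤ √F * √(∫ x, ‖fderiv ℝ ψ x‖ ^ 2) + √B * √(∫ x, ψ x ^ 2)) →
      s * (∫ y in Metric.closedBall (0 : Eu m) s, pval q (x₀ + Θ (hyperIncl m y)) ^ 2)
        ≤ C * (F + s ^ 2 * B) := by
  obtain ⟨C, hC, hb⟩ := exists_facet_bubble m k σ
  refine ⟨2 * C ^ 2 * (σ + σ⁻¹), by positivity, fun q hq x₀ Θ s F B hs hF hB hψ => ?_⟩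
  have hr : 0 < s / σ := div_pos hs hσ
  obtain ⟨ψ, h1, h2, h3, h4, h5⟩ := hb x₀ _ hr Θ q hq
  have hX := hψ ψ h1 h2
  simp_rw [mul_comm (pval q _)] at hX
  have habs := absorb hr hF hB (mul_nonneg hC.le hr.le) hX h5 h4
  rw [mul_div_cancel₀ _ hσ.ne'] at h3
  have e : s = σ * (s / σ) := (mul_div_cancel₀ _ hσ.ne').symm
  set r := s / σ
  set X := ∫ y : Eu m, ψ (x₀ + Θ (hyperIncl m y)) * pval q (x₀ + Θ (hyperIncl m y))
  have hrX : r * X ≤ 2 * C * (F + r ^ 2 * B) := by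
    have : r * (r * X) ≤ r * (2 * C * (F + r ^ 2 * B)) := by nlinarith
    exact le_of_mul_le_mul_left this hr
  have hsX : s * X ≤ 2 * C * (σ * F + σ⁻¹ * (s ^ 2 * B)) := by
    have h6 := mul_le_mul_of_nonneg_left hrX hσ.le
    have h7 : σ⁻¹ * (s ^ 2 * B) = σ * (r ^ 2 * B) := by
      rw [e]; field_simp
    rw [h7]
    calc s * X = σ * (r * X) := by rw [e]; ring
      _ ≤ _ := h6
      _ = _ := by ring
  have hB' : 0 ≤ s ^ 2 * B := by positivity
  have hσ' : 0 < σ⁻¹ := inv_pos.2 hσ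
  calc _ ≤ s * (C * X) := by gcongr
    _ = C * (s * X) := by ring
    _ ≤ C * (2 * C * (σ * F + σ⁻¹ * (s ^ 2 * B))) := by gcongr
    _ ≤ C * (2 * C * ((σ + σ⁻¹) * (F + s ^ 2 * B))) := by
        gcongr
        nlinarith [mul_nonneg hσ.le hB', mul_nonneg hσ'.le hF]
    _ = _ := by ring

lemma abs_setIntegral_mul_test_le_of_subset {d : ℕ} {g ψ : Eu d → ℝ} {W S : Set (Eu d)}
    (hg : Continuous g) (hψ : IsTest ψ) (hW : MeasurableSet W) (hS : IsCompact S)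
    (hWS : ∀ x ∈ W, x ∈ tsupport ψ → x ∈ S) :
    |∫ x in W, g x * ψ x| ≤ √(∫ x in S, g x ^ 2) * √(∫ x, ψ x ^ 2) := by
  have hint : IntegrableOn (fun x => g x ^ 2) S := (hg.pow 2).continuousOn.integrableOn_compact hS
  have hmem : MemLp g 2 (volume.restrict (W ∩ S)) := by
    rw [memLp_two_iff_integrable_sq hg.aestronglyMeasurable]
    exact hint.mono_set inter_subset_right
  have e : ∫ x in W, g x * ψ x = ∫ x in W ∩ S, g x * ψ x := by
    have := setIntegral_eq_of_subset_of_forall_sdiff_eq_zero (μ := volume)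
      (f := fun x => g x * ψ x) hW (inter_subset_left (t := S)) fun x hx => ?_
    · exact this
    rw [image_eq_zero_of_notMem_tsupport fun h => hx.2 ⟨hx.1, hWS x hx.1 h⟩, mul_zero]
  rw [e]
  refine (abs_setIntegral_mul_test_le hmem hψ).trans ?_
  refine mul_le_mul_of_nonneg_right (Real.sqrt_le_sqrt ?_) (Real.sqrt_nonneg _)
  exact setIntegral_mono_set hint (Filter.Eventually.of_forall fun x => sq_nonneg _)
    (Filter.Eventually.of_forall inter_subset_right)

/-- Twice the normal component of the jump `J₁`, as a polynomial. -/
def jump1Poly {d : ℕ} (c ρF : ℝ) (P P' : PolyField d) : MvPolynomial (Fin d) ℝ :=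
  MvPolynomial.C (c ^ 2 * ρF) * (P.div - P'.div)

/-- Twice a component of the jump `J₂` across a facet with normal `n`, as a polynomial. -/
def jump2Poly {d : ℕ} (ρF ωh : ℝ) (P P' : PolyField d) (n : Eu d) (i j : Fin d) :
    MvPolynomial (Fin d) ℝ :=
  MvPolynomial.C (ωh ^ 2 * ρF) *
    (MvPolynomial.C (n j) * (P i - P' i) - MvPolynomial.C (n i) * (P j - P' j))

lemma totalDegree_jump1Poly_le {d k : ℕ} (c ρF : ℝ) {P P' : PolyField d}
    (hP : ∀ i, (P i).totalDegree ≤ k) (hP' : ∀ i, (P' i).totalDegree ≤ k) :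
    (jump1Poly c ρF P P').totalDegree ≤ k :=
  (totalDegree_C_mul_le _ _).trans
    (totalDegree_sub_le_of_le (totalDegree_div_le hP) (totalDegree_div_le hP'))

lemma totalDegree_jump2Poly_le {d k : ℕ} (ρF ωh : ℝ) {P P' : PolyField d} (n : Eu d) (i j : Fin d)
    (hP : ∀ i, (P i).totalDegree ≤ k) (hP' : ∀ i, (P' i).totalDegree ≤ k) :
    (jump2Poly ρF ωh P P' n i j).totalDegree ≤ k :=
  (totalDegree_C_mul_le _ _).trans (totalDegree_sub_le_of_le
    ((totalDegree_C_mul_le _ _).trans (totalDegree_sub_le_of_le (hP i) (hP' i)))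
    ((totalDegree_C_mul_le _ _).trans (totalDegree_sub_le_of_le (hP j) (hP' j))))

lemma norm_jump1_sq {d : ℕ} (c ρF : ℝ) (P P' : PolyField d) {n : Eu d} (hn : ‖n‖ = 1) (x : Eu d) :
    ‖jump1 c ρF P P' n (-n) x‖ ^ 2 = 1 / 4 * pval (jump1Poly c ρF P P') x ^ 2 := by
  have e : jump1 c ρF P P' n (-n) x = (1 / 2 * pval (jump1Poly c ρF P P') x) • n := by
    rw [jump1, jump1Poly, pval_mul, pval_C, pval_sub, smul_neg, ← sub_eq_add_neg, ← sub_smul,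
      smul_smul]
    congr 1; ring
  rw [e, norm_smul, hn, mul_one, Real.norm_eq_abs, sq_abs]
  ring

lemma norm_jump2_sq {d : ℕ} (ρF ωh : ℝ) (P P' : PolyField d) (n x : Eu d) :
    ‖jump2 ρF ωh P P' n (-n) x‖ ^ 2
      = 1 / 4 * ∑ p : Pairs d, pval (jump2Poly ρF ωh P P' n p.1.1 p.1.2) x ^ 2 := by
  rw [EuclideanSpace.norm_sq_eq, Finset.mul_sum]
  refine Finset.sum_congr rfl fun p _ => ?_
  have e : jump2 ρF ωh P P' n (-n) x p
      = 1 / 2 * pval (jump2Poly ρF ωh P P' n p.1.1 p.1.2) x := by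
    rw [jump2Poly, pval_mul, pval_C, pval_sub, pval_mul, pval_C, pval_mul, pval_C, pval_sub,
      pval_sub]
    simp [jump2, cross, PolyField.val]
    ring
  rw [e, Real.norm_eq_abs, sq_abs]
  ring

namespace FluidData

variable {m : ℕ} {G : Config (m + 1)} {c ρF σ ω ωh : ℝ} {k : ℕ}
  {K : Geometry.SimplicialComplex ℝ (Eu (m + 1))} {z zh : HSpace G}
  {P : Finset (Eu (m + 1)) → PolyField (m + 1)} {ψ : Eu (m + 1) → ℝ}
  {l T T' : Finset (Eu (m + 1))} {n n' : Eu (m + 1)}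

/-- A ball about the barycentre of an interior facet, of radius comparable to the size of the
facet, is divided by the facet into a part in `T` and a part in `T'`. -/
lemma facet_geometry (h : FluidData G c ρF σ ω ωh k K z zh P) (hm : 0 < m)
    (hs : IsSharedFacet K l T T') (hn : IsOuterNormal T l n) (hn' : IsOuterNormal T' l n') :
    n' = -n ∧
    (∀ x ∈ Metric.closedBall (bary l) (size l / (σ * (m + 1) / 2)),
      ⟪n, x - bary l⟫_ℝ ≤ 0 → x ∈ hull T) ∧
    (∀ x ∈ Metric.closedBall (bary l) (size l / (σ * (m + 1) / 2)),
      0 ≤ ⟪n, x - bary l⟫_ℝ → x ∈ hull T') ∧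
    Metric.closedBall (bary l) (size l / (σ * (m + 1) / 2) / 2) ⊆ G.Ωf := by
  have hσ := h.σ_pos
  have hl : 0 < size l := size_pos (by rw [hs.facet.2]; omega)
  obtain ⟨x, hx, -⟩ := h.exists_inscribed_ball hs.cell
  obtain ⟨x', hx', -⟩ := h.exists_inscribed_ball hs.cell'
  have hT := size_mono hs.subset
  have hT' := size_mono hs.subset'
  have hnn : n' = -n := outerNormal_eq_neg hs hn hn' (div_pos (hl.trans_le hT) hσ)
    (div_pos (hl.trans_le hT') hσ) hx hx'
  -- `s / σ` is the radius of a ball in an element of size `s`; `halfBall_subset_hull` divides it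
  -- by half the number of vertices of the facet
  have hrad : ∀ s, size l ≤ s → size l / (σ * (m + 1) / 2) ≤ 2 * (s / σ) / (m + 1) := fun s hs => by
    rw [show 2 * (s / σ) / ((m : ℝ) + 1) = s / (σ * (m + 1) / 2) by field_simp]
    gcongr
  have h1 : ∀ x ∈ Metric.closedBall (bary l) (size l / (σ * (m + 1) / 2)),
      ⟪n, x - bary l⟫_ℝ ≤ 0 → x ∈ hull T := fun y hy hny =>
    halfBall_subset_hull (K.indep hs.cell.1) hs.cell.2 hs.facet.2 hs.subset hn hx
      ((mem_closedBall_iff_norm.1 hy).trans (hrad _ hT)) hny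
  have h2 : ∀ x ∈ Metric.closedBall (bary l) (size l / (σ * (m + 1) / 2)),
      0 ≤ ⟪n, x - bary l⟫_ℝ → x ∈ hull T' := fun y hy hny =>
    halfBall_subset_hull (K.indep hs.cell'.1) hs.cell'.2 hs.facet.2 hs.subset' hn' hx'
      ((mem_closedBall_iff_norm.1 hy).trans (hrad _ hT')) (by
        rw [hnn, inner_neg_left]; linarith)
  refine ⟨hnn, h1, h2, ?_⟩
  have hr : 0 < size l / (σ * (m + 1) / 2) := by positivity
  refine (Metric.closedBall_subset_ball (half_lt_self hr)).trans
    (subset_domain Metric.isOpen_ball fun y hy => ?_)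
  have hy' := Metric.ball_subset_closedBall hy
  rcases le_total ⟪n, y - bary l⟫_ℝ 0 with h0 | h0
  · exact hull_subset_closure h.mesh hs.cell (h1 y hy' h0)
  · exact hull_subset_closure h.mesh hs.cell' (h2 y hy' h0)

lemma integrable_facet_mul_test {p : Eu (m + 1) → ℝ} (hp : Continuous p) (hψ : IsTest ψ)
    (x₀ : Eu (m + 1)) (Θ : Eu (m + 1) ≃ₗᵢ[ℝ] Eu (m + 1)) :
    Integrable fun y : Eu m => p (x₀ + Θ (hyperIncl m y)) * ψ (x₀ + Θ (hyperIncl m y)) := by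
  have hJ : Isometry fun y : Eu m => x₀ + Θ (hyperIncl m y) := by
    refine Isometry.of_dist_eq fun s t => ?_
    rw [dist_add_left, Θ.dist_map, (hyperIncl m).dist_map]
  exact ((hp.comp hJ.continuous).mul (hψ.1.continuous.comp hJ.continuous)).integrable_of_hasCompactSupport
    (HasCompactSupport.mul_left (hψ.2.comp_isClosedEmbedding hJ.isClosedEmbedding))

/-- The error equation around an interior facet, tested in the normal direction. -/
lemma facet_error_direction (h : FluidData G c ρF σ ω ωh k K z zh P) (hT : IsCell K T)
    (hT' : IsCell K T') (hn : ‖n‖ = 1) {Θ : Eu (m + 1) ≃ₗᵢ[ℝ] Eu (m + 1)}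
    (hΘ : Θ (EuclideanSpace.single 0 1) = n) (x₀ : Eu (m + 1))
    (hψ : IsTest ψ) (hs : tsupport ψ ⊆ G.Ωf)
    (hi : ∀ᵐ x, x ∈ tsupport ψ → x ∈ {x | ⟪n, x - x₀⟫_ℝ < 0} → x ∈ interior (hull T))
    (hi' : ∀ᵐ x, x ∈ tsupport ψ → x ∉ {x | ⟪n, x - x₀⟫_ℝ < 0} → x ∈ interior (hull T')) :
    ∫ y : Eu m, pval (jump1Poly c ρF (P T) (P T')) (x₀ + Θ (hyperIncl m y))
        * ψ (x₀ + Θ (hyperIncl m y))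
      = (∫ x in {x | ⟪n, x - x₀⟫_ℝ < 0}, ⟪n, resid1 c ρF ωh (P T) x⟫_ℝ * ψ x)
        + (∫ x in {x | ⟪n, x - x₀⟫_ℝ < 0}ᶜ, ⟪n, resid1 c ρF ωh (P T') x⟫_ℝ * ψ x)
        - (c ^ 2 * ρF * (∫ x in G.Ωf, divErr z zh x * fderiv ℝ ψ x n)
        + ∫ x in G.Ωf, ⟪n, accErr ρF ω ωh z zh x⟫_ℝ * ψ x) := by
  have hnn : ⟪n, n⟫_ℝ = 1 := by rw [real_inner_self_eq_norm_sq, hn]; norm_num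
  rw [h.error_direction_piecewise hT hT' hψ hs (measurableSet_halfspace n x₀) hi hi' n,
    setIntegral_halfspace_mul_fderiv hΘ (contDiff_pval _) hψ,
    setIntegral_compl_halfspace_mul_fderiv hΘ (contDiff_pval _) hψ, hnn]
  have hR : ∀ (Q : PolyField (m + 1)) (S : Set (Eu (m + 1))),
      ∫ x in S, ⟪n, resid1 c ρF ωh Q x⟫_ℝ * ψ x
        = c ^ 2 * ρF * (∫ x in S, fderiv ℝ (pval Q.div) x n * ψ x)
          + ωh ^ 2 * ρF * ∫ x in S, ⟪n, Q.val x⟫_ℝ * ψ x := fun Q S => by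
    rw [← integral_const_mul, ← integral_const_mul, ← integral_add
      ((integrable_mul_test (((contDiff_pval _).continuous_fderiv one_ne_zero).clm_apply
        continuous_const) hψ).const_mul _).integrableOn
      ((integrable_mul_test (continuous_const.inner (continuous_val _)) hψ).const_mul
        _).integrableOn]
    simp_rw [inner_resid1, add_mul, mul_assoc _ _ (ψ _)]
  have hJ : ∫ y : Eu m, pval (jump1Poly c ρF (P T) (P T')) (x₀ + Θ (hyperIncl m y))
        * ψ (x₀ + Θ (hyperIncl m y))
      = c ^ 2 * ρF * ((∫ y : Eu m, pval (P T).div (x₀ + Θ (hyperIncl m y))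
          * ψ (x₀ + Θ (hyperIncl m y)))
        - ∫ y : Eu m, pval (P T').div (x₀ + Θ (hyperIncl m y)) * ψ (x₀ + Θ (hyperIncl m y))) := by
    rw [← integral_sub (integrable_facet_mul_test (continuous_pval _) hψ x₀ Θ)
      (integrable_facet_mul_test (continuous_pval _) hψ x₀ Θ), ← integral_const_mul]
    refine integral_congr_ae (Filter.Eventually.of_forall fun y => ?_)
    simp only [jump1Poly, pval_mul, pval_C, pval_sub]
    ring
  rw [hJ, hR, hR]
  ring

/-- The error equation around an interior facet for divergence-free test fields. -/
lemma facet_error_rot (h : FluidData G c ρF σ ω ωh k K z zh P) (hT : IsCell K T)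
    (hT' : IsCell K T') {Θ : Eu (m + 1) ≃ₗᵢ[ℝ] Eu (m + 1)}
    (hΘ : Θ (EuclideanSpace.single 0 1) = n) (x₀ : Eu (m + 1))
    (hψ : IsTest ψ) (hs : tsupport ψ ⊆ G.Ωf)
    (hi : ∀ᵐ x, x ∈ tsupport ψ → x ∈ {x | ⟪n, x - x₀⟫_ℝ < 0} → x ∈ interior (hull T))
    (hi' : ∀ᵐ x, x ∈ tsupport ψ → x ∉ {x | ⟪n, x - x₀⟫_ℝ < 0} → x ∈ interior (hull T'))
    (i j : Fin (m + 1)) :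
    ∫ y : Eu m, pval (jump2Poly ρF ωh (P T) (P T') n i j) (x₀ + Θ (hyperIncl m y))
        * ψ (x₀ + Θ (hyperIncl m y))
      = ((∫ x in G.Ωf, accErr ρF ω ωh z zh x i * fderiv ℝ ψ x (EuclideanSpace.single j 1))
        - ∫ x in G.Ωf, accErr ρF ω ωh z zh x j * fderiv ℝ ψ x (EuclideanSpace.single i 1))
        - (∫ x in {x | ⟪n, x - x₀⟫_ℝ < 0}, pval (resid2Poly ρF ωh (P T) i j) x * ψ x)
        - ∫ x in {x | ⟪n, x - x₀⟫_ℝ < 0}ᶜ, pval (resid2Poly ρF ωh (P T') i j) x * ψ x := by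
  have h1 := h.error_rot_piecewise hT hT' hψ hs (measurableSet_halfspace n x₀) hi hi' i j
  simp only [setIntegral_halfspace_mul_fderiv hΘ (contDiff_pval _) hψ,
    setIntegral_compl_halfspace_mul_fderiv hΘ (contDiff_pval _) hψ, fderiv_pval_single,
    EuclideanSpace.inner_single_right, conj_trivial, one_mul] at h1
  have hR : ∀ (Q : PolyField (m + 1)) (S : Set (Eu (m + 1))),
      ∫ x in S, pval (resid2Poly ρF ωh Q i j) x * ψ x
        = ωh ^ 2 * ρF * ((∫ x in S, pval (MvPolynomial.pderiv i (Q j)) x * ψ x)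
          - ∫ x in S, pval (MvPolynomial.pderiv j (Q i)) x * ψ x) := fun Q S => by
    rw [← integral_sub (integrable_mul_test (continuous_pval _) hψ).integrableOn
      (integrable_mul_test (continuous_pval _) hψ).integrableOn, ← integral_const_mul]
    simp_rw [resid2Poly, pval_mul, pval_C, pval_sub, mul_assoc, sub_mul]
  have hJ : ∫ y : Eu m, pval (jump2Poly ρF ωh (P T) (P T') n i j) (x₀ + Θ (hyperIncl m y))
        * ψ (x₀ + Θ (hyperIncl m y))
      = ωh ^ 2 * ρF * (n j * ((∫ y : Eu m, pval (P T i) (x₀ + Θ (hyperIncl m y))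
          * ψ (x₀ + Θ (hyperIncl m y)))
        - ∫ y : Eu m, pval (P T' i) (x₀ + Θ (hyperIncl m y)) * ψ (x₀ + Θ (hyperIncl m y)))
        - n i * ((∫ y : Eu m, pval (P T j) (x₀ + Θ (hyperIncl m y))
          * ψ (x₀ + Θ (hyperIncl m y)))
        - ∫ y : Eu m, pval (P T' j) (x₀ + Θ (hyperIncl m y))
          * ψ (x₀ + Θ (hyperIncl m y)))) := by
    have hI : ∀ p : MvPolynomial (Fin (m + 1)) ℝ, Integrable fun y : Eu m =>
        pval p (x₀ + Θ (hyperIncl m y)) * ψ (x₀ + Θ (hyperIncl m y)) := fun p =>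
      integrable_facet_mul_test (continuous_pval p) hψ x₀ Θ
    have hI2 : ∀ (a : ℝ) (p p' : MvPolynomial (Fin (m + 1)) ℝ), Integrable fun y : Eu m =>
        a * (pval p (x₀ + Θ (hyperIncl m y)) * ψ (x₀ + Θ (hyperIncl m y))
          - pval p' (x₀ + Θ (hyperIncl m y)) * ψ (x₀ + Θ (hyperIncl m y))) := fun a p p' =>
      ((hI p).sub (hI p')).const_mul a
    rw [← integral_sub (hI _) (hI _), ← integral_sub (hI _) (hI _), ← integral_const_mul,
      ← integral_const_mul, ← integral_sub (hI2 _ _ _) (hI2 _ _ _), ← integral_const_mul]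
    refine integral_congr_ae (Filter.Eventually.of_forall fun y => ?_)
    simp only [jump2Poly, pval_mul, pval_C, pval_sub]
    ring
  rw [hJ, hR, hR]
  linarith

lemma union_ae_le (h : FluidData G c ρF σ ω ωh k K z zh P) (hT : IsCell K T)
    (hT' : IsCell K T') : ∀ᵐ x, x ∈ hull T ∪ hull T' → x ∈ G.Ωf := by
  filter_upwards [h.hull_ae_le hT, h.hull_ae_le hT'] with x h1 h2 h3
  exact h3.elim h1 h2

lemma setIntegral_sq_le_union (h : FluidData G c ρF σ ω ωh k K z zh P) (hT : IsCell K T)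
    (hT' : IsCell K T') {F : Type*} [NormedAddCommGroup F] {f : Eu (m + 1) → F}
    (hf : MemLp f 2 (volume.restrict G.Ωf)) :
    (∫ x in hull T, ‖f x‖ ^ 2) ≤ (∫ x in hull T ∪ hull T', ‖f x‖ ^ 2) ∧
    (∫ x in hull T', ‖f x‖ ^ 2) ≤ ∫ x in hull T ∪ hull T', ‖f x‖ ^ 2 := by
  have hi : IntegrableOn (fun x => ‖f x‖ ^ 2) (hull T ∪ hull T') :=
    (memLp_of_ae_le hf (h.union_ae_le hT hT')).norm.integrable_sq
  exact ⟨setIntegral_mono_set hi (Filter.Eventually.of_forall fun x => sq_nonneg _)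
      (Filter.Eventually.of_forall subset_union_left),
    setIntegral_mono_set hi (Filter.Eventually.of_forall fun x => sq_nonneg _)
      (Filter.Eventually.of_forall subset_union_right)⟩

end FluidData

namespace FluidData

/-! ### Bounds for the jumps -/

variable {m : ℕ} {G : Config (m + 1)} {c ρF σ ω ωh : ℝ} {k : ℕ}
  {K : Geometry.SimplicialComplex ℝ (Eu (m + 1))} {z zh : HSpace G}
  {P : Finset (Eu (m + 1)) → PolyField (m + 1)} {ψ : Eu (m + 1) → ℝ}
  {l T T' : Finset (Eu (m + 1))} {n n' : Eu (m + 1)}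

/-- The position of a test function supported near the barycentre of an interior facet. -/
lemma facet_support (h : FluidData G c ρF σ ω ωh k K z zh P) (hm : 0 < m)
    (hs : IsSharedFacet K l T T') (hn : IsOuterNormal T l n) (hn' : IsOuterNormal T' l n')
    (hψ : tsupport ψ ⊆ Metric.closedBall (bary l) (size l / (σ * (m + 1) / 2) / 2)) :
    tsupport ψ ⊆ G.Ωf ∧ tsupport ψ ⊆ hull T ∪ hull T' ∧
    (∀ x ∈ {x | ⟪n, x - bary l⟫_ℝ < 0}, x ∈ tsupport ψ → x ∈ hull T) ∧
    ∀ x ∈ {x | ⟪n, x - bary l⟫_ℝ < 0}ᶜ, x ∈ tsupport ψ → x ∈ hull T' := by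
  obtain ⟨-, h1, h2, h3⟩ := h.facet_geometry hm hs hn hn'
  have hr : 0 ≤ size l / (σ * (m + 1) / 2) := by
    have := h.σ_pos
    have : 0 ≤ size l := Metric.diam_nonneg
    positivity
  have hb : tsupport ψ ⊆ Metric.closedBall (bary l) (size l / (σ * (m + 1) / 2)) :=
    hψ.trans (Metric.closedBall_subset_closedBall (half_le_self hr))
  refine ⟨hψ.trans h3, fun x hx => ?_, fun x hx hxψ => h1 x (hb hxψ) (le_of_lt hx),
    fun x hx hxψ => h2 x (hb hxψ) (not_lt.1 hx)⟩
  exact (le_total ⟪n, x - bary l⟫_ℝ 0).imp (h1 x (hb hx)) (h2 x (hb hx))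

/-- The integral over an interior facet is bounded by that over a disc in its hyperplane. -/
lemma sqNormFacet_le (hs : IsSharedFacet K l T T') (hn : IsOuterNormal T l n) (hm : 0 < m)
    {Θ : Eu (m + 1) ≃ₗᵢ[ℝ] Eu (m + 1)} (hΘ : Θ (EuclideanSpace.single 0 1) = n)
    {F : Type*} [NormedAddCommGroup F] {f : Eu (m + 1) → F} {g : Eu (m + 1) → ℝ}
    (hg : Continuous g) (hfg : ∀ x, ‖f x‖ ^ 2 = g x) :
    sqNormFacet l f ≤ ∫ y in Metric.closedBall (0 : Eu m) (size l),
      g (bary l + Θ (hyperIncl m y)) := by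
  have hne : l.Nonempty := Finset.card_pos.1 (by rw [hs.facet.2]; omega)
  simp only [sqNormFacet, hfg]
  exact setIntegral_surf_le (exists_hyperIncl_eq hΘ hn.normal hne) hg
    fun x => hfg x ▸ sq_nonneg _

/-- The jump `J₁` is parallel to the normal, so testing in the normal direction suffices. The factor
`δ` is any bound for the sizes of both elements. -/
lemma exists_jump1_bound (m k : ℕ) (hm : 0 < m) {σ : ℝ} (hσ : 0 < σ) (c ρF : ℝ) :
    ∃ C : ℝ, 0 < C ∧ ∀ (G : Config (m + 1)) (ω ωh : ℝ)
      (K : Geometry.SimplicialComplex ℝ (Eu (m + 1)))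
      (z zh : HSpace G) (P : Finset (Eu (m + 1)) → PolyField (m + 1)),
      FluidData G c ρF σ ω ωh k K z zh P → ∀ l T T' n n', IsSharedFacet K l T T' →
      IsOuterNormal T l n → IsOuterNormal T' l n' → ∀ δ, size T ≤ δ → size T' ≤ δ →
      size l * sqNormFacet l (jump1 c ρF (P T) (P T') n n')
        ≤ C * ((∫ x in hull T ∪ hull T', divErr z zh x ^ 2)
          + δ ^ 2 * ∫ x in hull T ∪ hull T', ‖accErr ρF ω ωh z zh x‖ ^ 2) := by
  obtain ⟨C, hC, hb⟩ := exists_facet_bound m k (σ := σ * (m + 1) / 2) (by positivity)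
  obtain ⟨C₁, hC₁, hb₁⟩ := exists_resid1_bound (m + 1) k (Nat.succ_pos m) hσ c ρF
  refine ⟨C * ((c ^ 2 * ρF) ^ 2 + 3 * (2 * C₁ + 1)), by positivity,
    fun G ω ωh K z zh P h l T T' n n' hs hn hn' δ hδ hδ' => ?_⟩
  obtain ⟨Θ, hΘ⟩ := exists_rotation hn.unit
  have hl : 0 < size l := size_pos (by rw [hs.facet.2]; omega)
  have hlT := size_mono hs.subset
  have hlT' := size_mono hs.subset'
  obtain ⟨hD₁, hD₂⟩ := h.setIntegral_sq_le_union hs.cell hs.cell' (memLp_divErr z zh)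
  obtain ⟨hA₁, hA₂⟩ := h.setIntegral_sq_le_union hs.cell hs.cell' (memLp_accErr ρF ω ωh z zh)
  simp only [Real.norm_eq_abs, sq_abs] at hD₁ hD₂
  have h1 := hb₁ G ω ωh K z zh P h T hs.cell
  have h2 := hb₁ G ω ωh K z zh P h T' hs.cell'
  set D := ∫ x in hull T ∪ hull T', divErr z zh x ^ 2
  set A := ∫ x in hull T ∪ hull T', ‖accErr ρF ω ωh z zh x‖ ^ 2
  set B₁ := ∫ x in hull T, ‖resid1 c ρF ωh (P T) x‖ ^ 2
  set B₂ := ∫ x in hull T', ‖resid1 c ρF ωh (P T') x‖ ^ 2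
  have hD : 0 ≤ D := integral_nonneg fun x => sq_nonneg _
  have hA : 0 ≤ A := integral_nonneg fun x => sq_nonneg _
  have hB₁ : 0 ≤ B₁ := integral_nonneg fun x => sq_nonneg _
  have hB₂ : 0 ≤ B₂ := integral_nonneg fun x => sq_nonneg _
  have hJ : size l * (∫ y in Metric.closedBall (0 : Eu m) (size l),
      pval (jump1Poly c ρF (P T) (P T')) (bary l + Θ (hyperIncl m y)) ^ 2)
      ≤ C * ((c ^ 2 * ρF) ^ 2 * D + size l ^ 2 * (3 * (A + B₁ + B₂))) := by
    refine hb _ (totalDegree_jump1Poly_le c ρF (h.poly T hs.cell).1 (h.poly T' hs.cell').1)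
      (bary l) Θ _ _ _ hl (by positivity) (by positivity) fun ψ hψ hsup => ?_
    obtain ⟨hΩ, hun, hT, hT'⟩ := h.facet_support hm hs hn hn' hsup
    have hi : ∀ᵐ x, x ∈ tsupport ψ → x ∈ {x | ⟪n, x - bary l⟫_ℝ < 0} → x ∈ interior (hull T) := by
      filter_upwards [ae_mem_interior T] with x hx h3 h4 using hx (hT x h4 h3)
    have hi' : ∀ᵐ x, x ∈ tsupport ψ → x ∉ {x | ⟪n, x - bary l⟫_ℝ < 0}
        → x ∈ interior (hull T') := by
      filter_upwards [ae_mem_interior T'] with x hx h3 h4 using hx (hT' x h4 h3)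
    rw [h.facet_error_direction hs.cell hs.cell' hn.unit hΘ (bary l) hψ hΩ hi hi']
    have e0 := h.abs_error_direction_le hψ (h.union_ae_le hs.cell hs.cell') hun hΩ hn.unit
    -- the residual on either side of the facet acts on `ψ` as a function on the element
    have side : ∀ (Q : PolyField (m + 1)) (W : Set (Eu (m + 1))) (S : Finset (Eu (m + 1))),
        MeasurableSet W → (∀ x ∈ W, x ∈ tsupport ψ → x ∈ hull S) →
        ∫ x in W, ⟪n, resid1 c ρF ωh Q x⟫_ℝ * ψ x
          ≤ √(∫ x in hull S, ‖resid1 c ρF ωh Q x‖ ^ 2) * √(∫ x, ψ x ^ 2) := by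
      intro Q W S hW hWS
      have hcont := continuous_resid1 c ρF ωh Q
      have hmem : MemLp (resid1 c ρF ωh Q) 2 (volume.restrict (hull S)) :=
        (memLp_two_iff_integrable_sq_norm hcont.aestronglyMeasurable).2
          ((hcont.norm.pow 2).continuousOn.integrableOn_compact (isCompact_hull S))
      refine (le_abs_self _).trans ((abs_setIntegral_mul_test_le_of_subset
        (continuous_const.inner hcont) hψ hW (isCompact_hull S) hWS).trans ?_)
      exact mul_le_mul_of_nonneg_right (Real.sqrt_le_sqrt (setIntegral_inner_sq_le hmem hn.unit))
        (Real.sqrt_nonneg _)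
    have e1 := side (P T) _ T (measurableSet_halfspace n (bary l)) hT
    have e2 := side (P T') _ T' (measurableSet_halfspace n (bary l)).compl hT'
    have e3 := mul_le_mul_of_nonneg_right (sqrt_add_three_le hA hB₁ hB₂)
      (Real.sqrt_nonneg (∫ x, ψ x ^ 2))
    have e4 := neg_le_of_abs_le e0
    linarith
  have hfac := sqNormFacet_le (f := jump1 c ρF (P T) (P T') n n') hs hn hm hΘ
    (((continuous_pval (jump1Poly c ρF (P T) (P T'))).pow 2).const_mul (1 / 4)) fun x => by
      rw [(h.facet_geometry hm hs hn hn').1]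
      exact norm_jump1_sq c ρF (P T) (P T') hn.unit x
  rw [integral_const_mul] at hfac
  have hB : ∀ {s d a b : ℝ}, size l ≤ s → s ≤ δ → 0 ≤ b → 0 ≤ a → d ≤ D → a ≤ A →
      s ^ 2 * b ≤ C₁ * (d + s ^ 2 * a) → size l ^ 2 * b ≤ C₁ * (D + δ ^ 2 * A) := by
    intro s d a b h3 h4 h5 h6 h7 h8 h9
    calc size l ^ 2 * b ≤ s ^ 2 * b := by gcongr
      _ ≤ _ := h9
      _ ≤ _ := by
        have : 0 ≤ s := hl.le.trans h3
        gcongr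
  have b1 := hB hlT hδ hB₁ (integral_nonneg fun x => sq_nonneg _) hD₁ hA₁ h1
  have b2 := hB hlT' hδ' hB₂ (integral_nonneg fun x => sq_nonneg _) hD₂ hA₂ h2
  have b3 : size l ^ 2 * A ≤ δ ^ 2 * A := by
    have := hlT.trans hδ
    gcongr
  have hδA : 0 ≤ δ ^ 2 * A := by positivity
  set I := ∫ y in Metric.closedBall (0 : Eu m) (size l),
    pval (jump1Poly c ρF (P T) (P T')) (bary l + Θ (hyperIncl m y)) ^ 2
  have hI : 0 ≤ I := integral_nonneg fun x => sq_nonneg _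
  calc size l * sqNormFacet l (jump1 c ρF (P T) (P T') n n')
      ≤ size l * I := by
        refine mul_le_mul_of_nonneg_left (hfac.trans ?_) hl.le
        change 1 / 4 * I ≤ I
        linarith
    _ ≤ _ := hJ
    _ ≤ C * ((c ^ 2 * ρF) ^ 2 * (D + δ ^ 2 * A) + 3 * (2 * C₁ + 1) * (D + δ ^ 2 * A)) := by
        refine mul_le_mul_of_nonneg_left (add_le_add ?_ ?_) hC.le
        · gcongr; linarith
        · linarith
    _ = _ := by ring

/-- Each component of the jump `J₂` is tested with its own divergence-free fields. -/
lemma exists_jump2_bound (m k : ℕ) (hm : 0 < m) {σ : ℝ} (hσ : 0 < σ) :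
    ∃ C : ℝ, 0 < C ∧ ∀ (G : Config (m + 1)) (c ρF ω ωh : ℝ)
      (K : Geometry.SimplicialComplex ℝ (Eu (m + 1)))
      (z zh : HSpace G) (P : Finset (Eu (m + 1)) → PolyField (m + 1)),
      FluidData G c ρF σ ω ωh k K z zh P → ∀ l T T' n n', IsSharedFacet K l T T' →
      IsOuterNormal T l n → IsOuterNormal T' l n' →
      size l * sqNormFacet l (jump2 ρF ωh (P T) (P T') n n')
        ≤ C * ∫ x in hull T ∪ hull T', ‖accErr ρF ω ωh z zh x‖ ^ 2 := by
  obtain ⟨C, hC, hb⟩ := exists_facet_bound m k (σ := σ * (m + 1) / 2) (by positivity)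
  obtain ⟨C₂, hC₂, hb₂⟩ := exists_resid2_bound (m + 1) k (Nat.succ_pos m) hσ
  refine ⟨(Fintype.card (Pairs (m + 1)) + 1) * (C * (4 + 6 * C₂)), by positivity,
    fun G c ρF ω ωh K z zh P h l T T' n n' hs hn hn' => ?_⟩
  obtain ⟨Θ, hΘ⟩ := exists_rotation hn.unit
  have hl : 0 < size l := size_pos (by rw [hs.facet.2]; omega)
  have hlT := size_mono hs.subset
  have hlT' := size_mono hs.subset'
  obtain ⟨hA₁, hA₂⟩ := h.setIntegral_sq_le_union hs.cell hs.cell' (memLp_accErr ρF ω ωh z zh)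
  have h1 := hb₂ G c ρF ω ωh K z zh P h T hs.cell
  have h2 := hb₂ G c ρF ω ωh K z zh P h T' hs.cell'
  set A := ∫ x in hull T ∪ hull T', ‖accErr ρF ω ωh z zh x‖ ^ 2
  set B₁ := ∫ x in hull T, ‖resid2 ρF ωh (P T) x‖ ^ 2
  set B₂ := ∫ x in hull T', ‖resid2 ρF ωh (P T') x‖ ^ 2
  have hA : 0 ≤ A := integral_nonneg fun x => sq_nonneg _
  have hB₁ : 0 ≤ B₁ := integral_nonneg fun x => sq_nonneg _
  have hB₂ : 0 ≤ B₂ := integral_nonneg fun x => sq_nonneg _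
  let I (p : Pairs (m + 1)) : ℝ := ∫ y in Metric.closedBall (0 : Eu m) (size l),
    pval (jump2Poly ρF ωh (P T) (P T') n p.1.1 p.1.2) (bary l + Θ (hyperIncl m y)) ^ 2
  have hJ : ∀ p, size l * I p ≤ C * (4 * A + size l ^ 2 * (3 * (0 + B₁ + B₂))) := by
    intro p
    refine hb _ (totalDegree_jump2Poly_le ρF ωh n _ _ (h.poly T hs.cell).1 (h.poly T' hs.cell').1)
      (bary l) Θ _ _ _ hl (by positivity) (by positivity) fun ψ hψ hsup => ?_
    obtain ⟨hΩ, hun, hT, hT'⟩ := h.facet_support hm hs hn hn' hsup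
    have hi : ∀ᵐ x, x ∈ tsupport ψ → x ∈ {x | ⟪n, x - bary l⟫_ℝ < 0} → x ∈ interior (hull T) := by
      filter_upwards [ae_mem_interior T] with x hx h3 h4 using hx (hT x h4 h3)
    have hi' : ∀ᵐ x, x ∈ tsupport ψ → x ∉ {x | ⟪n, x - bary l⟫_ℝ < 0}
        → x ∈ interior (hull T') := by
      filter_upwards [ae_mem_interior T'] with x hx h3 h4 using hx (hT' x h4 h3)
    rw [h.facet_error_rot hs.cell hs.cell' hΘ (bary l) hψ hΩ hi hi']
    have e0 := abs_error_rot_le ρF ω ωh z zh hψ (h.union_ae_le hs.cell hs.cell') hun hΩ p.1.1 p.1.2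
    have side : ∀ (Q : PolyField (m + 1)) (W : Set (Eu (m + 1))) (S : Finset (Eu (m + 1))),
        MeasurableSet W → (∀ x ∈ W, x ∈ tsupport ψ → x ∈ hull S) →
        |∫ x in W, pval (resid2Poly ρF ωh Q p.1.1 p.1.2) x * ψ x|
          ≤ √(∫ x in hull S, ‖resid2 ρF ωh Q x‖ ^ 2) * √(∫ x, ψ x ^ 2) := by
      intro Q W S hW hWS
      refine (abs_setIntegral_mul_test_le_of_subset (continuous_pval _) hψ hW
        (isCompact_hull S) hWS).trans ?_
      refine mul_le_mul_of_nonneg_right (Real.sqrt_le_sqrt ?_) (Real.sqrt_nonneg _)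
      rw [setIntegral_norm_sq_eq_sum (pval_resid2Poly ρF ωh Q) (isCompact_hull S)]
      exact Finset.single_le_sum (f := fun p : Pairs (m + 1) =>
        ∫ x in hull S, pval (resid2Poly ρF ωh Q p.1.1 p.1.2) x ^ 2)
        (fun p _ => integral_nonneg fun x => sq_nonneg _) (Finset.mem_univ p)
    have e1 := neg_le_of_abs_le (side (P T) _ T (measurableSet_halfspace n (bary l)) hT)
    have e2 := neg_le_of_abs_le (side (P T') _ T' (measurableSet_halfspace n (bary l)).compl hT')
    have e3 := mul_le_mul_of_nonneg_right (sqrt_add_three_le le_rfl hB₁ hB₂)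
      (Real.sqrt_nonneg (∫ x, ψ x ^ 2))
    rw [Real.sqrt_zero] at e3
    have e4 := (le_abs_self _).trans e0
    linarith
  have hcont : ∀ p : Pairs (m + 1), Continuous fun x =>
      pval (jump2Poly ρF ωh (P T) (P T') n p.1.1 p.1.2) x ^ 2 := fun p =>
    (continuous_pval _).pow 2
  have hfac := sqNormFacet_le (f := jump2 ρF ωh (P T) (P T') n n') hs hn hm hΘ
    ((continuous_finsetSum Finset.univ fun p _ => hcont p).const_mul (1 / 4)) fun x => by
      rw [(h.facet_geometry hm hs hn hn').1]
      exact norm_jump2_sq ρF ωh (P T) (P T') n x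
  have hJc : Continuous fun y : Eu m => bary l + Θ (hyperIncl m y) :=
    continuous_const.add (Θ.continuous.comp (hyperIncl m).continuous)
  have hint : ∀ p : Pairs (m + 1), IntegrableOn (fun y : Eu m =>
      pval (jump2Poly ρF ωh (P T) (P T') n p.1.1 p.1.2) (bary l + Θ (hyperIncl m y)) ^ 2)
      (Metric.closedBall 0 (size l)) := fun p =>
    ((hcont p).comp hJc).continuousOn.integrableOn_compact (isCompact_closedBall _ _)
  rw [integral_const_mul, integral_finsetSum _ fun p _ => hint p] at hfac
  have hB : ∀ {s a b : ℝ}, size l ≤ s → 0 ≤ b → a ≤ A →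
      s ^ 2 * b ≤ C₂ * a → size l ^ 2 * b ≤ C₂ * A := by
    intro s a b h3 h4 h5 h6
    calc size l ^ 2 * b ≤ s ^ 2 * b := by gcongr
      _ ≤ _ := h6
      _ ≤ _ := by gcongr
  have b1 := hB hlT hB₁ hA₁ h1
  have b2 := hB hlT' hB₂ hA₂ h2
  have hI : ∀ p, 0 ≤ I p := fun p => integral_nonneg fun x => sq_nonneg _
  have hsum : 0 ≤ ∑ p, I p := Finset.sum_nonneg fun p _ => hI p
  calc size l * sqNormFacet l (jump2 ρF ωh (P T) (P T') n n')
      ≤ size l * ∑ p, I p := by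
        refine mul_le_mul_of_nonneg_left (hfac.trans ?_) hl.le
        change 1 / 4 * ∑ p, I p ≤ _
        linarith
    _ = ∑ p, size l * I p := Finset.mul_sum _ _ _
    _ ≤ ∑ p : Pairs (m + 1), C * ((4 + 6 * C₂) * A) := by
        refine Finset.sum_le_sum fun p _ => (hJ p).trans (mul_le_mul_of_nonneg_left ?_ hC.le)
        linarith
    _ = Fintype.card (Pairs (m + 1)) * (C * (4 + 6 * C₂) * A) := by
        rw [Finset.sum_const, Finset.card_univ, nsmul_eq_mul]; ring
    _ ≤ (Fintype.card (Pairs (m + 1)) + 1) * (C * (4 + 6 * C₂) * A) := by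
        gcongr; linarith
    _ = _ := by ring

end FluidData

/-! ### Weighted norms -/

section Weights

variable {d : ℕ}

lemma wF_pos {c ρF : ℝ} (hc : 0 < c) (hρF : 0 < ρF) : 0 < wF c ρF :=
  Real.rpow_pos_of_pos (by positivity) _

lemma wFE_nonneg {c ρF ωh : ℝ} (hρF : 0 < ρF) : 0 ≤ wFE c ρF ωh :=
  le_min (by positivity) (by positivity)

lemma wFE_le_wF {c ρF ωh : ℝ} (hc : 0 < c) (hρF : 0 < ρF) : wFE c ρF ωh ≤ wF c ρF :=
  (min_le_left _ _).trans (div_le_self (wF_pos hc hρF).le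
    (Real.one_le_sqrt.2 one_le_two))

lemma sqNorm_smul {F : Type*} [NormedAddCommGroup F] [NormedSpace ℝ F] (a : ℝ) (S : Set (Eu d))
    (f : Eu d → F) : sqNorm S (fun x => a • f x) = a ^ 2 * ∫ x in S, ‖f x‖ ^ 2 := by
  simp only [sqNorm, norm_smul, mul_pow, Real.norm_eq_abs, sq_abs, integral_const_mul]

lemma sqNormFacet_smul {F : Type*} [NormedAddCommGroup F] [NormedSpace ℝ F] (a : ℝ)
    (l : Finset (Eu d)) (f : Eu d → F) :
    sqNormFacet l (fun x => a • f x) = a ^ 2 * sqNormFacet l f := by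
  simp only [sqNormFacet, norm_smul, mul_pow, Real.norm_eq_abs, sq_abs, integral_const_mul]

lemma errDiv_eq {G : Config d} {c ρF : ℝ} (hρF : 0 < ρF) (z zh : HSpace G) (S : Set (Eu d)) :
    errDiv c ρF z.τ zh.τ S = c ^ 2 * ρF * ∫ x in S, divErr z zh x ^ 2 := by
  rw [show c ^ 2 * ρF = (c * √ρF) ^ 2 by rw [mul_pow, Real.sq_sqrt hρF.le]]
  have h := sqNorm_smul (c * √ρF) S (divErr z zh)
  simp only [smul_eq_mul, Real.norm_eq_abs, sq_abs] at h
  exact h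

lemma errAcc_eq {G : Config d} (c ρF ω ωh : ℝ) (z zh : HSpace G) (S : Set (Eu d)) :
    errAcc c ρF ω ωh z.τ zh.τ S
      = (wF c ρF ^ (-(1 / 2) : ℝ)) ^ 2 * ∫ x in S, ‖accErr ρF ω ωh z zh x‖ ^ 2 :=
  sqNorm_smul _ S (accErr ρF ω ωh z zh)

/-- An estimate for unweighted norms implies one for weighted norms. -/
lemma weighted_estimate {v w C δ D A a b X : ℝ} (hv : 0 ≤ v) (hvw : v ≤ w) (hC : 0 < C)
    (hD : 0 ≤ D) (hA : 0 ≤ A) (ha : 0 < a) (hb : 0 < b) (hX : X ≤ C * (D + δ ^ 2 * A)) :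
    v ^ 2 * X ≤ w ^ 2 * (C * (a⁻¹ + δ ^ 2 * b⁻¹)) * (a * D + b * A) := by
  have h1 : D + δ ^ 2 * A ≤ (a⁻¹ + δ ^ 2 * b⁻¹) * (a * D + b * A) := by
    have e : (a⁻¹ + δ ^ 2 * b⁻¹) * (a * D + b * A)
        = D + δ ^ 2 * A + (a⁻¹ * (b * A) + δ ^ 2 * b⁻¹ * (a * D)) := by
      field_simp; ring
    rw [e]
    have : 0 ≤ a⁻¹ * (b * A) + δ ^ 2 * b⁻¹ * (a * D) := by positivity
    linarith
  calc v ^ 2 * X ≤ v ^ 2 * (C * (D + δ ^ 2 * A)) := by gcongr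
    _ ≤ w ^ 2 * (C * ((a⁻¹ + δ ^ 2 * b⁻¹) * (a * D + b * A))) := by gcongr
    _ = _ := by ring

lemma size_le_diam_closure {K : Geometry.SimplicialComplex ℝ (Eu d)} {Ω : Set (Eu d)}
    (hK : IsMesh K Ω) (hΩ : Bornology.IsBounded Ω) {T : Finset (Eu d)} (hT : IsCell K T) :
    size T ≤ Metric.diam (closure Ω) :=
  Metric.diam_mono (hull_subset_closure hK hT) hΩ.closure

end Weights

end ElastoAcoustic

end

theorem lemma5p4 (d : ℕ) (hd : d = 2 ∨ d = 3) (k : ℕ) (hk : 1 ≤ k) (σ : ℝ) (hσ : 0 < σ)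
    (G : ElastoAcoustic.Config d) (c ρF : ℝ) (hc : 0 < c) (hρF : 0 < ρF) :
    ∃ C : ℝ, 0 < C ∧
      ∀ (m : ElastoAcoustic.Material d) (D : ElastoAcoustic.SolidSpaces G)
        (K : Geometry.SimplicialComplex ℝ (ElastoAcoustic.Eu d)),
        ElastoAcoustic.IsMesh K G.Ωf → ElastoAcoustic.IsShapeRegular σ K →
      ∀ (ω ωh : ℝ), 0 < ω → 0 < ωh →
      ∀ (z zh : ElastoAcoustic.HSpace G),
        ElastoAcoustic.IsEigen G m c ρF Set.univ (ω ^ 2) z →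
        ElastoAcoustic.IsEigen G m c ρF (ElastoAcoustic.Hh G D K k) (ωh ^ 2) zh →
      ∀ P : Finset (ElastoAcoustic.Eu d) → ElastoAcoustic.PolyField d,
        ElastoAcoustic.IsPiecewisePoly K k zh.τ.fn P →
      (∀ T, ElastoAcoustic.IsCell K T →
        ElastoAcoustic.size T ^ 2 * ElastoAcoustic.sqNorm (ElastoAcoustic.hull T)
            (fun x => ElastoAcoustic.wF c ρF • ElastoAcoustic.resid1 c ρF ωh (P T) x)
          ≤ C * (ElastoAcoustic.errDiv c ρF z.τ zh.τ (ElastoAcoustic.hull T)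
            + ElastoAcoustic.errAcc c ρF ω ωh z.τ zh.τ (ElastoAcoustic.hull T)) ∧
        ElastoAcoustic.size T ^ 2 * ElastoAcoustic.sqNorm (ElastoAcoustic.hull T)
            (fun x => ElastoAcoustic.wF c ρF • ElastoAcoustic.resid2 ρF ωh (P T) x)
          ≤ C * ElastoAcoustic.errAcc c ρF ω ωh z.τ zh.τ (ElastoAcoustic.hull T)) ∧
      (∀ l T T' n n', ElastoAcoustic.IsSharedFacet K l T T' →
        ElastoAcoustic.IsOuterNormal T l n → ElastoAcoustic.IsOuterNormal T' l n' →
        ElastoAcoustic.size l * ElastoAcoustic.sqNormFacet l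
            (fun x => ElastoAcoustic.wFE c ρF ωh •
              ElastoAcoustic.jump1 c ρF (P T) (P T') n n' x)
          ≤ C * (ElastoAcoustic.errDiv c ρF z.τ zh.τ
              (ElastoAcoustic.hull T ∪ ElastoAcoustic.hull T')
            + ElastoAcoustic.errAcc c ρF ω ωh z.τ zh.τ
              (ElastoAcoustic.hull T ∪ ElastoAcoustic.hull T')) ∧
        ElastoAcoustic.size l * ElastoAcoustic.sqNormFacet l
            (fun x => ElastoAcoustic.wFE c ρF ωh •
              ElastoAcoustic.jump2 ρF ωh (P T) (P T') n n' x)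
          ≤ C * ElastoAcoustic.errAcc c ρF ω ωh z.τ zh.τ
              (ElastoAcoustic.hull T ∪ ElastoAcoustic.hull T')) := by
  open ElastoAcoustic in
  obtain ⟨m, hm, rfl⟩ : ∃ m, 0 < m ∧ d = m + 1 := ⟨d - 1, by omega, by omega⟩
  obtain ⟨C₁, hC₁, h₁⟩ := FluidData.exists_resid1_bound (m + 1) k (Nat.succ_pos m) hσ c ρF
  obtain ⟨C₂, hC₂, h₂⟩ := FluidData.exists_resid2_bound (m + 1) k (Nat.succ_pos m) hσ
  obtain ⟨C₃, hC₃, h₃⟩ := FluidData.exists_jump1_bound m k hm hσ c ρF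
  obtain ⟨C₄, hC₄, h₄⟩ := FluidData.exists_jump2_bound m k hm hσ
  have hw := wF_pos hc hρF
  have ha : 0 < c ^ 2 * ρF := by positivity
  have hb : 0 < (wF c ρF ^ (-(1 / 2) : ℝ)) ^ 2 := pow_pos (Real.rpow_pos_of_pos hw _) 2
  -- the sizes of all elements are at most the diameter of the fluid domain
  set δ := Metric.diam (closure G.Ωf)
  set w := wF c ρF
  set a := c ^ 2 * ρF
  set b := (w ^ (-(1 / 2) : ℝ)) ^ 2
  have hδ : 0 ≤ δ := Metric.diam_nonneg
  -- the bounds without divergence error are instances of `weighted_estimate` with `D = 0`, `δ = 1`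
  let κ : ℝ → ℝ := fun C => w ^ 2 * (C * (a⁻¹ + δ ^ 2 * b⁻¹))
  let κ' : ℝ → ℝ := fun C => w ^ 2 * (C * (a⁻¹ + 1 ^ 2 * b⁻¹))
  have hκ : ∀ C, 0 < C → 0 < κ C := fun C hC => by positivity
  have hκ' : ∀ C, 0 < C → 0 < κ' C := fun C hC => by positivity
  have p1 := hκ C₁ hC₁
  have p2 := hκ' C₂ hC₂
  have p3 := hκ C₃ hC₃
  have p4 := hκ' C₄ hC₄
  refine ⟨κ C₁ + κ' C₂ + κ C₃ + κ' C₄, by positivity, ?_⟩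
  intro M _ K hK hreg ω ωh hω _ z zh hz _ P hP
  have h : FluidData G c ρF σ ω ωh k K z zh P := ⟨hρF, hσ, hω, hK, hreg, ⟨M, hz⟩, hP⟩
  have hsz : ∀ {T}, IsCell K T → size T ≤ δ := fun hT =>
    size_le_diam_closure hK G.fluid_domain.isBounded hT
  have hD : ∀ S, 0 ≤ ∫ x in S, divErr z zh x ^ 2 := fun S =>
    MeasureTheory.integral_nonneg fun x => sq_nonneg _
  have hA : ∀ S, 0 ≤ ∫ x in S, ‖accErr ρF ω ωh z zh x‖ ^ 2 := fun S =>
    MeasureTheory.integral_nonneg fun x => sq_nonneg _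
  simp only [sqNorm_smul, sqNormFacet_smul, errDiv_eq hρF, errAcc_eq]
  refine ⟨fun T hT => ⟨?_, ?_⟩, fun l T T' n n' hs hn hn' => ⟨?_, ?_⟩⟩
  · have e := h₁ G ω ωh K z zh P h T hT
    have e' : C₁ * ((∫ x in hull T, divErr z zh x ^ 2)
        + size T ^ 2 * ∫ x in hull T, ‖accErr ρF ω ωh z zh x‖ ^ 2)
        ≤ C₁ * ((∫ x in hull T, divErr z zh x ^ 2)
        + δ ^ 2 * ∫ x in hull T, ‖accErr ρF ω ωh z zh x‖ ^ 2) := by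
      have h0 : 0 ≤ size T := Metric.diam_nonneg
      have := hsz hT
      have := hA (hull T)
      gcongr
    have f := weighted_estimate hw.le le_rfl hC₁ (hD _) (hA _) ha hb (e.trans e')
    rw [mul_left_comm]
    refine f.trans (mul_le_mul_of_nonneg_right ?_ ?_)
    · change κ C₁ ≤ _
      linarith
    · exact add_nonneg (mul_nonneg ha.le (hD _)) (mul_nonneg hb.le (hA _))
  · have e := h₂ G c ρF ω ωh K z zh P h T hT
    have f := weighted_estimate (D := 0) (δ := 1) hw.le le_rfl hC₂ le_rfl (hA (hull T)) ha hb
      (e.trans_eq (by ring))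
    rw [mul_left_comm]
    rw [mul_zero, zero_add] at f
    refine f.trans (mul_le_mul_of_nonneg_right ?_ (mul_nonneg hb.le (hA _)))
    change κ' C₂ ≤ _
    linarith
  · have e := h₃ G ω ωh K z zh P h l T T' n n' hs hn hn' δ (hsz hs.cell) (hsz hs.cell')
    have f := weighted_estimate (wFE_nonneg hρF) (wFE_le_wF (ωh := ωh) hc hρF) hC₃ (hD _) (hA _)
      ha hb e
    rw [mul_left_comm]
    refine f.trans (mul_le_mul_of_nonneg_right ?_ ?_)
    · change κ C₃ ≤ _
      linarith
    · exact add_nonneg (mul_nonneg ha.le (hD _)) (mul_nonneg hb.le (hA _))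
  · have e := h₄ G c ρF ω ωh K z zh P h l T T' n n' hs hn hn'
    have f := weighted_estimate (D := 0) (δ := 1) (wFE_nonneg hρF) (wFE_le_wF (ωh := ωh) hc hρF)
      hC₄ le_rfl (hA (hull T ∪ hull T')) ha hb (e.trans_eq (by ring))
    rw [mul_left_comm]
    rw [mul_zero, zero_add] at f
    refine f.trans (mul_le_mul_of_nonneg_right ?_ (mul_nonneg hb.le (hA _)))
    change κ' C₄ ≤ _
    linarith
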